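/- **Setting.** The *PV-symbols* are the names of polynomial-time functions in Cobham's algebra. They are generated from $0$, $x+1$, $x+y$, $x\cdot y$, truncated subtraction, $\lfloor x/2\rfloor$, $|x|$ (the number of binary digits of $x$), $x\#y=2^{|x|\cdot|y|}$ and the projections by composition and by bounded recursion on notation: from $g,h_0,h_1,k$ one obtains $f$ with $f(0,\vec x)=\min(g(\vec x),k(0,\vec x))$, $f(2y,\vec x)=\min(h_0(y,f(y,\vec x),\vec x),k(2y,\vec x))$ for $y\neq0$, and $f(2y+1,\vec x)=\min(h_1(y,f(y,\vec x),\vec x),k(2y+1,\vec x))$. The theory $\mathrm{PV}_1$ is the first-order theory in the language of all PV-symbols, $=$ and $\le$, whose axioms are Buss' 32 axioms BASIC, the defining equations of the remaining symbols, and induction for all quantifier-free formulas (with parameters). "$\mathrm{PV}_1$ proves $\sigma$" means that the sentence $\sigma$ is a logical consequence of these axioms, i.e. that it holds in all their models. Inside $\mathrm{PV}_1$: $p$ is *prime* if $p>1$ and every divisor of $p$ is $1$ or $p$. $1^{(r)}$ denotes the number whose binary expansion consists of $r$ ones; that is, $R$ has the form $1^{(r)}$ iff $R+1=1\#R$, and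 then $r=|R|$. A (low degree) polynomial over $\mathbb{Z}/p$ is a finite sequence $a_0,\dots,a_d$ of numbers less than $p$ with $a_d\neq0$ (the zero polynomial being the empty sequence), coded by the number $\sum_{i\le d}a_i2^{|p|\cdot i}$, i.e. by concatenating the binary expansions of the $a_i$, each padded to $|p|$ digits; its degree is $d$. Addition and multiplication of polynomials modulo $p$ are given by PV-symbols computing each coefficient by the usual formula, and $f\mid g$ means that $fh=g$ for some polynomial $h$ over $\mathbb{Z}/p$. For polynomials over $\mathbb{Z}/p$, $\gcd(f,g)=h$ means that $h$ is monic, $h\mid f$, $h\mid g$, every polynomial $t$ with $t\mid f$ and $t\mid g$ satisfies $t\mid h$, and $h=uf+vg$ for some polynomials $u,v$. Finally $\phi(r)$ is the value at $1^{(r)}$ of the PV-symbol that counts the numbers $i$, $1\le i\le r$, with $\gcd(i,r)=1$. **Theorem.** There is a binary PV-symbol $\mathrm{Cyc}$, written $\mathrm{Cyc}_p(R)=\mathrm{Cyc}(p,R)$, such that $\mathrm{PV}_1$ proves: for every prime $p$ and every number of the form $1^{(r)}$ with $1\le r<p$, the value $Q_r=\mathrm{Cyc}_p(1^{(r)})$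 is a polynomial over $\mathbb{Z}/p$ of degree $\phi(r)$ such that $$Q_r\mid \mathcal X^r-1\qquad\text{and}\qquad \gcd(Q_r,\mathcal X^{r'}-1)=1\ \text{ for all } r'\in\{1,\dots,r-1\}.$$ -/

import Mathlib

open FirstOrder FirstOrder.Language

namespace PVArith

/-! ### The language of PV

Function symbols are the descriptions of functions in Cobham's algebra: every polynomial-time
computable function is named by some symbol, and every symbol names such a function. -/

/-- PV-symbols of a given arity. -/
inductive Sym : ℕ → Type
  /-- the constant `0` -/
  | zero : Sym 0
  /-- the successor `x + 1` -/
  | succ : Sym 1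
  /-- addition -/
  | add : Sym 2
  /-- multiplication -/
  | mul : Sym 2
  /-- truncated subtraction -/
  | sub : Sym 2
  /-- `⌊x / 2⌋` -/
  | half : Sym 1
  /-- `|x|`, the number of binary digits of `x` -/
  | size : Sym 1
  /-- `x # y = 2 ^ (|x| * |y|)` -/
  | smash : Sym 2
  /-- projections -/
  | proj {n : ℕ} (i : Fin n) : Sym n
  /-- composition `f (g₀ (x), …, gₖ₋₁ (x))` -/
  | comp {n k : ℕ} (f : Sym k) (g : Fin k → Sym n) : Sym n
  /-- Bounded recursion on notation. The recursion variable is the first argument: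
  `f (0, x) = min (g (x), k (0, x))`,
  `f (2y, x) = min (h₀ (y, f (y, x), x), k (2y, x))` for `y ≠ 0`, and
  `f (2y + 1, x) = min (h₁ (y, f (y, x), x), k (2y + 1, x))`. -/
  | lrn {n : ℕ} (g : Sym n) (h₀ h₁ : Sym (n + 2)) (k : Sym (n + 1)) : Sym (n + 1)

/-- The only relation symbol besides equality. -/
inductive Rel : ℕ → Type
  | le : Rel 2

/-- The language of PV. -/
def lang : FirstOrder.Language.{0, 0} := ⟨Sym, Rel⟩

/-- Terms in the bound variables `&0, …, &(n - 1)`. -/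
abbrev Tm (n : ℕ) : Type := lang.Term (Empty ⊕ Fin n)

/-- Formulas in the bound variables `&0, …, &(n - 1)`; a further quantifier binds `&n`. -/
abbrev Fm (n : ℕ) : Type := lang.BoundedFormula Empty n

section Terms

variable {n k : ℕ}

/-- Application of a PV-symbol to terms. -/
def ap (f : Sym k) (t : Fin k → Tm n) : Tm n := Term.func (show lang.Functions k from f) t

instance : Zero (Tm n) := ⟨ap .zero ![]⟩
instance : Add (Tm n) := ⟨fun s t => ap .add ![s, t]⟩
instance : Mul (Tm n) := ⟨fun s t => ap .mul ![s, t]⟩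
instance : Sub (Tm n) := ⟨fun s t => ap .sub ![s, t]⟩

def S (t : Tm n) : Tm n := ap .succ ![t]
def half (t : Tm n) : Tm n := ap .half ![t]
def size (t : Tm n) : Tm n := ap .size ![t]
def smash (s t : Tm n) : Tm n := ap .smash ![s, t]

instance : One (Tm n) := ⟨S 0⟩

def le (s t : Tm n) : Fm n := Relations.boundedFormula₂ (show lang.Relations 2 from Rel.le) s t
def eq (s t : Tm n) : Fm n := s =' t
def lt (s t : Tm n) : Fm n := le (S s) t

/-- The variable `&i`. -/
def x (i : Fin n) : Tm n := &i

/-- A term regarded as a term in one more variable. -/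
def up (t : Tm n) : Tm (n + 1) := t.relabel (Sum.map id Fin.castSucc)

/-- The innermost bound variable. -/
def new : Tm (n + 1) := x (Fin.last n)

/-- `r = min (s, t)`. -/
def isMin (r s t : Tm n) : Fm n := (le s t ⟹ eq r s) ⊓ (le t s ⟹ eq r t)

/-- The instance `φ (t₀, …, tₖ₋₁)` of a formula `φ` in `k` free variables. -/
def inst (φ : lang.Formula (Fin k)) (t : Fin k → Tm n) : Fm n :=
  BoundedFormula.relabel (n := n) (k := 0) (id : Empty ⊕ Fin n → Empty ⊕ Fin n) (φ.subst t)

/-- Universal closure. -/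
def close (φ : Fm n) : lang.Sentence := φ.alls

end Terms

/-! ### The theory PV₁ -/

/-- The non-logical postulates of `PV₁`: Buss' 32 formulas BASIC, the defining equations of the
remaining PV-symbols, and induction for open (that is, quantifier-free) formulas. -/
inductive Postulate : lang.Sentence → Prop
  -- BASIC
  | basic1 : Postulate (close (n := 2) (le (x 1) (x 0) ⟹ le (x 1) (S (x 0))))
  | basic2 : Postulate (close (n := 1) ∼(eq (x 0) (S (x 0))))
  | basic3 : Postulate (close (n := 1) (le 0 (x 0)))
  | basic4 : Postulate (close (n := 2)
      ((le (x 0) (x 1) ⊓ ∼(eq (x 0) (x 1))) ⇔ le (S (x 0)) (x 1)))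
  | basic5 : Postulate (close (n := 1) (∼(eq (x 0) 0) ⟹ ∼(eq (S 1 * x 0) 0)))
  | basic6 : Postulate (close (n := 2) (le (x 1) (x 0) ⊔ le (x 0) (x 1)))
  | basic7 : Postulate (close (n := 2) (le (x 0) (x 1) ⊓ le (x 1) (x 0) ⟹ eq (x 0) (x 1)))
  | basic8 : Postulate (close (n := 3) (le (x 0) (x 1) ⊓ le (x 1) (x 2) ⟹ le (x 0) (x 2)))
  | basic9 : Postulate (close (n := 0) (eq (size 0) 0))
  | basic10 : Postulate (close (n := 1) (∼(eq (x 0) 0) ⟹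
      eq (size (S 1 * x 0)) (S (size (x 0))) ⊓ eq (size (S (S 1 * x 0))) (S (size (x 0)))))
  | basic11 : Postulate (close (n := 0) (eq (size 1) 1))
  | basic12 : Postulate (close (n := 2) (le (x 0) (x 1) ⟹ le (size (x 0)) (size (x 1))))
  | basic13 : Postulate (close (n := 2)
      (eq (size (smash (x 0) (x 1))) (S (size (x 0) * size (x 1)))))
  | basic14 : Postulate (close (n := 1) (eq (smash 0 (x 0)) 1))
  | basic15 : Postulate (close (n := 1) (∼(eq (x 0) 0) ⟹
      eq (smash 1 (S 1 * x 0)) (S 1 * smash 1 (x 0)) ⊓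
      eq (smash 1 (S (S 1 * x 0))) (S 1 * smash 1 (x 0))))
  | basic16 : Postulate (close (n := 2) (eq (smash (x 0) (x 1)) (smash (x 1) (x 0))))
  | basic17 : Postulate (close (n := 3)
      (eq (size (x 0)) (size (x 1)) ⟹ eq (smash (x 0) (x 2)) (smash (x 1) (x 2))))
  | basic18 : Postulate (close (n := 4)
      (eq (size (x 0)) (size (x 1) + size (x 2)) ⟹
        eq (smash (x 0) (x 3)) (smash (x 1) (x 3) * smash (x 2) (x 3))))
  | basic19 : Postulate (close (n := 2) (le (x 0) (x 0 + x 1)))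
  | basic20 : Postulate (close (n := 2) (le (x 0) (x 1) ⊓ ∼(eq (x 0) (x 1)) ⟹
      le (S (S 1 * x 0)) (S 1 * x 1) ⊓ ∼(eq (S (S 1 * x 0)) (S 1 * x 1))))
  | basic21 : Postulate (close (n := 2) (eq (x 0 + x 1) (x 1 + x 0)))
  | basic22 : Postulate (close (n := 1) (eq (x 0 + 0) (x 0)))
  | basic23 : Postulate (close (n := 2) (eq (x 0 + S (x 1)) (S (x 0 + x 1))))
  | basic24 : Postulate (close (n := 3) (eq ((x 0 + x 1) + x 2) (x 0 + (x 1 + x 2))))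
  | basic25 : Postulate (close (n := 3) (le (x 0 + x 1) (x 0 + x 2) ⇔ le (x 1) (x 2)))
  | basic26 : Postulate (close (n := 1) (eq (x 0 * 0) 0))
  | basic27 : Postulate (close (n := 2) (eq (x 0 * S (x 1)) (x 0 * x 1 + x 0)))
  | basic28 : Postulate (close (n := 2) (eq (x 0 * x 1) (x 1 * x 0)))
  | basic29 : Postulate (close (n := 3) (eq (x 0 * (x 1 + x 2)) (x 0 * x 1 + x 0 * x 2)))
  | basic30 : Postulate (close (n := 3)
      (le 1 (x 0) ⟹ (le (x 0 * x 1) (x 0 * x 2) ⇔ le (x 1) (x 2))))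
  | basic31 : Postulate (close (n := 1)
      (∼(eq (x 0) 0) ⟹ eq (size (x 0)) (S (size (half (x 0))))))
  | basic32 : Postulate (close (n := 2)
      (eq (x 0) (half (x 1)) ⇔ (eq (S 1 * x 0) (x 1) ⊔ eq (S (S 1 * x 0)) (x 1))))
  -- truncated subtraction
  | sub_le : Postulate (close (n := 2) (le (x 0) (x 1) ⟹ eq (x 0 - x 1) 0))
  | sub_ge : Postulate (close (n := 2) (le (x 1) (x 0) ⟹ eq (x 1 + (x 0 - x 1)) (x 0)))
  -- projections and composition
  | proj {n : ℕ} (i : Fin n) : Postulate (close (eq (ap (.proj i) x) (x i)))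
  | comp {n k : ℕ} (f : Sym k) (g : Fin k → Sym n) :
      Postulate (close (eq (ap (.comp f g) x) (ap f fun i => ap (g i) x)))
  -- bounded recursion on notation
  | lrn_zero {n : ℕ} (g : Sym n) (h₀ h₁ : Sym (n + 2)) (k : Sym (n + 1)) :
      Postulate (close (n := n)
        (isMin (ap (.lrn g h₀ h₁ k) (Fin.cons 0 x)) (ap g x) (ap k (Fin.cons 0 x))))
  | lrn_even {n : ℕ} (g : Sym n) (h₀ h₁ : Sym (n + 2)) (k : Sym (n + 1)) :
      Postulate (close (n := n + 1) (∼(eq (x 0) 0) ⟹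
        isMin (ap (.lrn g h₀ h₁ k) (Fin.cons (x 0 + x 0) fun i => x i.succ))
          (ap h₀ (Fin.cons (x 0) (Fin.cons (ap (.lrn g h₀ h₁ k) x) fun i => x i.succ)))
          (ap k (Fin.cons (x 0 + x 0) fun i => x i.succ))))
  | lrn_odd {n : ℕ} (g : Sym n) (h₀ h₁ : Sym (n + 2)) (k : Sym (n + 1)) :
      Postulate (close (n := n + 1)
        (isMin (ap (.lrn g h₀ h₁ k) (Fin.cons (S (x 0 + x 0)) fun i => x i.succ))
          (ap h₁ (Fin.cons (x 0) (Fin.cons (ap (.lrn g h₀ h₁ k) x) fun i => x i.succ)))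
          (ap k (Fin.cons (S (x 0 + x 0)) fun i => x i.succ))))
  -- induction on the first variable of an open formula, the other variables being parameters
  | induction {n : ℕ} (φ : lang.Formula (Fin (n + 1))) (hφ : φ.IsQF) :
      Postulate (close (n := n)
        (inst φ (Fin.cons 0 x) ⟹
          (∀' (inst φ (Fin.cons new fun i => up (x i)) ⟹
            inst φ (Fin.cons (S new) fun i => up (x i)))) ⟹
          ∀' inst φ (Fin.cons new fun i => up (x i))))

/-- The first-order theory `PV₁`. -/
def PV1 : lang.Theory := {σ | Postulate σ}

/-- `PV₁` proves the sentence `σ`: it is a logical consequence of the postulates of `PV₁`. -/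
def PV1Proves (σ : lang.Sentence) : Prop := PV1 ⊨ᵇ σ

/-! ### The PV-symbols used in the statement -/

namespace Sym

variable {n : ℕ}

instance : Zero (Sym n) := ⟨comp zero ![]⟩
instance : Add (Sym n) := ⟨fun a b => comp add ![a, b]⟩
instance : Mul (Sym n) := ⟨fun a b => comp mul ![a, b]⟩
instance : Sub (Sym n) := ⟨fun a b => comp sub ![a, b]⟩

/-- Composition with symbols of arity one, two, and so on. -/
def ap1 (f : Sym 1) (a : Sym n) : Sym n := comp f ![a]
def ap2 (f : Sym 2) (a b : Sym n) : Sym n := comp f ![a, b]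
def ap3 (f : Sym 3) (a b c : Sym n) : Sym n := comp f ![a, b, c]
def ap4 (f : Sym 4) (a b c d : Sym n) : Sym n := comp f ![a, b, c, d]
def ap5 (f : Sym 5) (a b c d e : Sym n) : Sym n := comp f ![a, b, c, d, e]

instance : One (Sym n) := ⟨ap1 succ 0⟩

/-- `cond (c, a, b)` is `a` if `c = 0` and `b` otherwise. -/
def cond : Sym 3 := lrn (proj 0) (proj 3) (proj 3) (proj 1 + proj 2)

/-- `shift (u, y) = ⌊y / 2 ^ |u|⌋`. -/
def shift : Sym 2 := lrn (proj 0) (ap1 half (proj 1)) (ap1 half (proj 1)) (proj 1)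

/-- `low (u, y) = y mod 2 ^ |u|`. -/
def low : Sym 2 := proj 1 - ap2 shift (proj 0) (proj 1) * ap2 smash 1 (proj 0)

/-- `t - m` if `m ≤ t`, and `t` otherwise. -/
def redOnce : Sym 2 :=
  ap3 cond (ap1 succ (proj 0) - proj 1) (proj 0) (proj 0 - proj 1)

/-- The remainder `rem (y, m) = y mod m`, by long division in binary. -/
def rem : Sym 2 :=
  lrn 0 (ap2 redOnce (proj 1 + proj 1) (proj 2))
    (ap2 redOnce (ap1 succ (proj 1 + proj 1)) (proj 2)) (proj 0)

/-- `coef (I, p, f)` is the coefficient of index `|I|` of the polynomial coded by `f`: the block of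
`|p|` binary digits of `f` that starts at position `|p| * |I|`. -/
def coef : Sym 3 :=
  ap2 low (proj 1) (ap2 shift (ap1 half (ap2 smash (proj 1) (proj 0))) (proj 2))

/-- `convSum (I, K, p, f, g) = ∑ j < |I|, f_j * g_{|K| - j} mod p`. -/
def convSum : Sym 5 :=
  let step : Sym 6 :=
    ap2 rem (proj 1 + ap3 coef (proj 0) (proj 3) (proj 4) *
      ap3 coef (ap2 shift (proj 0) (proj 2)) (proj 3) (proj 5)) (proj 3)
  lrn 0 step step (proj 2)

/-- The coefficient `∑ j ≤ |I|, f_j * g_{|I| - j} mod p` of index `|I|` of `f * g`;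
the arguments are `(I, p, f, g)`. -/
def mulCoef : Sym 4 :=
  ap5 convSum (ap1 succ (proj 0 + proj 0)) (proj 0) (proj 1) (proj 2) (proj 3)

/-- The coefficient `f_i + g_i mod p` of index `i = |I|` of `f + g`; the arguments are
`(I, p, f, g)`. -/
def addCoef : Sym 4 :=
  ap2 rem (ap3 coef (proj 0) (proj 1) (proj 2) + ap3 coef (proj 0) (proj 1) (proj 3)) (proj 1)

/-- The code `∑ j < |I|, c_j * 2 ^ (|p| * j)` of the polynomial with coefficients
`c_j = c (J, p, f, g)`, where `|J| = j`; the arguments are `(I, p, f, g)`. -/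
def tabulate (c : Sym 4) : Sym 4 :=
  let step : Sym 5 :=
    proj 1 + ap4 c (proj 0) (proj 2) (proj 3) (proj 4) * ap2 smash (proj 2) (proj 0)
  lrn 0 step step (ap2 smash (proj 1) (proj 0))

/-- The polynomial with the coefficients `c` up to (and excluding) index `|f| + |g|`; the arguments
are `(p, f, g)`. -/
def assemble (c : Sym 4) : Sym 3 :=
  ap4 (tabulate c) (ap1 half (ap2 smash (proj 1) 1 * ap2 smash (proj 2) 1))
    (proj 0) (proj 1) (proj 2)

/-- The product of the polynomials `f` and `g` over `ℤ/p`; the arguments are `(p, f, g)`. -/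
def polyMul : Sym 3 := assemble mulCoef

/-- The sum of the polynomials `f` and `g` over `ℤ/p`; the arguments are `(p, f, g)`. -/
def polyAdd : Sym 3 := assemble addCoef

/-- The polynomial `X ^ |R| - 1` over `ℤ/p`, for `|R| ≥ 1`; the arguments are `(p, R)`. -/
def xPowSubOne : Sym 2 := ap2 smash (proj 0) (proj 1) + (proj 0 - 1)

/-- The greatest `d ≤ |D|` that divides both `i` and `r`; the arguments are `(D, i, r)`. -/
def gcdUpTo : Sym 3 :=
  let d : Sym 4 := ap1 succ (ap1 size (proj 0))
  let step : Sym 4 := ap3 cond (ap2 rem (proj 2) d + ap2 rem (proj 3) d) d (proj 1)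
  lrn 0 step step (ap1 size (proj 0))

/-- The number of `i` with `1 ≤ i ≤ |I|` and `gcd (i, |R|) = 1`; the arguments are `(I, R)`. -/
def totUpTo : Sym 2 :=
  let gcd : Sym 3 :=
    ap3 gcdUpTo (proj 2) (ap1 succ (ap1 size (proj 0))) (ap1 size (proj 2))
  let step : Sym 3 := proj 1 + ap3 cond (gcd - 1) 1 0
  lrn 0 step step (ap1 size (proj 0))

/-- Euler's totient `φ (|R|)`. -/
def tot : Sym 1 := ap2 totUpTo (proj 0) (proj 0)

end Sym

/-! ### The formulas used in the statement -/

section Formulas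

variable {n : ℕ}

/-- `a` divides `b`. -/
def dvd (a b : Tm n) : Fm n := ∃' eq (up a * new) (up b)

/-- `p` is a prime. -/
def prime (p : Tm n) : Fm n :=
  lt 1 p ⊓ ∀' (le new (up p) ⟹ dvd new (up p) ⟹ eq new 1 ⊔ eq new (up p))

/-- The binary expansion of `R` consists of ones only, that is, `R + 1 = 2 ^ |R|`. -/
def allOnes (R : Tm n) : Fm n := eq (S R) (smash 1 R)

def coef (I p f : Tm n) : Tm n := ap Sym.coef ![I, p, f]
def polyMul (p f g : Tm n) : Tm n := ap Sym.polyMul ![p, f, g]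
def polyAdd (p f g : Tm n) : Tm n := ap Sym.polyAdd ![p, f, g]
def xPowSubOne (p R : Tm n) : Tm n := ap Sym.xPowSubOne ![p, R]
def tot (R : Tm n) : Tm n := ap Sym.tot ![R]

/-- `f` codes a polynomial over `ℤ/p`: all its coefficients are less than `p`. The sequence
`a₀, …, a_d` of coefficients, with `a_d ≠ 0`, is coded by the concatenation of the binary expansions
of the `a_i`, each one written with `|p|` digits; the zero polynomial is coded by `0`. -/
def isPoly (p f : Tm n) : Fm n := ∀' (le new (up f) ⟹ lt (coef new (up p) (up f)) (up p))

/-- The nonzero polynomial `f` has degree `d`: it has `d + 1` blocks of `|p|` digits,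
`|p| * d < |f| ≤ |p| * (d + 1)`. -/
def hasDegree (p f d : Tm n) : Fm n :=
  lt (size p * d) (size f) ⊓ le (size f) (size p * S d)

/-- `f` is monic: for some index `|D|` the coefficient of `f` is one and there are no further
coefficients. -/
def monic (p f : Tm n) : Fm n :=
  ∃' (eq (coef new (up p) (up f)) 1 ⊓ lt (up f) (smash (up p) (S (new + new))))

/-- The polynomial `f` divides the polynomial `g` over `ℤ/p`. -/
def polyDvd (p f g : Tm n) : Fm n :=
  ∃' (isPoly (up p) new ⊓ eq (polyMul (up p) (up f) new) (up g))

/-- `h` is the greatest common divisor of the polynomials `f` and `g` over `ℤ/p`: it is a monic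
common divisor, every common divisor divides it, and it is a combination `u * f + v * g`. -/
def isPolyGcd (p f g h : Tm n) : Fm n :=
  isPoly p h ⊓ monic p h ⊓ polyDvd p h f ⊓ polyDvd p h g ⊓
    (∀' (isPoly (up p) new ⊓ polyDvd (up p) new (up f) ⊓ polyDvd (up p) new (up g) ⟹
      polyDvd (up p) new (up h))) ⊓
    (∃' ∃' (isPoly (up (up p)) (up new) ⊓ isPoly (up (up p)) new ⊓
      eq (polyAdd (up (up p)) (polyMul (up (up p)) (up new) (up (up f)))
        (polyMul (up (up p)) new (up (up g)))) (up (up h))))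

end Formulas

end PVArith

namespace PVArith

/-! Provability is logical consequence, so the sentence is checked in an arbitrary model `M` of PV₁
and the algebra is carried out inside `M`. The only induction available is open induction, so each
inductive claim must be expressed by PV-functions with parameters. `Def` is the calculus of
functions and predicates expressible in this way. It is closed under bounded recursion on lengths
(`exists_recursion`) and under quantifiers bounded by a length (`Def.ball`). Degrees, exponents and
indices range over `Len M`, the lengths `|a|`. They form an initial segment of `M` closed under
addition and multiplication, with Bézout's theorem and hence the usual arithmetic of coprimality.
For a prime `p`, the residues form a field (`exists_inverse`) and the codes of polynomials form an
integral domain `Poly p`.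

Roots of unity are not used; the polynomials come from a recursion. Put Q_1 = 1 - X, and for a prime
q let Q_{nq} = Q_n(X^q) if q divides n and Q_{nq} = Q_n(X^q) / Q_n(X) otherwise. The recursion
follows a chain of divisors 1 = n_0 | n_1 | ... of r, each multiplied by the least factor that keeps
it a divisor of r; such a factor is prime, and r steps reach r (`factor_spec`, `chain_spec`). Signs
are chosen so that all constant coefficients are 1. Then exact division is division of power series,
and divisibility becomes an equation between PV-functions (`dvd_iff`), so induction applies to it.

The invariant `IsCyclo` consists of divisibilities only. With f at stage n and h = (1 - X^n) / f: f
divides 1 - X^n; f divides f(X^s) and h divides h(X^s) for s coprime to n; and f·(1 - X^m) divides 1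
- X^n for each proper divisor m of n. The second property with s = q makes the division in the
recursion exact; `IsCyclo.subst_of_dvd` and `IsCyclo.quo_of_not_dvd` propagate the invariant.

Coprimality follows from the congruence (1 - X^{mk}) / (1 - X^m) ≡ k modulo 1 - X^m. Here 0 < k ≤ r
< p, so k is invertible, and Q_r divides the left side for mk = r; thus Q_r is coprime to 1 - X^m
for proper divisors m of r (`isCoprime_bin_of_mul_dvd`). Any other exponent below r is reduced to
its gcd with r by Bézout (`IsCyclo.isCoprime`). The degree obeys the same recursion as Euler's
function: φ(nq) = q·φ(n) if q divides n, and φ(nq) + φ(n) = q·φ(n) otherwise. -/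

/-- A model of `PV₁`. -/
class PVModel (M : Type*) extends lang.Structure M where
  models : M ⊨ PV1

/-- The function on a model named by a PV-symbol. -/
def ev {M : Type*} [PVModel M] {n : ℕ} (s : Sym n) (v : Fin n → M) : M :=
  Structure.funMap (L := lang) (show lang.Functions n from s) v

namespace PVModel

variable {M : Type*} [PVModel M]

theorem realize_of_postulate {σ : lang.Sentence} (h : Postulate σ) : M ⊨ σ :=
  (PVModel.models (M := M)).realize_of_mem σ h

instance (priority := 50) : Zero M := ⟨ev .zero ![]⟩
instance (priority := 50) : One M := ⟨ev .succ ![0]⟩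
instance (priority := 50) : Add M := ⟨fun a b => ev .add ![a, b]⟩
instance (priority := 50) : Mul M := ⟨fun a b => ev .mul ![a, b]⟩
instance (priority := 50) : Sub M := ⟨fun a b => ev .sub ![a, b]⟩
instance (priority := 50) : LE M :=
  ⟨fun a b => Structure.RelMap (L := lang) (show lang.Relations 2 from Rel.le) ![a, b]⟩

/-- `|a|` -/
def sz (a : M) : M := ev .size ![a]

/-- `⌊a / 2⌋` -/
def hf (a : M) : M := ev .half ![a]

/-- `a # b` -/
def sm (a b : M) : M := ev .smash ![a, b]

/-! ### Evaluation of terms and formulas in a model -/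

section Realize

variable {n : ℕ} {v : Empty → M} {xs : Fin n → M} (s t : Tm n)

@[simp] theorem realize_ap {k : ℕ} (f : Sym k) (t : Fin k → Tm n) :
    (ap f t).realize (Sum.elim v xs) = ev f fun i => (t i).realize (Sum.elim v xs) := rfl

theorem comp_vec1 {α β : Type*} (f : α → β) (a : α) : (fun i => f (![a] i)) = ![f a] := by
  funext i; fin_cases i; rfl

theorem comp_vec2 {α β : Type*} (f : α → β) (a b : α) :
    (fun i => f (![a, b] i)) = ![f a, f b] := by
  funext i; fin_cases i <;> rfl

theorem comp_vec3 {α β : Type*} (f : α → β) (a b c : α) :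
    (fun i => f (![a, b, c] i)) = ![f a, f b, f c] := by
  funext i; fin_cases i <;> rfl

theorem comp_vec4 {α β : Type*} (f : α → β) (a b c d : α) :
    (fun i => f (![a, b, c, d] i)) = ![f a, f b, f c, f d] := by
  funext i; fin_cases i <;> rfl

theorem comp_vec5 {α β : Type*} (f : α → β) (a b c d e : α) :
    (fun i => f (![a, b, c, d, e] i)) = ![f a, f b, f c, f d, f e] := by
  funext i; fin_cases i <;> rfl

@[simp] theorem realize_x (i : Fin n) : (x i).realize (Sum.elim v xs) = xs i := rfl

@[simp] theorem realize_zero : (0 : Tm n).realize (Sum.elim v xs) = 0 :=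
  congrArg (ev Sym.zero) (funext fun i => i.elim0)

@[simp] theorem realize_S :
    (S t).realize (Sum.elim v xs) = ev .succ ![t.realize (Sum.elim v xs)] :=
  congrArg (ev Sym.succ) (comp_vec1 _ _)

@[simp] theorem realize_one : (1 : Tm n).realize (Sum.elim v xs) = 1 :=
  (realize_S 0).trans (by rw [realize_zero]; rfl)

@[simp] theorem realize_add : (s + t).realize (Sum.elim v xs) =
    s.realize (Sum.elim v xs) + t.realize (Sum.elim v xs) :=
  congrArg (ev Sym.add) (comp_vec2 _ _ _)

@[simp] theorem realize_mul : (s * t).realize (Sum.elim v xs) =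
    s.realize (Sum.elim v xs) * t.realize (Sum.elim v xs) :=
  congrArg (ev Sym.mul) (comp_vec2 _ _ _)

@[simp] theorem realize_sub : (s - t).realize (Sum.elim v xs) =
    s.realize (Sum.elim v xs) - t.realize (Sum.elim v xs) :=
  congrArg (ev Sym.sub) (comp_vec2 _ _ _)

@[simp] theorem realize_half :
    (half t).realize (Sum.elim v xs) = hf (t.realize (Sum.elim v xs)) :=
  congrArg (ev Sym.half) (comp_vec1 _ _)

@[simp] theorem realize_size :
    (size t).realize (Sum.elim v xs) = sz (t.realize (Sum.elim v xs)) :=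
  congrArg (ev Sym.size) (comp_vec1 _ _)

@[simp] theorem realize_smash : (smash s t).realize (Sum.elim v xs) =
    sm (s.realize (Sum.elim v xs)) (t.realize (Sum.elim v xs)) :=
  congrArg (ev Sym.smash) (comp_vec2 _ _ _)

@[simp] theorem realize_eq : (eq s t).Realize v xs ↔
    s.realize (Sum.elim v xs) = t.realize (Sum.elim v xs) := by
  simp [eq]

@[simp] theorem realize_le : (le s t).Realize v xs ↔
    s.realize (Sum.elim v xs) ≤ t.realize (Sum.elim v xs) := by
  exact BoundedFormula.realize_rel₂

@[simp] theorem realize_isMin (r : Tm n) : (isMin r s t).Realize v xs ↔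
    (s.realize (Sum.elim v xs) ≤ t.realize (Sum.elim v xs) →
      r.realize (Sum.elim v xs) = s.realize (Sum.elim v xs)) ∧
    (t.realize (Sum.elim v xs) ≤ s.realize (Sum.elim v xs) →
      r.realize (Sum.elim v xs) = t.realize (Sum.elim v xs)) := by
  simp [isMin]

@[simp] theorem realize_up (xs : Fin (n + 1) → M) :
    (up t).realize (Sum.elim v xs) = t.realize (Sum.elim v fun i => xs i.castSucc) := by
  simp only [up, Term.realize_relabel]
  congr 1
  funext i
  cases i <;> rfl

@[simp] theorem realize_new (xs : Fin (n + 1) → M) :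
    (new : Tm (n + 1)).realize (Sum.elim v xs) = xs (Fin.last n) := rfl

theorem realize_close {φ : Fm n} : M ⊨ close φ ↔ ∀ xs : Fin n → M, φ.Realize default xs :=
  BoundedFormula.realize_alls

theorem realize_inst {k : ℕ} (φ : lang.Formula (Fin k)) (t : Fin k → Tm n) :
    (inst φ t).Realize v xs ↔ φ.Realize fun i => (t i).realize (Sum.elim v xs) := by
  rw [inst, BoundedFormula.realize_relabel, BoundedFormula.realize_subst]
  exact iff_of_eq (congrArg₂ _ rfl (Subsingleton.elim _ _))

theorem holds_of_postulate {φ : Fm n} (h : Postulate (close φ)) (xs : Fin n → M) :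
    φ.Realize default xs :=
  realize_close.1 (realize_of_postulate h) xs

end Realize

/-! ### Addition and order in a model -/

theorem add_zero' (a : M) : a + 0 = a := by
  simpa using holds_of_postulate .basic22 ![a]

theorem suc_eq (a : M) : ev .succ ![a] = a + 1 := by
  have h : a + ev .succ ![0] = ev .succ ![a + 0] := by
    simpa using holds_of_postulate .basic23 ![a, 0]
  rw [add_zero'] at h
  exact h.symm

theorem add_comm' (a b : M) : a + b = b + a := by
  simpa using holds_of_postulate .basic21 ![a, b]

theorem succ_le_iff' (a b : M) : a + 1 ≤ b ↔ a ≤ b ∧ a ≠ b := by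
  simpa [suc_eq, iff_comm] using holds_of_postulate .basic4 ![a, b]

theorem le_total' (a b : M) : a ≤ b ∨ b ≤ a := by
  simpa [or_comm] using holds_of_postulate .basic6 ![a, b]

theorem le_antisymm' (a b : M) : a ≤ b → b ≤ a → a = b := by
  simpa using holds_of_postulate .basic7 ![a, b]

theorem le_trans' (a b c : M) : a ≤ b → b ≤ c → a ≤ c := by
  simpa using holds_of_postulate .basic8 ![a, b, c]

noncomputable instance (priority := 50) : LinearOrder M where
  le_refl a := (le_total' a a).elim id id
  le_trans := le_trans'
  le_antisymm := le_antisymm'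
  le_total := le_total'
  toDecidableLE := Classical.decRel _

noncomputable instance (priority := 50) : AddCommMonoid M where
  add_assoc a b c := by simpa using holds_of_postulate .basic24 ![a, b, c]
  zero_add a := by rw [add_comm', add_zero']
  add_zero := add_zero'
  add_comm := add_comm'
  nsmul := nsmulRec

theorem add_le_add_iff' (a b c : M) : a + b ≤ a + c ↔ b ≤ c := by
  simpa using holds_of_postulate .basic25 ![a, b, c]

instance (priority := 50) : IsOrderedCancelAddMonoid M where
  add_le_add_left b c h a := by rw [add_comm b, add_comm c]; exact (add_le_add_iff' a b c).2 h
  le_of_add_le_add_left a b c h := (add_le_add_iff' a b c).1 h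

theorem sub_of_le {a b : M} : a ≤ b → a - b = 0 := by
  simpa using holds_of_postulate .sub_le ![a, b]

theorem add_sub_of_le {a b : M} : b ≤ a → b + (a - b) = a := by
  simpa using holds_of_postulate .sub_ge ![a, b]

theorem zero_le' (a : M) : 0 ≤ a := by
  simpa using holds_of_postulate .basic3 ![a]

instance (priority := 50) : CanonicallyOrderedAdd M where
  exists_add_of_le {a b} h := ⟨b - a, (add_sub_of_le h).symm⟩
  le_self_add a b := by simpa using holds_of_postulate .basic19 ![a, b]
  le_add_self a b := by rw [add_comm]; simpa using holds_of_postulate .basic19 ![a, b]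

instance (priority := 50) : OrderedSub M where
  tsub_le_iff_right a b c := by
    rcases le_total' a b with h | h
    · rw [sub_of_le h]
      exact iff_of_true (zero_le' c) (h.trans (le_add_of_nonneg_left (zero_le' c)))
    · conv_rhs => rw [← add_sub_of_le h, add_comm c b]
      exact (add_le_add_iff' b _ c).symm

instance (priority := 50) : NeZero (1 : M) where
  out h := by
    have : (0 : M) ≠ ev .succ ![0] := by simpa using holds_of_postulate .basic2 ![(0 : M)]
    exact this h.symm

theorem lt_iff_succ_le {a b : M} : a < b ↔ a + 1 ≤ b := by
  rw [succ_le_iff', lt_iff_le_and_ne]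

theorem lt_succ_iff {a b : M} : a < b + 1 ↔ a ≤ b := by
  rw [lt_iff_succ_le, add_le_add_iff_right]

theorem lt_one_iff' {a : M} : a < 1 ↔ a = 0 := by
  rw [← zero_add (1 : M), lt_succ_iff, nonpos_iff_eq_zero]

theorem one_le_iff {a : M} : 1 ≤ a ↔ a ≠ 0 := by
  rw [← not_lt, lt_one_iff']

/-! ### Evaluation of composed symbols -/

section Eval

variable {n k : ℕ} (v : Fin n → M)

@[simp] theorem ev_proj (i : Fin n) : ev (.proj i) v = v i := by
  simpa using holds_of_postulate (.proj i) v

@[simp] theorem ev_comp (f : Sym k) (g : Fin k → Sym n) :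
    ev (.comp f g) v = ev f fun i => ev (g i) v := by
  simpa using holds_of_postulate (.comp f g) v

@[simp] theorem ev_zero : ev (0 : Sym n) v = 0 :=
  (ev_comp v _ _).trans (congrArg (ev Sym.zero) (funext fun i => i.elim0))

@[simp] theorem ev_add (a b : Sym n) : ev (a + b) v = ev a v + ev b v :=
  (ev_comp v _ _).trans (congrArg (ev Sym.add) (comp_vec2 (ev · v) a b))

@[simp] theorem ev_mul (a b : Sym n) : ev (a * b) v = ev a v * ev b v :=
  (ev_comp v _ _).trans (congrArg (ev Sym.mul) (comp_vec2 (ev · v) a b))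

@[simp] theorem ev_sub (a b : Sym n) : ev (a - b) v = ev a v - ev b v :=
  (ev_comp v _ _).trans (congrArg (ev Sym.sub) (comp_vec2 (ev · v) a b))

@[simp] theorem ev_ap1 (f : Sym 1) (a : Sym n) : ev (f.ap1 a) v = ev f ![ev a v] :=
  (ev_comp v _ _).trans (congrArg (ev f) (comp_vec1 (ev · v) a))

@[simp] theorem ev_ap2 (f : Sym 2) (a b : Sym n) :
    ev (f.ap2 a b) v = ev f ![ev a v, ev b v] :=
  (ev_comp v _ _).trans (congrArg (ev f) (comp_vec2 (ev · v) a b))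

@[simp] theorem ev_ap3 (f : Sym 3) (a b c : Sym n) :
    ev (f.ap3 a b c) v = ev f ![ev a v, ev b v, ev c v] :=
  (ev_comp v _ _).trans (congrArg (ev f) (comp_vec3 (ev · v) a b c))

@[simp] theorem ev_ap4 (f : Sym 4) (a b c d : Sym n) :
    ev (f.ap4 a b c d) v = ev f ![ev a v, ev b v, ev c v, ev d v] :=
  (ev_comp v _ _).trans (congrArg (ev f) (comp_vec4 (ev · v) a b c d))

@[simp] theorem ev_ap5 (f : Sym 5) (a b c d e : Sym n) :
    ev (f.ap5 a b c d e) v = ev f ![ev a v, ev b v, ev c v, ev d v, ev e v] :=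
  (ev_comp v _ _).trans (congrArg (ev f) (comp_vec5 (ev · v) a b c d e))

@[simp] theorem ev_succ (a : M) : ev .succ ![a] = a + 1 := suc_eq a
@[simp] theorem ev_half (a : M) : ev .half ![a] = hf a := rfl
@[simp] theorem ev_size (a : M) : ev .size ![a] = sz a := rfl
@[simp] theorem ev_smash (a b : M) : ev .smash ![a, b] = sm a b := rfl

@[simp] theorem ev_one : ev (1 : Sym n) v = 1 := by
  show ev (Sym.ap1 .succ 0) v = 1
  simp

theorem isMin_iff {a b c : M} : (b ≤ c → a = b) ∧ (c ≤ b → a = c) ↔ a = min b c := by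
  constructor
  · rintro ⟨h₁, h₂⟩
    rcases le_total b c with h | h
    · rw [min_eq_left h, h₁ h]
    · rw [min_eq_right h, h₂ h]
  · rintro rfl
    exact ⟨min_eq_left, min_eq_right⟩

theorem realize_cons {m : ℕ} {v : Empty → M} {xs : Fin m → M} (t : Tm m) (ts : Fin n → Tm m) :
    (fun i => ((Fin.cons t ts : Fin (n + 1) → Tm m) i).realize (Sum.elim v xs)) =
      Fin.cons (t.realize (Sum.elim v xs)) fun i => (ts i).realize (Sum.elim v xs) := by
  funext i
  cases i using Fin.cases <;> rfl

variable (g : Sym n) (h₀ h₁ : Sym (n + 2)) (b : Sym (n + 1))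

theorem ev_lrn_zero : ev (.lrn g h₀ h₁ b) (Fin.cons 0 v) =
    min (ev g v) (ev b (Fin.cons 0 v)) := by
  rw [← isMin_iff]
  simpa [realize_cons] using holds_of_postulate (.lrn_zero g h₀ h₁ b) v

theorem ev_lrn_even {a : M} (ha : a ≠ 0) : ev (.lrn g h₀ h₁ b) (Fin.cons (a + a) v) =
    min (ev h₀ (Fin.cons a (Fin.cons (ev (.lrn g h₀ h₁ b) (Fin.cons a v)) v)))
      (ev b (Fin.cons (a + a) v)) := by
  rw [← isMin_iff]
  simpa [realize_cons, ha] using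
    holds_of_postulate (.lrn_even g h₀ h₁ b) (Fin.cons a v : Fin (n + 1) → M)

theorem ev_lrn_odd (a : M) : ev (.lrn g h₀ h₁ b) (Fin.cons (a + a + 1) v) =
    min (ev h₁ (Fin.cons a (Fin.cons (ev (.lrn g h₀ h₁ b) (Fin.cons a v)) v)))
      (ev b (Fin.cons (a + a + 1) v)) := by
  rw [← isMin_iff]
  simpa [realize_cons] using
    holds_of_postulate (.lrn_odd g h₀ h₁ b) (Fin.cons a v : Fin (n + 1) → M)

end Eval

/-- Induction for equations between PV-functions. -/
theorem ev_induction {n : ℕ} (s t : Sym (n + 1)) (c : Fin n → M)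
    (h0 : ev s (Fin.cons 0 c) = ev t (Fin.cons 0 c))
    (ih : ∀ a, ev s (Fin.cons a c) = ev t (Fin.cons a c) →
      ev s (Fin.cons (a + 1) c) = ev t (Fin.cons (a + 1) c)) (a : M) :
    ev s (Fin.cons a c) = ev t (Fin.cons a c) := by
  let φ : lang.Formula (Fin (n + 1)) :=
    Term.equal (Term.func (show lang.Functions _ from s) Term.var)
      (Term.func (show lang.Functions _ from t) Term.var)
  have hφ : φ.IsQF := (BoundedFormula.IsAtomic.equal _ _).isQF
  have hr (v : Fin (n + 1) → M) : φ.Realize v ↔ ev s v = ev t v :=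
    Formula.realize_equal
  have := holds_of_postulate (M := M) (.induction φ hφ) c
  simp only [BoundedFormula.realize_imp, BoundedFormula.realize_all, realize_inst, hr,
    realize_cons] at this
  simpa using this (by simpa using h0) (by simpa using ih) a

end PVModel
end PVArith

namespace PVArith
open PVModel

/-! ### Functions definable by PV-symbols with parameters -/

/-- A type whose elements are described by finitely many elements of `M`. -/
class Coded (M : Type*) (Γ : Type*) where
  arity : ℕ
  code : Γ → Fin arity → M

/-- Functions into `M` that are given by PV-symbols, with parameters from `M`. -/
inductive PVFun {M Γ : Type*} [PVModel M] [Coded M Γ] : (Γ → M) → Prop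
  | const (c : M) : PVFun fun _ => c
  | code (i : Fin (Coded.arity M Γ)) : PVFun fun γ : Γ => Coded.code γ i
  | app {n : ℕ} (s : Sym n) {f : Fin n → Γ → M} (hf : ∀ i, PVFun (f i)) :
      PVFun fun γ => ev s fun i => f i γ

/-- Functions between coded types that are given by PV-symbols, with parameters from `M`. -/
@[fun_prop]
def Def (M : Type*) {Γ Δ : Type*} [PVModel M] [Coded M Γ] [Coded M Δ] (f : Γ → Δ) : Prop :=
  ∀ i, PVFun fun γ => (Coded.code (f γ) i : M)

instance {M : Type*} : Coded M M := ⟨1, fun a _ => a⟩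

instance {M Γ Δ : Type*} [Coded M Γ] [Coded M Δ] : Coded M (Γ × Δ) :=
  ⟨Coded.arity M Γ + Coded.arity M Δ, fun γ => Fin.append (Coded.code γ.1) (Coded.code γ.2)⟩

-- With 0 for truth, the definable predicates are exactly the zero sets of definable functions, so
-- that one notion `Def` serves for both.
open Classical in
noncomputable instance {M : Type*} [PVModel M] : Coded M Prop :=
  ⟨1, fun P _ => if P then 0 else 1⟩

section Def

variable {M Γ Δ Θ : Type*} [PVModel M] [Coded M Γ] [Coded M Δ] [Coded M Θ]

theorem PVFun.comp {f : Δ → M} (hf : PVFun f) {g : Γ → Δ} (hg : Def M g) :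
    PVFun fun γ => f (g γ) := by
  induction hf with
  | const c => exact .const c
  | code i => exact hg i
  | app s hf ih => exact .app s ih

theorem def_iff {f : Γ → M} : Def M f ↔ PVFun f := ⟨fun h => h 0, fun h _ => h⟩

@[fun_prop] theorem Def.id : Def M fun γ : Γ => γ := fun i => .code i

@[fun_prop] theorem Def.const (d : Δ) : Def M fun _ : Γ => d := fun _ => .const _

@[fun_prop] theorem Def.comp {f : Δ → Θ} {g : Γ → Δ} (hf : Def M f) (hg : Def M g) :
    Def M fun γ => f (g γ) := fun i => (hf i).comp hg

@[fun_prop] theorem Def.prodMk {f : Γ → Δ} {g : Γ → Θ} (hf : Def M f) (hg : Def M g) :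
    Def M fun γ => (f γ, g γ) := fun i => by
  refine Fin.addCases (fun i => ?_) (fun i => ?_) i
  · simpa [Coded.code] using hf i
  · simpa [Coded.code] using hg i

@[fun_prop] theorem Def.fst {f : Γ → Δ × Θ} (hf : Def M f) : Def M fun γ => (f γ).1 :=
  Def.comp (f := Prod.fst) (fun i => by
    have : PVFun fun γ : Δ × Θ => (Coded.code γ (Fin.castAdd _ i) : M) := .code _
    simpa [Coded.code] using this) hf

@[fun_prop] theorem Def.snd {f : Γ → Δ × Θ} (hf : Def M f) : Def M fun γ => (f γ).2 :=
  Def.comp (f := Prod.snd) (fun i => by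
    have : PVFun fun γ : Δ × Θ => (Coded.code γ (Fin.natAdd _ i) : M) := .code _
    simpa [Coded.code] using this) hf

theorem Def.app {n : ℕ} (s : Sym n) {f : Fin n → Γ → M} (hf : ∀ i, Def M (f i)) :
    Def M fun γ => ev s fun i => f i γ := def_iff.2 <| .app s fun i => hf i 0

@[fun_prop] theorem Def.app1 (s : Sym 1) {f : Γ → M} (hf : Def M f) :
    Def M fun γ => ev s ![f γ] :=
  (congrArg (Def M) (funext fun γ =>
    congrArg (ev s) (comp_vec1 (fun h : Γ → M => h γ) f))).mp
    (Def.app s (f := ![f]) fun i => by fin_cases i; exacts [hf])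

@[fun_prop] theorem Def.app2 (s : Sym 2) {f g : Γ → M} (hf : Def M f) (hg : Def M g) :
    Def M fun γ => ev s ![f γ, g γ] :=
  (congrArg (Def M) (funext fun γ =>
    congrArg (ev s) (comp_vec2 (fun h : Γ → M => h γ) f g))).mp
    (Def.app s (f := ![f, g]) fun i => by fin_cases i; exacts [hf, hg])

@[fun_prop] theorem Def.app3 (s : Sym 3) {f g h : Γ → M} (hf : Def M f) (hg : Def M g)
    (hh : Def M h) : Def M fun γ => ev s ![f γ, g γ, h γ] :=
  (congrArg (Def M) (funext fun γ =>
    congrArg (ev s) (comp_vec3 (fun h : Γ → M => h γ) f g h))).mp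
    (Def.app s (f := ![f, g, h]) fun i => by fin_cases i; exacts [hf, hg, hh])

@[fun_prop] theorem Def.app4 (s : Sym 4) {f g h k : Γ → M} (hf : Def M f) (hg : Def M g)
    (hh : Def M h) (hk : Def M k) : Def M fun γ => ev s ![f γ, g γ, h γ, k γ] :=
  (congrArg (Def M) (funext fun γ =>
    congrArg (ev s) (comp_vec4 (fun h : Γ → M => h γ) f g h k))).mp
    (Def.app s (f := ![f, g, h, k]) fun i => by fin_cases i; exacts [hf, hg, hh, hk])

@[fun_prop] theorem Def.app5 (s : Sym 5) {f g h k l : Γ → M} (hf : Def M f) (hg : Def M g)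
    (hh : Def M h) (hk : Def M k) (hl : Def M l) :
    Def M fun γ => ev s ![f γ, g γ, h γ, k γ, l γ] :=
  (congrArg (Def M) (funext fun γ =>
    congrArg (ev s) (comp_vec5 (fun h : Γ → M => h γ) f g h k l))).mp
    (Def.app s (f := ![f, g, h, k, l]) fun i => by fin_cases i; exacts [hf, hg, hh, hk, hl])

@[fun_prop] theorem Def.add {f g : Γ → M} (hf : Def M f) (hg : Def M g) :
    Def M fun γ => f γ + g γ := Def.app2 .add hf hg

@[fun_prop] theorem Def.mul {f g : Γ → M} (hf : Def M f) (hg : Def M g) :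
    Def M fun γ => f γ * g γ := Def.app2 .mul hf hg

@[fun_prop] theorem Def.sub {f g : Γ → M} (hf : Def M f) (hg : Def M g) :
    Def M fun γ => f γ - g γ := Def.app2 .sub hf hg

@[fun_prop] theorem Def.hf {f : Γ → M} (h : Def M f) : Def M fun γ => hf (f γ) :=
  Def.app1 .half h

@[fun_prop] theorem Def.sz {f : Γ → M} (h : Def M f) : Def M fun γ => sz (f γ) :=
  Def.app1 .size h

@[fun_prop] theorem Def.sm {f g : Γ → M} (hf : Def M f) (hg : Def M g) :
    Def M fun γ => sm (f γ) (g γ) := Def.app2 .smash hf hg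

theorem def_prop_of_iff {P : Γ → Prop} {f : Γ → M} (hf : Def M f) (h : ∀ γ, P γ ↔ f γ = 0) :
    Def M P := fun _ => by
  -- Truncated subtraction turns every nonzero value into 1, as the coding of propositions requires.
  have : Def M fun γ => 1 - (1 - f γ) := by fun_prop
  convert def_iff.1 this using 2 with γ
  simp only [Coded.code, h]
  split_ifs with h0
  · simp [h0]
  · rw [tsub_eq_zero_of_le (one_le_iff.2 h0), tsub_zero]

theorem Def.exists_eq_zero_iff {P : Γ → Prop} (hP : Def M P) :
    ∃ f : Γ → M, Def M f ∧ ∀ γ, P γ ↔ f γ = 0 :=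
  ⟨_, def_iff.2 (hP 0), fun γ => by by_cases h : P γ <;> simp [Coded.code, h]⟩

@[fun_prop] theorem Def.le {f g : Γ → M} (hf : Def M f) (hg : Def M g) :
    Def M fun γ => f γ ≤ g γ :=
  def_prop_of_iff (f := fun γ => f γ - g γ) (by fun_prop) fun _ => tsub_eq_zero_iff_le.symm

@[fun_prop] theorem Def.and {P Q : Γ → Prop} (hP : Def M P) (hQ : Def M Q) :
    Def M fun γ => P γ ∧ Q γ := by
  obtain ⟨f, hf, hf'⟩ := hP.exists_eq_zero_iff
  obtain ⟨g, hg, hg'⟩ := hQ.exists_eq_zero_iff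
  exact def_prop_of_iff (f := fun γ => f γ + g γ) (by fun_prop) fun γ => by
    rw [hf', hg', add_eq_zero]

@[fun_prop] theorem Def.not {P : Γ → Prop} (hP : Def M P) : Def M fun γ => ¬ P γ := by
  obtain ⟨f, hf, hf'⟩ := hP.exists_eq_zero_iff
  exact def_prop_of_iff (f := fun γ => 1 - f γ) (by fun_prop) fun γ => by
    rw [hf', tsub_eq_zero_iff_le, one_le_iff]

@[fun_prop] theorem Def.or {P Q : Γ → Prop} (hP : Def M P) (hQ : Def M Q) :
    Def M fun γ => P γ ∨ Q γ := by
  have : Def M fun γ => ¬ (¬ P γ ∧ ¬ Q γ) := by fun_prop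
  simpa only [not_and_or, not_not] using this

theorem Def.imp {P Q : Γ → Prop} (hP : Def M P) (hQ : Def M Q) :
    Def M fun γ => P γ → Q γ := by
  have : Def M fun γ => ¬ P γ ∨ Q γ := by fun_prop
  simpa only [imp_iff_not_or] using this

@[fun_prop] theorem Def.eq {f g : Γ → M} (hf : Def M f) (hg : Def M g) :
    Def M fun γ => f γ = g γ := by
  have : Def M fun γ => f γ ≤ g γ ∧ g γ ≤ f γ := by fun_prop
  simpa only [← le_antisymm_iff] using this

@[fun_prop] theorem Def.lt {f g : Γ → M} (hf : Def M f) (hg : Def M g) :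
    Def M fun γ => f γ < g γ := by
  have : Def M fun γ => ¬ g γ ≤ f γ := by fun_prop
  simpa only [not_le] using this

/-- A definable function is given by a PV-symbol with parameters. -/
theorem PVFun.exists_sym {f : Γ → M} (hf : PVFun f) :
    ∃ (n : ℕ) (s : Sym (Coded.arity M Γ + n)) (c : Fin n → M),
      ∀ γ, f γ = ev s (Fin.append (Coded.code γ) c) := by
  induction hf with
  | const c => exact ⟨1, .proj (Fin.natAdd _ 0), fun _ => c, fun γ => by simp⟩
  | code i => exact ⟨0, .proj (Fin.castAdd _ i), Fin.elim0, fun γ => by simp⟩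
  | @app m s f hf ih =>
    choose n t c h using ih
    let e := finSigmaFinEquiv (n := n)
    refine ⟨∑ i, n i, .comp s fun i => .comp (t i) (Fin.addCases
      (fun j => .proj (Fin.castAdd _ j)) fun j => .proj (Fin.natAdd _ (e ⟨i, j⟩))),
      fun j => c (e.symm j).1 (e.symm j).2, fun γ => ?_⟩
    rw [ev_comp]
    refine congrArg (ev s) (funext fun i => ?_)
    rw [ev_comp, h]
    congr 1
    funext j
    refine Fin.addCases (fun j => by simp) (fun j => ?_) j
    simp only [Fin.append_right, Fin.addCases_right, ev_proj]
    rw [Equiv.symm_apply_apply]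

/-- A definable function of three arguments is given by a PV-symbol with parameters. -/
theorem Def.exists_sym_prod {f : M × M × Γ → M} (hf : Def M f) :
    ∃ (n : ℕ) (s : Sym (n + 2)) (c : Γ → Fin n → M),
      (∀ a b γ, f (a, b, γ) = ev s (Fin.cons a (Fin.cons b (c γ)))) ∧
        ∀ i, Def M fun γ => c γ i := by
  obtain ⟨n, s, c, hs⟩ := (def_iff.1 hf).exists_sym
  refine ⟨Coded.arity M Γ + n, .comp s (Fin.addCases (Fin.addCases (m := Coded.arity M M)
    (n := Coded.arity M (M × Γ)) (fun _ => .proj 0) (Fin.addCases (m := Coded.arity M M)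
    (n := Coded.arity M Γ) (fun _ => .proj 1) fun j => .proj (Fin.castAdd _ j).succ.succ))
    fun j => .proj (Fin.natAdd _ j).succ.succ),
    fun γ => Fin.append (Coded.code γ) c, fun a b γ => ?_, fun i => ?_⟩
  · rw [hs, ev_comp]
    refine congrArg (ev s) (funext fun i => ?_)
    refine Fin.addCases (fun i => ?_) (fun i => ?_) i
    · rw [Fin.append_left, Fin.addCases_left]
      refine Fin.addCases (m := Coded.arity M M) (n := Coded.arity M (M × Γ)) (fun i => ?_)
        (fun i => ?_) i
      · rw [Fin.addCases_left, ev_proj]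
        exact Fin.append_left _ _ _
      · rw [Fin.addCases_right]
        refine (Fin.append_right _ _ _).trans ?_
        refine Fin.addCases (m := Coded.arity M M) (n := Coded.arity M Γ) (fun i => ?_)
          (fun i => ?_) i
        · rw [Fin.addCases_left, ev_proj]
          exact Fin.append_left _ _ _
        · rw [Fin.addCases_right, ev_proj, Fin.cons_succ, Fin.cons_succ]
          exact (Fin.append_right _ _ _).trans (Fin.append_left _ _ _).symm
    · simp
  · refine Fin.addCases (fun i => ?_) (fun i => ?_) i
    · simpa using def_iff.2 (PVFun.code i)
    · simpa using Def.const (c i)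

/-- Induction for definable predicates. -/
theorem induction_of_def {P : M → Prop} (hP : Def M P) (h0 : P 0)
    (ih : ∀ a, P a → P (a + 1)) (a : M) : P a := by
  obtain ⟨f, hf, hP⟩ := hP.exists_eq_zero_iff
  obtain ⟨n, s, c, hs, -⟩ := Def.exists_sym_prod (f := fun γ : M × M × M => f γ.1) (by fun_prop)
  simp only [hP, fun a => hs a 0 0] at h0 ih ⊢
  have := ev_induction s 0 (Fin.cons 0 (c 0))
  simp only [ev_zero] at this
  exact this h0 ih a

end Def

end PVArith

namespace PVArith
namespace PVModel

/-! ### Multiplication, length and smash in a model -/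

section

variable {M : Type*} [PVModel M]

theorem mul_succ' (a b : M) : a * (b + 1) = a * b + a := by
  simpa using holds_of_postulate .basic27 ![a, b]

theorem mul_zero' (a : M) : a * 0 = 0 := by
  simpa using holds_of_postulate .basic26 ![a]

theorem mul_comm' (a b : M) : a * b = b * a := by
  simpa using holds_of_postulate .basic28 ![a, b]

theorem mul_add' (a b c : M) : a * (b + c) = a * b + a * c := by
  simpa using holds_of_postulate .basic29 ![a, b, c]

/-- Associativity of multiplication is not among the axioms BASIC and needs open induction, on the
last factor. -/
theorem mul_assoc' (a b c : M) : a * b * c = a * (b * c) := by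
  refine induction_of_def (P := fun c => a * b * c = a * (b * c)) (by fun_prop) ?_ ?_ c
  · simp only [mul_zero']
  · intro c hc
    rw [mul_succ', mul_succ', mul_add', hc]

theorem mul_one' (a : M) : a * 1 = a := by
  rw [← zero_add (1 : M), mul_succ', mul_zero', zero_add]

noncomputable instance (priority := 50) : CommSemiring M where
  __ := (inferInstance : AddCommMonoid M)
  left_distrib := mul_add'
  right_distrib a b c := by rw [mul_comm', mul_add', mul_comm' a, mul_comm' b]
  zero_mul a := by rw [mul_comm', mul_zero']
  mul_zero := mul_zero'
  mul_assoc := mul_assoc'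
  one_mul a := by rw [mul_comm', mul_one']
  mul_one := mul_one'
  mul_comm := mul_comm'

theorem mul_le_mul_iff' {a : M} (ha : 1 ≤ a) (b c : M) : a * b ≤ a * c ↔ b ≤ c := by
  have := holds_of_postulate .basic30 ![a, b, c]
  simp at this
  exact this ha

theorem mul_lt_mul' {a b c : M} (h : b < c) (ha : 0 < a) : a * b < a * c := by
  rw [← not_le, mul_le_mul_iff' (one_le_iff.2 ha.ne')]
  exact h.not_ge

instance (priority := 50) : IsStrictOrderedRing M where
  zero_le_one := zero_le' 1
  exists_pair_ne := ⟨0, 1, zero_ne_one⟩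
  mul_lt_mul_of_pos_left a ha b c h := mul_lt_mul' h ha
  mul_lt_mul_of_pos_right a ha b c h := by
    rw [mul_comm b, mul_comm c]; exact mul_lt_mul' h ha

theorem pos_iff {a : M} : 0 < a ↔ a ≠ 0 := pos_iff_ne_zero

@[simp] theorem sz_zero : sz (0 : M) = 0 := by
  simpa using holds_of_postulate (M := M) .basic9 ![]

@[simp] theorem sz_one : sz (1 : M) = 1 := by
  simpa using holds_of_postulate (M := M) .basic11 ![]

theorem sz_mono {a b : M} : a ≤ b → sz a ≤ sz b := by
  simpa using holds_of_postulate .basic12 ![a, b]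

theorem sz_sm (a b : M) : sz (sm a b) = sz a * sz b + 1 := by
  simpa using holds_of_postulate .basic13 ![a, b]

theorem sm_zero_left (a : M) : sm 0 a = 1 := by
  simpa using holds_of_postulate .basic14 ![a]

theorem sm_comm (a b : M) : sm a b = sm b a := by
  simpa using holds_of_postulate .basic16 ![a, b]

theorem sm_congr_left {a b : M} (c : M) : sz a = sz b → sm a c = sm b c := by
  simpa using holds_of_postulate .basic17 ![a, b, c]

theorem sm_congr_right {a b : M} (c : M) (h : sz a = sz b) : sm c a = sm c b := by
  rw [sm_comm, sm_congr_left c h, sm_comm]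

theorem sm_add_left {a b c : M} (d : M) : sz a = sz b + sz c → sm a d = sm b d * sm c d := by
  simpa using holds_of_postulate .basic18 ![a, b, c, d]

theorem sm_add_right {a b c : M} (d : M) (h : sz a = sz b + sz c) :
    sm d a = sm d b * sm d c := by
  rw [sm_comm, sm_add_left d h, sm_comm d b, sm_comm d c]

theorem two_mul_eq (a : M) : (1 + 1) * a = a + a := by ring

theorem eq_hf_iff (a b : M) : a = hf b ↔ a + a = b ∨ a + a + 1 = b := by
  simpa [two_mul_eq] using holds_of_postulate .basic32 ![a, b]

theorem cases_hf (b : M) : b = hf b + hf b ∨ b = hf b + hf b + 1 := by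
  simpa only [eq_comm] using (eq_hf_iff (hf b) b).1 rfl

@[simp] theorem hf_even (a : M) : hf (a + a) = a := ((eq_hf_iff _ _).2 (.inl rfl)).symm

@[simp] theorem hf_odd (a : M) : hf (a + a + 1) = a := ((eq_hf_iff _ _).2 (.inr rfl)).symm

@[simp] theorem hf_zero : hf (0 : M) = 0 := by simpa using hf_even (0 : M)

@[simp] theorem hf_one : hf (1 : M) = 0 := by simpa using hf_odd (0 : M)

theorem sz_hf {a : M} : a ≠ 0 → sz a = sz (hf a) + 1 := by
  simpa using holds_of_postulate .basic31 ![a]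

theorem sz_even {a : M} (h : a ≠ 0) : sz (a + a) = sz a + 1 := by
  rw [sz_hf (by simpa using h), hf_even]

theorem sz_odd (a : M) : sz (a + a + 1) = sz a + 1 := by
  rw [sz_hf (by simp), hf_odd]

theorem sz_eq_zero {a : M} : sz a = 0 ↔ a = 0 :=
  ⟨fun h => by by_contra h0; simp [sz_hf h0] at h, fun h => by simp [h]⟩

theorem sz_succ_cases (a : M) : sz (a + 1) = sz a ∨ sz (a + 1) = sz a + 1 := by
  by_cases h : a = 0
  · simp [h]
  · have h1 : sz a ≤ sz (a + 1) := sz_mono le_self_add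
    have h2 : sz (a + 1) ≤ sz a + 1 := by
      rw [← sz_even h]
      exact sz_mono (add_le_add_right (one_le_iff.2 h) a)
    rcases h1.eq_or_lt with h1 | h1
    · exact .inl h1.symm
    · exact .inr (h2.antisymm (lt_iff_succ_le.1 h1))

@[simp] theorem sm_one_zero : sm 1 (0 : M) = 1 := by rw [sm_comm, sm_zero_left]

/-- BASIC evaluates 1 # 2 in two ways, as 2·(1 # 1) and as (1 # 1)·(1 # 1); the nonzero factor 1 # 1
cancels. -/
theorem sm_one_one : sm 1 (1 : M) = 1 + 1 := by
  have := holds_of_postulate (M := M) .basic15 ![1]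
  simp at this
  have h := sm_add_right (a := (1 + 1 : M)) (b := 1) (c := 1) 1 (by rw [sz_even one_ne_zero, sz_one])
  rw [this.1] at h
  have h0 : sm (1 : M) 1 ≠ 0 := fun h0 => by
    have := sz_sm (1 : M) 1
    rw [h0, sz_zero] at this
    exact (add_pos_of_nonneg_of_pos (zero_le' _) one_pos).ne this
  exact (mul_right_cancel₀ h0 h).symm

theorem sm_one_succ_size {a b : M} (h : sz b = sz a + 1) : sm 1 b = sm 1 a + sm 1 a := by
  rw [sm_add_right 1 (b := a) (c := 1) (by rw [h, sz_one]), sm_one_one, mul_add, mul_one]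

theorem sm_one_pos (a : M) : 0 < sm 1 a := pos_iff.2 fun h0 => by
  have := sz_sm (1 : M) a
  rw [h0, sz_zero] at this
  exact (add_pos_of_nonneg_of_pos (zero_le' _) one_pos).ne this

theorem succ_le_sm_one (a : M) : a + 1 ≤ sm 1 a := by
  refine induction_of_def (P := fun a => a + 1 ≤ sm 1 a) (by fun_prop) (by simp) ?_ a
  intro a h
  rcases sz_succ_cases a with hs | hs
  · rw [sm_congr_right 1 hs]
    -- If `a + 1` were equal to 1 # a, it would have |a| + 1 digits, contrary to `hs`.
    refine lt_iff_succ_le.1 (h.lt_of_ne fun h' => ?_)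
    rw [h', sz_sm] at hs
    simp at hs
  · rw [sm_one_succ_size hs]
    exact add_le_add h (one_le_iff.2 (sm_one_pos a).ne')

theorem lt_sm_one (a : M) : a < sm 1 a := lt_iff_succ_le.2 (succ_le_sm_one a)

theorem sm_one_mono {a b : M} (h : a ≤ b) : sm 1 a ≤ sm 1 b := by
  obtain ⟨c, rfl⟩ := exists_add_of_le h
  refine induction_of_def (P := fun c => sm 1 a ≤ sm 1 (a + c)) (by fun_prop) (by simp) ?_ c
  intro c hc
  rw [← add_assoc]
  rcases sz_succ_cases (a + c) with hs | hs
  · rwa [sm_congr_right 1 hs]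
  · rw [sm_one_succ_size hs]
    exact hc.trans le_self_add

theorem sm_one_mono' {a b : M} (h : sz a ≤ sz b) : sm 1 a ≤ sm 1 b := by
  rcases le_total a b with h' | h'
  · exact sm_one_mono h'
  · rw [sm_congr_right 1 (h.antisymm (sz_mono h'))]

theorem hf_add_hf_le (a : M) : hf a + hf a ≤ a := by
  rcases cases_hf a with h | h
  · exact h.ge
  · exact le_self_add.trans h.ge

theorem hf_le (a : M) : hf a ≤ a := le_self_add.trans (hf_add_hf_le a)

/-! ### Shifts and induction on notation -/

theorem cons_eq_vecCons {α : Type*} {n : ℕ} (a : α) (v : Fin n → α) :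
    (Fin.cons a v : Fin (n + 1) → α) = Matrix.vecCons a v := rfl

/-- `⌊a / 2 ^ |u|⌋` -/
def shr (u a : M) : M := ev .shift ![u, a]

@[fun_prop] theorem _root_.PVArith.Def.shr {Γ : Type*} [Coded M Γ] {f g : Γ → M} (hf : Def M f)
    (hg : Def M g) : Def M fun γ => shr (f γ) (g γ) := Def.app2 _ hf hg

@[simp] theorem shr_zero_left (a : M) : shr 0 a = a :=
  (ev_lrn_zero ![a] _ _ _ _).trans (by simp [cons_eq_vecCons])

theorem shr_le (u a : M) : shr u a ≤ a := by
  rcases cases_hf u with h | h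
  · by_cases h0 : hf u = 0
    · rw [h, h0, add_zero, shr_zero_left]
    · rw [h]
      exact (ev_lrn_even ![a] _ _ _ _ h0).trans_le ((min_le_right _ _).trans_eq (by simp))
  · rw [h]
    exact (ev_lrn_odd ![a] _ _ _ _ _).trans_le ((min_le_right _ _).trans_eq (by simp))

theorem shr_even {u : M} (a : M) (h : u ≠ 0) : shr (u + u) a = hf (shr u a) := by
  have := ev_lrn_even ![a] (.proj 0) (.ap1 .half (.proj 1)) (.ap1 .half (.proj 1)) (.proj 1) h
  simp only [cons_eq_vecCons, ev_ap1, ev_proj, ev_half, Matrix.cons_val_one,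
    Matrix.cons_val_zero] at this
  exact this.trans (min_eq_left ((hf_le _).trans (shr_le u a)))

theorem shr_odd (u a : M) : shr (u + u + 1) a = hf (shr u a) := by
  have := ev_lrn_odd ![a] (.proj 0) (.ap1 .half (.proj 1)) (.ap1 .half (.proj 1)) (.proj 1) u
  simp only [cons_eq_vecCons, ev_ap1, ev_proj, ev_half, Matrix.cons_val_one,
    Matrix.cons_val_zero] at this
  exact this.trans (min_eq_left ((hf_le _).trans (shr_le u a)))

theorem hf_bounds {a m b : M} (h₁ : a * m ≤ b) (h₂ : b < (a + 1) * m) :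
    hf a * (m + m) ≤ b ∧ b < (hf a + 1) * (m + m) := by
  rcases cases_hf a with h | h
  all_goals
    generalize hf a = c at h ⊢
    subst h
    constructor
  · exact h₁.trans_eq' (by ring)
  · refine h₂.trans_le ?_
    calc (c + c + 1) * m ≤ (c + c + 1) * m + m := le_self_add
      _ = _ := by ring
  · refine h₁.trans' ?_
    calc c * (m + m) ≤ c * (m + m) + m := le_self_add
      _ = _ := by ring
  · exact h₂.trans_eq (by ring)

/-- The number 1 # v has |v| + 1 digits, so it shifts 2a as far as `v` would shift `a`. It replaces
`v` because 1 # (v + 1) is either equal to 1 # v or its double; thus ordinary induction on `v` only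
meets the even clause of the recursion. -/
theorem shr_sm_one_bounds (v a : M) : shr (sm 1 v) (a + a) * sm 1 v ≤ a ∧
    a < (shr (sm 1 v) (a + a) + 1) * sm 1 v := by
  refine induction_of_def (P := fun v => shr (sm 1 v) (a + a) * sm 1 v ≤ a ∧
    a < (shr (sm 1 v) (a + a) + 1) * sm 1 v) (by fun_prop) ?_ ?_ v
  · have : shr 1 (a + a) = a := by simpa using shr_odd 0 (a + a)
    simp [this]
  · rintro v ⟨h₁, h₂⟩
    rcases sz_succ_cases v with hs | hs
    · rw [sm_congr_right 1 hs]
      exact ⟨h₁, h₂⟩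
    · rw [sm_one_succ_size hs, shr_even _ (sm_one_pos v).ne']
      exact hf_bounds h₁ h₂

/-- Induction on notation. -/
theorem notation_induction {P : M → Prop} (hP : Def M P) (h0 : P 0)
    (ih : ∀ a, P (hf a) → P a) (a : M) : P a := by
  by_contra ha
  -- A failure at `a` propagates to all numbers ⌊a / 2^|v|⌋, which are reached from `a` by
  -- successive halving.
  have key : ∀ v, ¬ P (shr (sm 1 v) (a + a)) := by
    refine induction_of_def (by fun_prop) ?_ ?_
    · have : shr 1 (a + a) = a := by simpa using shr_odd 0 (a + a)
      simpa [this] using ha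
    · intro v hv
      rcases sz_succ_cases v with hs | hs
      · rwa [sm_congr_right 1 hs]
      · rw [sm_one_succ_size hs, shr_even _ (sm_one_pos v).ne']
        exact fun h => hv (ih _ h)
  -- After |a| halvings nothing is left of `a`, and `P 0` is contradicted.
  have h := (shr_sm_one_bounds a a).1
  refine key a ?_
  rwa [show shr (sm 1 a) (a + a) = 0 from ?_]
  by_contra h0
  exact absurd (h.trans_lt (lt_sm_one a))
    (not_lt.2 (le_mul_of_one_le_left (zero_le' _) (one_le_iff.2 h0)))

theorem sm_one_le {a : M} (h : a ≠ 0) : sm 1 a ≤ a + a := by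
  refine (notation_induction (P := fun a : M => a = 0 ∨ sm 1 a ≤ a + a) (by fun_prop) (.inl rfl) ?_
    a).resolve_left h
  intro a ha
  by_cases h0 : a = 0
  · exact .inl h0
  right
  rw [sm_one_succ_size (sz_hf h0)]
  have h1 := hf_add_hf_le a
  rcases ha with ha | ha
  · rw [ha, sm_one_zero]
    exact add_le_add (one_le_iff.2 h0) (one_le_iff.2 h0)
  · exact add_le_add (ha.trans h1) (ha.trans h1)

/-- If |b| < |a|, then 2·2^|b| ≤ 2^|a| ≤ 2a, which excludes a < 2^|b|. -/
theorem lt_sm_one_iff {a b : M} : a < sm 1 b ↔ sz a ≤ sz b := by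
  constructor
  · intro h
    by_contra! h1
    have ha : a ≠ 0 := by rintro rfl; simp at h1
    have h2 : sm 1 b + sm 1 b ≤ sm 1 a := by
      have : sz (sm 1 b) ≤ sz a := by rw [sz_sm, sz_one, one_mul]; exact lt_iff_succ_le.1 h1
      refine le_trans (le_of_eq ?_) (sm_one_mono' this)
      exact (sm_one_succ_size (by rw [sz_sm, sz_one, one_mul])).symm
    exact absurd (h2.trans (sm_one_le ha)) (not_le.2 (add_lt_add h h))
  · intro h
    exact (lt_sm_one a).trans_le (sm_one_mono' h)

theorem shr_bounds (u a : M) : shr u a * sm 1 u ≤ a ∧ a < (shr u a + 1) * sm 1 u := by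
  refine notation_induction (P := fun u => shr u a * sm 1 u ≤ a ∧
    a < (shr u a + 1) * sm 1 u) (by fun_prop) (by simp) ?_ u
  rintro u ⟨h₁, h₂⟩
  by_cases h0 : u = 0
  · simp [h0]
  have h : shr u a = hf (shr (hf u) a) := by
    rcases cases_hf u with h | h
    · conv_lhs => rw [h]
      exact shr_even _ fun h1 => h0 (by rw [h, h1, add_zero])
    · conv_lhs => rw [h]
      exact shr_odd _ _
  rw [h, sm_one_succ_size (sz_hf h0)]
  exact hf_bounds h₁ h₂

theorem div_unique {a b m q : M} (h₁ : a * m ≤ q) (h₂ : q < (a + 1) * m) (h₃ : b * m ≤ q)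
    (h₄ : q < (b + 1) * m) : a = b := by
  refine le_antisymm ?_ ?_
  · exact lt_succ_iff.1 (lt_of_mul_lt_mul_right (h₁.trans_lt h₄) (zero_le' m))
  · exact lt_succ_iff.1 (lt_of_mul_lt_mul_right (h₃.trans_lt h₂) (zero_le' m))

theorem shr_eq_iff {u a q : M} : shr u a = q ↔ q * sm 1 u ≤ a ∧ a < (q + 1) * sm 1 u :=
  ⟨fun h => h ▸ shr_bounds u a, fun h =>
    div_unique (shr_bounds u a).1 (shr_bounds u a).2 h.1 h.2⟩

end

end PVModel
end PVArith

namespace PVArith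
namespace PVModel

variable {M : Type*} [PVModel M]

noncomputable instance (priority := 50) : SuccOrder M :=
  SuccOrder.ofSuccLeIff (fun a => a + 1) lt_iff_succ_le.symm

noncomputable instance (priority := 50) : SuccAddOrder M := ⟨fun _ => rfl⟩

/-! ### Unary numbers and recursion on length -/

/-- The number whose binary expansion consists of `|a|` ones. -/
noncomputable def un (a : M) : M := sm 1 a - 1

@[fun_prop] theorem _root_.PVArith.Def.un {Γ : Type*} [Coded M Γ] {f : Γ → M} (hf : Def M f) :
    Def M fun γ => un (f γ) := by
  unfold PVModel.un
  fun_prop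

theorem un_add_one (a : M) : un a + 1 = sm 1 a :=
  tsub_add_cancel_of_le (one_le_iff.2 (sm_one_pos a).ne')

@[simp] theorem un_zero : un (0 : M) = 0 := by simp [un]

theorem un_succ {a b : M} (h : sz b = sz a + 1) : un b = un a + un a + 1 := by
  rw [← add_left_inj (1 : M), un_add_one, sm_one_succ_size h, ← un_add_one]
  ring

@[simp] theorem sz_un (a : M) : sz (un a) = sz a := by
  refine notation_induction (P := fun a : M => sz (un a) = sz a) (by fun_prop) (by simp) ?_ a
  intro a h
  by_cases h0 : a = 0
  · simp [h0]
  · rw [un_succ (sz_hf h0), sz_odd, h, ← sz_hf h0]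

theorem un_congr {a b : M} (h : sz a = sz b) : un a = un b := by
  rw [un, un, sm_congr_right 1 h]

/-! ### Recursions that depend only on the length of the recursion variable -/

section Recursion

variable {n : ℕ} {g : Sym n} {h : Sym (n + 2)} {b : Sym (n + 1)} {c : Fin n → M}

theorem _root_.PVArith.Def.app_cons {Γ : Type*} [Coded M Γ] (s : Sym (n + 1)) {f : Γ → M}
    {c : Γ → Fin n → M} (hf : Def M f) (hc : ∀ i, Def M fun γ => c γ i) :
    Def M fun γ => ev s (Fin.cons (f γ) (c γ)) := by
  have := Def.app s (f := Fin.cons f fun i γ => c γ i) (Fin.cases hf fun i => hc i)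
  convert this using 3 with γ
  funext i
  cases i using Fin.cases <;> rfl

/-- The two clauses of the recursion coincide and the step and the bound see only the length of the
counter. Hence replacing every digit of `I` by 1, which gives `un I`, does not change the value;
this is checked by induction on notation. -/
theorem lrn_congr
    (hh : ∀ y y' v, sz y = sz y' → ev h (Fin.cons y (Fin.cons v c)) =
      ev h (Fin.cons y' (Fin.cons v c)))
    (hb : ∀ y y' : M, sz y = sz y' → ev b (Fin.cons y c) = ev b (Fin.cons y' c))
    {I J : M} (hIJ : sz I = sz J) :
    ev (.lrn g h h b) (Fin.cons I c) = ev (.lrn g h h b) (Fin.cons J c) := by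
  suffices H : ∀ I, ev (.lrn g h h b) (Fin.cons I c) = ev (.lrn g h h b) (Fin.cons (un I) c) by
    rw [H I, H J, un_congr hIJ]
  refine notation_induction (.eq (.app_cons _ .id fun i => .const _)
    (.app_cons _ (.un .id) fun i => .const _)) (by simp) ?_
  intro I ih
  by_cases h0 : I = 0
  · simp [h0]
  rw [un_succ (sz_hf h0), ev_lrn_odd, ← ih, hh _ (hf I) _ (sz_un _),
    hb _ I (by rw [sz_odd, sz_un, ← sz_hf h0])]
  rcases cases_hf I with h1 | h1
  · have h2 : hf I ≠ 0 := fun h2 => h0 (by rw [h1, h2, add_zero])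
    have := ev_lrn_even c g h h b h2
    rwa [← h1] at this
  · have := ev_lrn_odd c g h h b (hf I)
    rwa [← h1] at this

theorem ev_lrn_succ
    (hh : ∀ y y' v, sz y = sz y' → ev h (Fin.cons y (Fin.cons v c)) =
      ev h (Fin.cons y' (Fin.cons v c)))
    (hb : ∀ y y' : M, sz y = sz y' → ev b (Fin.cons y c) = ev b (Fin.cons y' c))
    {I J : M} (hIJ : sz I = sz J + 1) :
    ev (.lrn g h h b) (Fin.cons I c) =
      min (ev h (Fin.cons J (Fin.cons (ev (.lrn g h h b) (Fin.cons J c)) c)))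
        (ev b (Fin.cons I c)) := by
  have h1 : sz I = sz (J + J + 1) := by rw [hIJ, sz_odd]
  rw [lrn_congr hh hb h1, ev_lrn_odd, hb _ _ h1]

end Recursion

@[simp] theorem ev_cond (c a b : M) [Decidable (c = 0)] :
    ev .cond ![c, a, b] = if c = 0 then a else b := by
  split_ifs with h
  · subst h
    have := ev_lrn_zero ![a, b] (.proj 0) (.proj 3) (.proj 3) (.proj 1 + .proj 2)
    simp only [cons_eq_vecCons, ev_add, ev_proj] at this
    exact this.trans (min_eq_left le_self_add)
  · have := ev_lrn_succ (g := .proj 0) (h := .proj 3) (b := .proj 1 + .proj 2) (c := ![a, b])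
      (by simp [cons_eq_vecCons]) (by simp [cons_eq_vecCons]) (sz_hf h)
    simp only [cons_eq_vecCons, ev_add, ev_proj] at this
    exact this.trans (min_eq_left le_add_self)

/-! ### The semiring of lengths -/

/-- The length grows by at most one from `b` to `b + 1`, so it cannot jump over `a`; if it never
took the value `a`, it would stay below `a` forever. -/
theorem exists_sz_eq {a b : M} (h : a ≤ sz b) : ∃ c, sz c = a := by
  by_contra! H
  refine absurd h (not_le.2 (induction_of_def (P := fun b => sz b < a) (by fun_prop) ?_ ?_ b))
  · exact (sz_zero (M := M)).trans_lt (pos_iff.2 fun h => H 0 (by simp [h]))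
  · intro c hc
    rcases sz_succ_cases c with h | h
    · rwa [h]
    · exact (h.trans_le (lt_iff_succ_le.1 hc)).lt_of_ne (H _)

/-- The semiring of all lengths `|a|`. -/
def lengths (M : Type*) [PVModel M] : Subsemiring M where
  carrier := {a | ∃ b, sz b = a}
  zero_mem' := ⟨0, sz_zero⟩
  one_mem' := ⟨1, sz_one⟩
  mul_mem' := by
    rintro _ _ ⟨a, rfl⟩ ⟨b, rfl⟩
    exact exists_sz_eq (b := sm a b) (by rw [sz_sm]; exact le_self_add)
  add_mem' := by
    rintro _ _ ⟨a, rfl⟩ ⟨b, rfl⟩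
    -- The length of this number is (|a| + 1)(|b| + 1) + 1, which exceeds |a| + |b|.
    refine exists_sz_eq (b := sm (a + a + 1) (b + b + 1)) ?_
    rw [sz_sm, sz_odd, sz_odd]
    calc sz a + sz b ≤ sz a + sz b + (sz a * sz b + 1 + 1) := le_self_add
      _ = _ := by ring

/-- The type of lengths `|a|`. -/
abbrev Len (M : Type*) [PVModel M] : Type _ := lengths M

/-- `|a|` as an element of the type of lengths. -/
def len (a : M) : Len M := ⟨sz a, a, rfl⟩

@[simp] theorem coe_len (a : M) : (len a : M) = sz a := rfl

theorem len_eq_iff {a b : M} : len a = len b ↔ sz a = sz b := Subtype.ext_iff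

theorem len_surjective : Function.Surjective (len : M → Len M) :=
  fun ⟨_, a, h⟩ => ⟨a, Subtype.ext h⟩

theorem exists_len_eq {a : M} {i : Len M} (h : a ≤ i) : ∃ j : Len M, (j : M) = a := by
  obtain ⟨b, rfl⟩ := len_surjective i
  obtain ⟨c, hc⟩ := exists_sz_eq h
  exact ⟨len c, hc⟩

instance : Sub (Len M) := ⟨fun i j => ⟨i - j, by
  obtain ⟨k, hk⟩ := exists_len_eq (tsub_le_self : (i : M) - j ≤ i)
  exact hk ▸ k.2⟩⟩

@[simp] theorem coe_sub (i j : Len M) : ((i - j : Len M) : M) = i - j := rfl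

instance : CanonicallyOrderedAdd (Len M) where
  exists_add_of_le {i j} h := ⟨j - i, Subtype.ext (add_sub_of_le (M := M) h).symm⟩
  le_self_add i j := show (i : M) ≤ i + j from le_self_add
  le_add_self i j := show (i : M) ≤ j + i from le_add_self

instance : OrderedSub (Len M) where
  tsub_le_iff_right i j k := show (i : M) - j ≤ k ↔ (i : M) ≤ k + j from tsub_le_iff_right

noncomputable instance : SuccOrder (Len M) :=
  SuccOrder.ofSuccLeIff (fun a => a + 1) fun {a b} =>
    (lt_iff_succ_le (a := (a : M)) (b := b)).symm

noncomputable instance : SuccAddOrder (Len M) := ⟨fun _ => rfl⟩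

/-- `2 ^ i` for a length `i` -/
noncomputable def ex (i : Len M) : M := sm 1 i.2.choose

@[simp] theorem ex_len (a : M) : ex (len a) = sm 1 a :=
  sm_congr_right 1 (len a).2.choose_spec

/-- The number whose binary expansion consists of `i` ones. -/
noncomputable def ones (i : Len M) : M := ex i - 1

@[simp] theorem ones_len (a : M) : ones (len a) = un a := by rw [ones, ex_len, un]

@[simp] theorem len_ones (i : Len M) : len (ones i) = i := by
  obtain ⟨a, rfl⟩ := len_surjective i
  rw [ones_len, len_eq_iff, sz_un]

@[simp] theorem sz_ones (i : Len M) : sz (ones i) = i := congrArg Subtype.val (len_ones i)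

theorem ones_add_one (i : Len M) : ones i + 1 = ex i := by
  obtain ⟨a, rfl⟩ := len_surjective i
  rw [ones_len, ex_len, un_add_one]

theorem sm_one_ones (i : Len M) : sm 1 (ones i) = ex i := by rw [← ex_len, len_ones]

@[simp] theorem ex_zero : ex (0 : Len M) = 1 := by
  rw [← sm_one_zero, ← ex_len]; congr 1; exact Subtype.ext sz_zero.symm

@[simp] theorem ones_zero : ones (0 : Len M) = 0 := by simp [ones]

theorem ex_add (i j : Len M) : ex (i + j) = ex i * ex j := by
  simp only [← sm_one_ones]
  exact sm_add_right 1 (by simp)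

theorem ex_pos (i : Len M) : 0 < ex i := sm_one_pos _

theorem ex_one : ex (1 : Len M) = 1 + 1 := by
  rw [← sm_one_one, ← ex_len]; congr 1; exact Subtype.ext sz_one.symm

theorem lt_ex_iff {a : M} {i : Len M} : a < ex i ↔ sz a ≤ i := by
  rw [← sm_one_ones, lt_sm_one_iff, sz_ones]

theorem lt_ex_len (a : M) : a < ex (len a) := lt_ex_iff.2 le_rfl

theorem ex_le_ex {i j : Len M} : ex i ≤ ex j ↔ i ≤ j := by
  rw [← not_lt, lt_ex_iff, ← sm_one_ones, sz_sm, sz_one, one_mul, sz_ones, ← lt_iff_succ_le,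
    not_lt]
  rfl

theorem ex_mono {i j : Len M} (h : i ≤ j) : ex i ≤ ex j := ex_le_ex.2 h

theorem sz_hf_eq_sub (a : M) : sz (hf a) = sz a - 1 := by
  by_cases h : a = 0
  · simp [h]
  · rw [sz_hf h, add_tsub_cancel_right]

/-- As a # b has |a||b| + 1 digits, its half has |a||b| digits, and the claim becomes a # b = 1 #
⌊(a # b) / 2⌋. By induction on `b`: whenever |b| grows by one, both sides gain the factor 1 # a. -/
theorem sm_eq_ex (a b : M) : sm a b = ex (len a * len b) := by
  suffices H : ∀ b, sm a b = sm 1 (hf (sm a b)) by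
    rw [H, ← ex_len]
    congr 1
    apply Subtype.ext
    simp [sz_hf_eq_sub, sz_sm]
  refine induction_of_def (by fun_prop) ?_ ?_
  · simp [sm_comm a 0, sm_zero_left]
  · intro b hb
    rcases sz_succ_cases b with h | h
    · rwa [sm_congr_right a h]
    · have h1 : sm a (b + 1) = sm a b * sm a 1 := sm_add_right a (by rw [h, sz_one])
      have h2 : sm 1 (hf (sm a (b + 1))) = sm 1 (hf (sm a b)) * sm 1 a := by
        apply sm_add_right
        simp only [sz_hf_eq_sub, sz_sm, h, add_tsub_cancel_right]
        ring
      rw [h2, ← hb, h1, sm_comm a 1]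

/-! ### Definability over the lengths -/

/-- A length is coded in unary, by `i` ones, so that recursion on notation along the code makes `i`
steps and `ex` is definable. -/
noncomputable instance : Coded M (Len M) := ⟨1, fun i _ => ones i⟩

section Def

variable {Γ : Type*} [Coded M Γ]

theorem def_len_iff {f : Γ → Len M} : Def M f ↔ Def M fun γ => ones (f γ) := Iff.rfl

@[fun_prop] theorem _root_.PVArith.Def.len {f : Γ → M} (hf : Def M f) :
    Def M fun γ => len (f γ) := by
  simp only [def_len_iff, ones_len]
  fun_prop

@[fun_prop] theorem _root_.PVArith.Def.ones {f : Γ → Len M} (hf : Def M f) :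
    Def M fun γ => ones (f γ) := hf

@[fun_prop] theorem _root_.PVArith.Def.coe_len {f : Γ → Len M} (hf : Def M f) :
    Def M fun γ => (f γ : M) := by
  simp only [← sz_ones]
  fun_prop

@[fun_prop] theorem _root_.PVArith.Def.ex {f : Γ → Len M} (hf : Def M f) :
    Def M fun γ => ex (f γ) := by
  simp only [← ones_add_one]
  fun_prop

theorem ones_eq (i : Len M) : ones i = ex i - 1 := rfl

attribute [irreducible] ones

@[fun_prop] theorem _root_.PVArith.Def.len_add {f g : Γ → Len M} (hf : Def M f) (hg : Def M g) :
    Def M fun γ => f γ + g γ := by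
  simp only [def_len_iff, ones_eq, ex_add]
  fun_prop

@[fun_prop] theorem _root_.PVArith.Def.len_mul {f g : Γ → Len M} (hf : Def M f) (hg : Def M g) :
    Def M fun γ => f γ * g γ := by
  have (i j : Len M) : ones (i * j) = sm (ones i) (ones j) - 1 := by
    rw [sm_eq_ex, len_ones, len_ones, ones_eq]
  simp only [def_len_iff, this]
  fun_prop

@[fun_prop] theorem _root_.PVArith.Def.len_sub {f g : Γ → Len M} (hf : Def M f) (hg : Def M g) :
    Def M fun γ => f γ - g γ := by
  have (i j : Len M) : ones (i - j) = shr (ones j) (ones i) := by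
    rcases le_total i j with h | h
    · rw [tsub_eq_zero_of_le h, ones_zero, eq_comm, shr_eq_iff, zero_mul, zero_add, one_mul,
        sm_one_ones]
      refine ⟨zero_le' _, lt_of_lt_of_le ?_ (ex_mono h)⟩
      rw [lt_ex_iff, sz_ones]
    · obtain ⟨k, rfl⟩ := exists_add_of_le h
      rw [add_tsub_cancel_left, eq_comm, shr_eq_iff, sm_one_ones, ones_add_one, ← ex_add,
        add_comm k, lt_ex_iff, sz_ones, and_iff_left le_rfl, ← Order.lt_add_one_iff, ones_add_one,
        ex_add, ← ones_add_one k, mul_add, mul_one, mul_comm]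
      exact lt_add_of_pos_right _ (ex_pos j)
  simp only [def_len_iff, this]
  fun_prop

@[fun_prop] theorem _root_.PVArith.Def.len_le {f g : Γ → Len M} (hf : Def M f) (hg : Def M g) :
    Def M fun γ => f γ ≤ g γ := by
  change Def M fun γ => (f γ : M) ≤ g γ
  fun_prop

@[fun_prop] theorem _root_.PVArith.Def.len_lt {f g : Γ → Len M} (hf : Def M f) (hg : Def M g) :
    Def M fun γ => f γ < g γ := by
  change Def M fun γ => (f γ : M) < g γ
  fun_prop

@[fun_prop] theorem _root_.PVArith.Def.len_eq {f g : Γ → Len M} (hf : Def M f) (hg : Def M g) :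
    Def M fun γ => f γ = g γ := by
  simp only [Subtype.ext_iff]
  fun_prop

/-- Induction on lengths. -/
theorem len_induction {P : Len M → Prop} (hP : Def M P) (h0 : P 0)
    (ih : ∀ i, P i → P (i + 1)) (i : Len M) : P i := by
  obtain ⟨a, rfl⟩ := len_surjective i
  refine induction_of_def (P := fun a : M => P (len a)) (hP.comp (.len .id)) ?_ ?_ a
  · rwa [show len (0 : M) = 0 from Subtype.ext sz_zero]
  · intro a ha
    rcases sz_succ_cases a with h | h
    · rwa [len_eq_iff.2 h]
    · rw [show len (a + 1) = len a + 1 from Subtype.ext h]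
      exact ih _ ha

@[fun_prop] theorem _root_.PVArith.Def.ite {P : Γ → Prop} {f g : Γ → M} [DecidablePred P]
    (hP : Def M P) (hf : Def M f) (hg : Def M g) :
    Def M fun γ => if P γ then f γ else g γ := by
  classical
  obtain ⟨k, hk, hPk⟩ := hP.exists_eq_zero_iff
  have : Def M fun γ => ev .cond ![k γ, f γ, g γ] := by fun_prop
  convert this with γ
  simp [hPk]

/-- Definable recursion on lengths. -/
theorem exists_recursion {g b : Γ → M} {h : Γ → Len M → M → M} (hg : Def M g) (hb : Def M b)
    (hh : Def M fun x : Γ × Len M × M => h x.1 x.2.1 x.2.2) :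
    ∃ T : Γ → Len M → M, (Def M fun x : Γ × Len M => T x.1 x.2) ∧
      (∀ γ, T γ 0 = min (g γ) (b γ)) ∧
      ∀ γ j, T γ (j + 1) = min (h γ j (T γ j)) (b γ) := by
  obtain ⟨n, s, c, hs, hc⟩ := Def.exists_sym_prod
    (f := fun x : M × M × Γ => h x.2.2 (len x.1) x.2.1)
    (hh.comp (g := fun x : M × M × Γ => (x.2.2, len x.1, x.2.1)) (by fun_prop))
  let step : Sym (n + 2 + 2) := .comp s
    (Fin.cons (Sym.proj 0) (Fin.cons (Sym.proj 1) fun j => Sym.proj j.succ.succ.succ.succ))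
  -- The initial value and the bound become the first two parameters, so that in the recursion they
  -- are given by the projections `.proj 0` and `.proj 2` (the counter coming first in the latter).
  let d (γ : Γ) : Fin (n + 2) → M := Fin.cons (g γ) (Fin.cons (b γ) (c γ))
  have hd (i) : Def M fun γ => d γ i := by
    refine Fin.cases ?_ (fun i => ?_) i
    · simpa [d] using hg
    · refine Fin.cases ?_ (fun i => ?_) i
      · simpa [d] using hb
      · simpa [d] using hc i
  have hstep (y v : M) (γ : Γ) :
      ev step (Fin.cons y (Fin.cons v (d γ))) = h γ (len y) v := by
    simp only [step, ev_comp]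
    refine (hs y v γ).symm ▸ congrArg (ev s) (funext fun j => ?_)
    refine Fin.cases ?_ (fun j => ?_) j
    · simp
    · refine Fin.cases ?_ (fun j => ?_) j
      · simp
      · simp [d]
  have hbd (y : M) (γ : Γ) : ev (.proj 2 : Sym (n + 3)) (Fin.cons y (d γ)) = b γ := ev_proj _ _
  clear_value step
  refine ⟨fun γ j => ev (.lrn (.proj 0) step step (.proj 2)) (Fin.cons (ones j) (d γ)),
    ?_, fun γ => ?_, fun γ j => ?_⟩
  · exact .app_cons _ (by fun_prop) fun i => (hd i).comp (.fst .id)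
  · simp only [ones_zero]
    rw [ev_lrn_zero, hbd, ev_proj]
    rfl
  · beta_reduce
    rw [ev_lrn_succ (J := ones j) (fun y y' v h => by rw [hstep, hstep, len_eq_iff.2 h])
      (fun y y' h => by rw [hbd, hbd]) (by simp), hstep, hbd, len_ones]

/-- A definable function `T` such that `T γ i = 0` expresses `∀ j < i, P γ j`. -/
theorem exists_ball_counter {P : Γ → Len M → Prop} (hP : Def M fun x : Γ × Len M => P x.1 x.2) :
    ∃ T : Γ → Len M → M, (Def M fun x : Γ × Len M => T x.1 x.2) ∧ (∀ γ, T γ 0 = 0) ∧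
      ∀ γ j, T γ (j + 1) = 0 ↔ T γ j = 0 ∧ P γ j := by
  classical
  have hP' : Def M fun x : Γ × Len M × M => P x.1 x.2.1 :=
    hP.comp (g := fun x : Γ × Len M × M => (x.1, x.2.1)) (by fun_prop)
  obtain ⟨T, hT, hT0, hTs⟩ := exists_recursion (Γ := Γ) (g := fun _ => 0) (b := fun _ => 1)
    (h := fun γ j v => if v = 0 ∧ P γ j then 0 else 1) (by fun_prop) (by fun_prop) (by fun_prop)
  refine ⟨T, hT, fun γ => (hT0 γ).trans (min_eq_left zero_le_one), fun γ j => ?_⟩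
  rw [hTs]
  split_ifs with h <;> simp [h]

/-- Sharply bounded universal quantification preserves definability. -/
theorem _root_.PVArith.Def.ball {b : Γ → Len M} {P : Γ → Len M → Prop} (hb : Def M b)
    (hP : Def M fun x : Γ × Len M => P x.1 x.2) : Def M fun γ => ∀ j < b γ, P γ j := by
  obtain ⟨T, hT, hT0, hTs⟩ := exists_ball_counter hP
  refine def_prop_of_iff (f := fun γ => T γ (b γ)) (hT.comp (.prodMk .id hb)) fun γ => ?_
  constructor
  · intro h
    refine len_induction (P := fun i => ¬ i ≤ b γ ∨ T γ i = 0) ?_ (.inr (hT0 γ)) ?_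
      (b γ) |>.resolve_left (not_not.2 le_rfl)
    · have : Def M fun i => T γ i := hT.comp (.prodMk (.const γ) .id)
      fun_prop
    · intro i hi
      by_cases hib : i + 1 ≤ b γ
      · have hib' : i < b γ := Order.add_one_le_iff.1 hib
        exact .inr ((hTs γ i).2 ⟨hi.resolve_left (not_not.2 hib'.le), h i hib'⟩)
      · exact .inl hib
  · intro h j hj
    by_contra hPj
    refine absurd h ?_
    -- Once `P` has failed at `j`, the counter never returns to zero.
    refine len_induction (P := fun i => i ≤ j ∨ ¬ T γ i = 0) ?_ (.inl zero_le) ?_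
      (b γ) |>.resolve_left hj.not_ge
    · have : Def M fun i => T γ i := hT.comp (.prodMk (.const γ) .id)
      fun_prop
    · intro i hi
      by_cases hij : i + 1 ≤ j
      · exact .inl hij
      · right
        rw [hTs, not_and]
        rcases hi with hi | hi
        · rw [Order.add_one_le_iff, not_lt] at hij
          rw [hi.antisymm hij]
          exact fun _ => hPj
        · exact fun h => (hi h).elim

theorem _root_.PVArith.Def.bex {b : Γ → Len M} {P : Γ → Len M → Prop} (hb : Def M b)
    (hP : Def M fun x : Γ × Len M => P x.1 x.2) : Def M fun γ => ∃ j < b γ, P γ j := by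
  have : Def M fun γ => ¬ ∀ j < b γ, ¬ P γ j := .not (.ball hb (.not hP))
  simpa using this

/-- Strong induction on lengths. -/
theorem len_strong_induction {P : Len M → Prop} (hP : Def M P)
    (ih : ∀ i, (∀ j < i, P j) → P i) (i : Len M) : P i := by
  refine ih i ?_
  refine len_induction (P := fun i => ∀ j < i, P j) (.ball .id (hP.comp (.snd .id)))
    (fun j hj => (not_lt_zero hj).elim) (fun i hi j hj => ?_) i
  rcases (Order.lt_add_one_iff.1 hj).lt_or_eq with h | rfl
  · exact hi j h
  · exact ih _ hi

/-- The least number principle for lengths. -/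
theorem exists_least {P : Len M → Prop} (hP : Def M P) (h : ∃ i, P i) :
    ∃ i, P i ∧ ∀ j < i, ¬ P j := by
  by_contra! H
  obtain ⟨i, hi⟩ := h
  exact len_strong_induction (P := fun i => ¬ P i) hP.not
    (fun i ih hi => by obtain ⟨j, hj, hj'⟩ := H i hi; exact ih j hj hj') i hi

end Def

end PVModel
end PVArith

namespace PVArith

/-- The quotient `⌊y / m⌋`; the arguments are `(y, m)`. -/
def Sym.quot : Sym 2 :=
  .lrn 0 (.proj 1 + .proj 1 + .ap3 .cond (.proj 2 -
      (.ap2 .rem (.proj 0) (.proj 2) + .ap2 .rem (.proj 0) (.proj 2))) 1 0)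
    (.proj 1 + .proj 1 + .ap3 .cond (.proj 2 -
      .ap1 .succ (.ap2 .rem (.proj 0) (.proj 2) + .ap2 .rem (.proj 0) (.proj 2))) 1 0)
    (.ap1 .succ (.proj 0 + .proj 0))

namespace PVModel

variable {M : Type*} [PVModel M]

/-! ### Division with remainder -/

/-- `a mod m` -/
def rm (a m : M) : M := ev .rem ![a, m]

/-- `⌊a / m⌋` -/
def qt (a m : M) : M := ev .quot ![a, m]

section

variable {Γ : Type*} [Coded M Γ] {f g : Γ → M}

@[fun_prop] theorem _root_.PVArith.Def.rm (hf : Def M f) (hg : Def M g) :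
    Def M fun γ => rm (f γ) (g γ) := Def.app2 _ hf hg

@[fun_prop] theorem _root_.PVArith.Def.qt (hf : Def M f) (hg : Def M g) :
    Def M fun γ => qt (f γ) (g γ) := Def.app2 _ hf hg

end

open Classical in
theorem ev_redOnce (t m : M) : ev .redOnce ![t, m] = if t < m then t else t - m := by
  rw [Sym.redOnce, ev_ap3, ev_cond]
  simp [tsub_eq_zero_iff_le]

theorem ev_redOnce_le (t m : M) : ev .redOnce ![t, m] ≤ t := by
  classical
  rw [ev_redOnce]
  split_ifs
  exacts [le_rfl, tsub_le_self]

@[simp] theorem rm_zero_left (m : M) : rm 0 m = 0 :=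
  (ev_lrn_zero ![m] _ _ _ _).trans (by simp)

theorem rm_le (a m : M) : rm a m ≤ a := by
  rcases cases_hf a with h | h
  · by_cases h0 : hf a = 0
    · rw [h, h0, add_zero, rm_zero_left]
    · rw [h]
      exact (ev_lrn_even ![m] _ _ _ _ h0).trans_le ((min_le_right _ _).trans_eq (by simp))
  · rw [h]
    exact (ev_lrn_odd ![m] _ _ _ _ _).trans_le ((min_le_right _ _).trans_eq (by simp))

theorem rm_even {a : M} (m : M) (h : a ≠ 0) :
    rm (a + a) m = ev .redOnce ![rm a m + rm a m, m] := by
  have := ev_lrn_even ![m] 0 (.ap2 .redOnce (.proj 1 + .proj 1) (.proj 2))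
    (.ap2 .redOnce (.ap1 .succ (.proj 1 + .proj 1)) (.proj 2)) (.proj 0) h
  simp [cons_eq_vecCons] at this
  exact this.trans (min_eq_left ((ev_redOnce_le _ _).trans (add_le_add (rm_le a m) (rm_le a m))))

theorem rm_odd (a m : M) :
    rm (a + a + 1) m = ev .redOnce ![rm a m + rm a m + 1, m] := by
  have := ev_lrn_odd ![m] 0 (.ap2 .redOnce (.proj 1 + .proj 1) (.proj 2))
    (.ap2 .redOnce (.ap1 .succ (.proj 1 + .proj 1)) (.proj 2)) (.proj 0) a
  simp [cons_eq_vecCons] at this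
  exact this.trans (min_eq_left ((ev_redOnce_le _ _).trans
    (add_le_add_left (add_le_add (rm_le a m) (rm_le a m)) 1)))

@[simp] theorem qt_zero_left (m : M) : qt 0 m = 0 :=
  (ev_lrn_zero ![m] _ _ _ _).trans (by simp)

theorem digit_le_one (t m : M) : ev .cond ![m - t, 1, 0] ≤ 1 := by
  classical
  rw [ev_cond]
  split_ifs <;> simp

/-- `hq` ensures that the bound in the recursion for `Sym.quot` does not truncate the new value. -/
theorem qt_even {a m : M} (h : a ≠ 0) (hq : qt a m ≤ a) : qt (a + a) m =
    qt a m + qt a m + ev .cond ![m - (rm a m + rm a m), 1, 0] := by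
  have := ev_lrn_even ![m] (0 : Sym 1) (.proj 1 + .proj 1 + .ap3 .cond (.proj 2 -
      (.ap2 .rem (.proj 0) (.proj 2) + .ap2 .rem (.proj 0) (.proj 2))) 1 0)
    (.proj 1 + .proj 1 + .ap3 .cond (.proj 2 -
      .ap1 .succ (.ap2 .rem (.proj 0) (.proj 2) + .ap2 .rem (.proj 0) (.proj 2))) 1 0)
    (.ap1 .succ (.proj 0 + .proj 0)) h
  simp only [ev_add, ev_proj, ev_ap3, ev_sub, ev_ap2, ev_ap1, ev_one, ev_zero] at this
  refine this.trans (min_eq_left ?_)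
  refine (add_le_add (add_le_add hq hq) (digit_le_one _ _)).trans ?_
  simp only [ev_succ]
  exact add_le_add_left (add_le_add le_self_add le_self_add) 1

theorem qt_odd {a m : M} (hq : qt a m ≤ a) : qt (a + a + 1) m =
    qt a m + qt a m + ev .cond ![m - (rm a m + rm a m + 1), 1, 0] := by
  have := ev_lrn_odd ![m] (0 : Sym 1) (.proj 1 + .proj 1 + .ap3 .cond (.proj 2 -
      (.ap2 .rem (.proj 0) (.proj 2) + .ap2 .rem (.proj 0) (.proj 2))) 1 0)
    (.proj 1 + .proj 1 + .ap3 .cond (.proj 2 -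
      .ap1 .succ (.ap2 .rem (.proj 0) (.proj 2) + .ap2 .rem (.proj 0) (.proj 2))) 1 0)
    (.ap1 .succ (.proj 0 + .proj 0)) a
  simp only [ev_add, ev_proj, ev_ap3, ev_sub, ev_ap2, ev_ap1, ev_one, ev_zero, ev_succ] at this
  refine this.trans (min_eq_left ?_)
  refine (add_le_add (add_le_add hq hq) (digit_le_one _ _)).trans ?_
  simp only [Fin.cons_zero]
  exact add_le_add_left ((le_self_add (b := a + a + 1 + 1)).trans_eq (by ring)) 1

/-- One digit of long division: 2a + b = 2q·m + (2r + b), and 2r + b < 2m, so subtracting `m` at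
most once restores a remainder. -/
theorem div_step {a q r m b : M} (h : a = q * m + r) (hr : r < m) (hb : b ≤ 1) :
    a + a + b = (q + q + ev .cond ![m - (r + r + b), 1, 0]) * m + ev .redOnce ![r + r + b, m] ∧
      ev .redOnce ![r + r + b, m] < m := by
  classical
  rw [ev_cond, ev_redOnce]
  by_cases hm : r + r + b < m
  · rw [if_neg (by simpa [tsub_eq_zero_iff_le] using hm), if_pos hm, h]
    exact ⟨by ring, hm⟩
  · have hm' := not_lt.1 hm
    rw [if_pos (by simpa [tsub_eq_zero_iff_le] using hm), if_neg hm]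
    obtain ⟨c, hc⟩ := exists_add_of_le hm'
    rw [hc, add_tsub_cancel_left]
    constructor
    · calc a + a + b = (q + q) * m + (r + r + b) := by rw [h]; ring
        _ = _ := by rw [hc]; ring
    · by_contra h1
      have h2 : m + m ≤ r + r + b := hc ▸ add_le_add_right (not_lt.1 h1) m
      have h3 : r + r + b < m + m := by
        calc r + r + b ≤ r + r + 1 := add_le_add_right hb _
          _ < r + r + 1 + 1 := Order.lt_add_one_iff.2 le_rfl
          _ = (r + 1) + (r + 1) := by ring
          _ ≤ m + m := add_le_add (lt_iff_succ_le.1 hr) (lt_iff_succ_le.1 hr)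
      exact h2.not_gt h3

theorem div_spec (a : M) {m : M} (hm : m ≠ 0) : a = qt a m * m + rm a m ∧ rm a m < m := by
  refine notation_induction (P := fun a => a = qt a m * m + rm a m ∧ rm a m < m) (by fun_prop)
    (by simpa using pos_iff.2 hm) ?_ a
  intro a ih
  have hq : qt (hf a) m ≤ hf a := by
    conv_rhs => rw [ih.1]
    exact (le_mul_of_one_le_right (zero_le' _) (one_le_iff.2 hm)).trans le_self_add
  rcases cases_hf a with h | h
  · by_cases h0 : hf a = 0
    · rw [h, h0, add_zero, rm_zero_left, qt_zero_left, zero_mul, zero_add]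
      exact ⟨rfl, pos_iff.2 hm⟩
    · have := div_step ih.1 ih.2 (zero_le' 1)
      rw [add_zero, add_zero] at this
      rwa [h, qt_even h0 hq, rm_even m h0]
  · rw [h, qt_odd hq, rm_odd]
    exact div_step ih.1 ih.2 le_rfl

theorem rm_lt (a : M) {m : M} (hm : m ≠ 0) : rm a m < m := (div_spec a hm).2

theorem rm_unique {a q r m : M} (h : a = q * m + r) (hr : r < m) : rm a m = r := by
  obtain ⟨h₁, h₂⟩ := div_spec a (pos_iff.1 ((zero_le' r).trans_lt hr))
  have hq : qt a m = q := by
    refine div_unique (m := m) (q := a) (le_self_add.trans_eq h₁.symm) ?_ (le_self_add.trans_eq h.symm) ?_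
    · conv_lhs => rw [h₁]
      rw [add_mul, one_mul]
      exact add_lt_add_right h₂ _
    · conv_lhs => rw [h]
      rw [add_mul, one_mul]
      exact add_lt_add_right hr _
  rw [hq] at h₁
  exact (add_left_cancel (h.symm.trans h₁)).symm

theorem rm_eq_zero_iff {a m : M} (hm : m ≠ 0) : rm a m = 0 ↔ m ∣ a := by
  constructor
  · intro h
    have := (div_spec a hm).1
    rw [h, add_zero] at this
    exact ⟨_, this.trans (mul_comm _ _)⟩
  · rintro ⟨q, rfl⟩
    exact rm_unique (by rw [mul_comm, add_zero]) (pos_iff.2 hm)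

/-! ### Primes and inverses modulo a prime -/

theorem le_of_dvd' {a b : M} (hb : b ≠ 0) (h : a ∣ b) : a ≤ b := by
  obtain ⟨c, rfl⟩ := h
  exact le_mul_of_one_le_right (zero_le' _) (one_le_iff.2 fun h => hb (by rw [h, mul_zero]))

/-- A prime element of a model. -/
def IsPrime (p : M) : Prop := 1 < p ∧ ∀ d, d ∣ p → d = 1 ∨ d = p

theorem exists_recursion' {g b : M} {h : Len M → M → M}
    (hh : Def M fun x : Len M × M => h x.1 x.2) :
    ∃ T : Len M → M, Def M T ∧ T 0 = min g b ∧ ∀ j, T (j + 1) = min (h j (T j)) b := by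
  obtain ⟨T, hT, h0, hs⟩ := exists_recursion (Γ := M) (g := fun _ => g) (b := fun _ => b)
    (h := fun _ => h) (by fun_prop) (by fun_prop)
    (hh.comp (g := fun x : M × Len M × M => x.2) (by fun_prop))
  exact ⟨T 0, hT.comp (f := fun x : M × Len M => T x.1 x.2)
    (g := fun i => (0, i)) (by fun_prop), h0 0, hs 0⟩

theorem half_le_of_add_le {a b : M} (h : a + a ≤ b) : a ≤ hf b := by
  by_contra! hl
  have h1 : hf b + 1 + (hf b + 1) ≤ b :=
    (add_le_add (lt_iff_succ_le.1 hl) (lt_iff_succ_le.1 hl)).trans h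
  have h2 : b ≤ hf b + hf b + 1 := by
    rcases cases_hf b with h | h
    · exact h.le.trans le_self_add
    · exact h.le
  refine absurd (h1.trans h2) (not_le.2 ?_)
  rw [← Order.add_one_le_iff]
  exact (by ring : hf b + hf b + 1 + 1 = hf b + 1 + (hf b + 1)).le

/-- A multiple of `c` modulo a prime `p` that is at most half of `c`. -/
theorem exists_smaller_multiple {p c : M} (hp : IsPrime p) (hc : 1 < c) (hcp : c < p) :
    let s := rm p c
    let v := if s + s ≤ c then p - qt p c else qt p c + 1
    rm (v * c) p ≠ 0 ∧ rm (v * c) p ≤ hf c := by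
  intro s v
  have hc0 : c ≠ 0 := (zero_lt_one.trans hc).ne'
  obtain ⟨h1, h2⟩ := div_spec p hc0
  -- A zero remainder would make `c` a divisor of `p` strictly between 1 and `p`.
  have hs : s ≠ 0 := fun hs => by
    rcases hp.2 c ((rm_eq_zero_iff hc0).1 hs) with h | h
    · exact hc.ne' h
    · exact hcp.ne h
  change p = qt p c * c + s at h1
  change s < c at h2
  -- Write p = Qc + s. The multiplier -Q, represented by p - Q, yields the residue `s`; the
  -- multiplier Q + 1 yields c - s. One of these is at most half of `c`.
  by_cases h : s + s ≤ c
  · have hq : qt p c ≤ p := by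
      conv_rhs => rw [h1]
      exact (le_mul_of_one_le_right (zero_le' _) hc.le).trans le_self_add
    obtain ⟨w, hw⟩ := exists_add_of_le hq
    have hv : v = w := by
      simp only [v, if_pos h]
      exact tsub_eq_of_eq_add_rev hw
    have hwc : w * c = (c - 1) * p + s := by
      obtain ⟨e, rfl⟩ := exists_add_of_le hc.le
      have h3 : qt p (1 + e) * (1 + e) + w * (1 + e) =
          qt p (1 + e) * (1 + e) + ((1 + e - 1) * p + s) := by
        rw [add_tsub_cancel_left, ← add_mul, ← hw, mul_add, mul_one]
        calc p + p * e = (qt p (1 + e) * (1 + e) + s) + e * p := by rw [← h1]; ring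
          _ = _ := by ring
      exact add_left_cancel h3
    rw [hv, rm_unique hwc (h2.trans hcp)]
    exact ⟨hs, half_le_of_add_le h⟩
  · obtain ⟨e, he⟩ := exists_add_of_le h2.le
    have hv : v * c = 1 * p + e := by
      simp only [v, if_neg h]
      rw [add_mul, one_mul, one_mul]
      conv_rhs => rw [h1]
      conv_lhs => enter [2]; rw [he]
      ring
    have hes : e < s := by
      rw [not_le] at h
      conv_lhs at h => rw [he]
      exact lt_of_add_lt_add_left h
    rw [rm_unique hv ((hes.trans h2).trans hcp)]
    refine ⟨fun h0 => h2.ne (by rw [he, h0, add_zero]), half_le_of_add_le ?_⟩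
    rw [he]
    exact add_le_add_left hes.le e

theorem rm_mul_rm (a b : M) {m : M} (hm : m ≠ 0) : rm (a * rm b m) m = rm (a * b) m := by
  obtain ⟨h1, -⟩ := div_spec (a * rm b m) hm
  refine (rm_unique (q := qt (a * rm b m) m + a * qt b m) ?_ (rm_lt _ hm)).symm
  calc a * b = a * (qt b m * m) + (qt (a * rm b m) m * m + rm (a * rm b m) m) := by
        rw [← h1, ← mul_add, ← (div_spec b hm).1]
    _ = _ := by ring

/-- Numbers not divisible by a prime `p` are invertible modulo `p`. -/
theorem exists_inverse {p c : M} (hp : IsPrime p) (hc : c ≠ 0) (hcp : c < p) :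
    ∃ u, rm (u * c) p = 1 := by
  classical
  have hp0 : p ≠ 0 := (zero_lt_one.trans hp.1).ne'
  -- The multiplier is 1 for residues up to 1, so that the iteration rests once the residue 1 is
  -- reached.
  let v (d : M) : M := if d ≤ 1 then 1 else
    if rm p d + rm p d ≤ d then p - qt p d else qt p d + 1
  have hv : Def M v := by
    simp only [v]
    fun_prop
  obtain ⟨T, hT, h0, hs⟩ := exists_recursion' (g := 1) (b := p)
    (h := fun _ t => rm (v (rm (t * c) p) * t) p) (by fun_prop)
  rw [min_eq_left hp.1.le] at h0
  replace hs (j) : T (j + 1) = rm (v (rm (T j * c) p) * T j) p :=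
    (hs j).trans (min_eq_left (rm_lt _ hp0).le)
  -- Until it is 1, the residue of `T j * c` loses a binary digit in each step and never becomes
  -- zero; after |c| steps only the value 1 is left.
  have key : ∀ j, rm (T j * c) p ≠ 0 ∧
      (rm (T j * c) p ≤ 1 ∨ sz (rm (T j * c) p) + j ≤ sz c) := by
    refine len_induction (by fun_prop) ?_ fun j hj => ?_
    · rw [h0, one_mul, rm_unique (q := 0) (r := c) (by ring) hcp]
      exact ⟨hc, .inr (by simp)⟩
    · have e : rm (T (j + 1) * c) p = rm (v (rm (T j * c) p) * rm (T j * c) p) p := by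
        rw [hs, mul_comm, rm_mul_rm _ _ hp0, rm_mul_rm _ _ hp0]
        ring_nf
      rw [e]
      obtain ⟨hj, hj'⟩ := hj
      generalize hd : rm (T j * c) p = d at *
      by_cases h1 : d ≤ 1
      · have hd1 : d = 1 := h1.antisymm (one_le_iff.2 hj)
        have : rm (v d * d) p = 1 := by
          rw [hd1]
          simp only [v, if_pos le_rfl, one_mul]
          exact rm_unique (q := 0) (by ring) hp.1
        rw [this]
        exact ⟨one_ne_zero, .inl le_rfl⟩
      · have := exists_smaller_multiple hp (not_le.1 h1) (hd ▸ rm_lt _ hp0)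
        simp only [v, if_neg h1]
        refine ⟨this.1, .inr ?_⟩
        refine le_trans ?_ (hj'.resolve_left h1)
        rw [sz_hf hj]
        push_cast
        rw [add_comm (j : M) 1, ← add_assoc]
        exact add_le_add_left (add_le_add_left (sz_mono this.2) 1) _
  refine ⟨T (len c), ?_⟩
  obtain ⟨h1, h2⟩ := key (len c)
  rcases h2 with h2 | h2
  · exact h2.antisymm (one_le_iff.2 h1)
  · exact absurd (sz_eq_zero.1 (nonpos_iff_eq_zero.1 (by simpa using h2))) h1

end PVModel
end PVArith

namespace PVArith
namespace PVModel

variable {M : Type*} [PVModel M]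

/-! ### Divisibility of lengths -/

theorem coe_dvd_coe {i j : Len M} : (i : M) ∣ j ↔ i ∣ j := by
  constructor
  · rintro ⟨c, hc⟩
    by_cases hi : i = 0
    · rw [hi]
      exact ⟨0, Subtype.ext (by simpa [hi] using hc)⟩
    · have hi' : (1 : M) ≤ i := one_le_iff.2 fun h => hi (Subtype.ext h)
      obtain ⟨k, hk⟩ := exists_len_eq (i := j) (a := c)
        (hc ▸ le_mul_of_one_le_left (zero_le' c) hi')
      exact ⟨k, Subtype.ext (by simp [hc, hk])⟩
  · rintro ⟨k, rfl⟩
    exact ⟨k, by simp⟩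

-- The quantifier in divisibility is removed by testing the remainder; the divisor zero is treated
-- apart.
@[fun_prop] theorem _root_.PVArith.Def.len_dvd {Γ : Type*} [Coded M Γ] {f g : Γ → Len M}
    (hf : Def M f) (hg : Def M g) : Def M fun γ => f γ ∣ g γ := by
  have : Def M fun γ => ((f γ = 0 ∧ g γ = 0) ∨ (¬ f γ = 0 ∧ rm (g γ : M) (f γ) = 0)) := by
    fun_prop
  convert this using 3 with γ
  by_cases h : f γ = 0
  · simp [h]
  · simp [h, rm_eq_zero_iff (m := (f γ : M)) (fun h' => h (Subtype.ext h')), coe_dvd_coe]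

theorem len_exists_div (i : Len M) {m : Len M} (hm : m ≠ 0) :
    ∃ q r, i = m * q + r ∧ r < m := by
  obtain ⟨h1, h2⟩ := div_spec (i : M) (m := m) (fun h => hm (Subtype.ext h))
  obtain ⟨r, hr⟩ := exists_len_eq (i := m) h2.le
  obtain ⟨q, hq⟩ := exists_len_eq (i := i) (a := qt (i : M) m) (by
    conv_rhs => rw [h1]
    exact (le_mul_of_one_le_right (zero_le' _)
      (one_le_iff.2 fun h => hm (Subtype.ext h))).trans le_self_add)
  rw [← hr, ← hq] at h1
  exact ⟨q, r, Subtype.ext (by rw [h1]; simp [mul_comm]), by rw [← hr] at h2; exact h2⟩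

theorem len_one_le_iff {i : Len M} : 1 ≤ i ↔ i ≠ 0 := by
  rw [← not_lt, Order.lt_one_iff]

/-- The Euclidean algorithm, as a strong induction on the first argument. Lengths have no negatives,
so the identity is stated with `g + b * m` on one side. -/
theorem bezout (m n : Len M) (hm : m ≠ 0) (hn : n ≠ 0) :
    ∃ a b g, g ≠ 0 ∧ g ∣ m ∧ g ∣ n ∧ a * n = g + b * m := by
  -- The second argument and all witnesses are bounded by lengths, which makes the induction
  -- predicate definable; the case `n + m + 1 ≤ k` keeps the arguments of the algorithm in range.
  suffices H : ∀ k, (k = 0 ∨ n + m + 1 ≤ k) ∨ ∀ n' < n + m + 1, n' = 0 ∨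
      ∃ a < k + 1, ∃ b < n' + 1, ∃ g < k + 1, (¬ g = 0) ∧ g ∣ k ∧ g ∣ n' ∧
        a * n' = g + b * k by
    have hm' : ¬ n + m + 1 ≤ m := by
      rw [Order.add_one_le_iff, not_lt]
      exact le_add_self
    obtain ⟨a, -, b, -, g, -, h⟩ := (((H m).resolve_left (by tauto)) n
      (Order.lt_add_one_iff.2 le_self_add)).resolve_left hn
    exact ⟨a, b, g, h⟩
  generalize n + m + 1 = N
  clear hn hm n m
  intro m
  refine len_strong_induction (P := fun m => (m = 0 ∨ N ≤ m) ∨ ∀ n' < N, n' = 0 ∨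
      ∃ a < m + 1, ∃ b < n' + 1, ∃ g < m + 1, (¬ g = 0) ∧ g ∣ m ∧ g ∣ n' ∧
        a * n' = g + b * m) ?_ ?_ m
  · refine .or (by fun_prop) (.ball (by fun_prop) (.or (by fun_prop) ?_))
    refine .bex (by fun_prop) (.bex (by fun_prop) (.bex (by fun_prop) (by fun_prop)))
  · intro m ih
    by_cases h0 : m = 0 ∨ N ≤ m
    · exact .inl h0
    rw [not_or, not_le] at h0
    obtain ⟨hm, hmN⟩ := h0
    refine .inr fun n hnN => ?_
    by_cases hn : n = 0
    · exact .inl hn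
    right
    obtain ⟨c, s, rfl, hs⟩ := len_exists_div n hm
    by_cases hs0 : s = 0
    · subst hs0
      rw [add_zero] at hn ⊢
      obtain ⟨d, rfl⟩ : ∃ d, c = 1 + d :=
        exists_add_of_le (len_one_le_iff.2 fun h => hn (by rw [h, mul_zero]))
      refine ⟨1, ?_, d, ?_, m, Order.lt_add_one_iff.2 le_rfl, hm, dvd_rfl, dvd_mul_right _ _,
        by ring⟩
      · exact Order.lt_add_one_iff.2 (len_one_le_iff.2 hm)
      · refine Order.lt_add_one_iff.2 (le_trans ?_
          (le_mul_of_one_le_left zero_le (len_one_le_iff.2 hm)))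
        exact le_add_self
    · obtain ⟨a, ha, b, hb, g, hg, hg0, hgs, hgm, h⟩ := ((ih s hs).resolve_left (by
        rw [not_or, not_le]; exact ⟨hs0, hs.trans hmN⟩) m hmN).resolve_left hm
      -- The induction hypothesis for (s, m) reads a·m = g + b·s. With the complements t = m - b and
      -- w = s - a it becomes t·s = g + w·m, the form needed for n = m·c + s.
      obtain ⟨t, rfl⟩ := exists_add_of_le (Order.lt_add_one_iff.1 hb)
      obtain ⟨w, rfl⟩ := exists_add_of_le (Order.lt_add_one_iff.1 ha)
      refine ⟨t, Order.lt_add_one_iff.2 le_add_self, t * c + w, Order.lt_add_one_iff.2 ?_, g,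
        ?_, hg0, hgm, dvd_add (hgm.mul_right _) hgs, ?_⟩
      · rw [add_mul]
        exact add_le_add le_add_self le_add_self
      · exact hg.trans (add_lt_add_left hs 1)
      · have h' : a * t = g + b * w := add_left_cancel (a := a * b) (by linear_combination h)
        linear_combination h'

theorem isUnit_len_iff {i : Len M} : IsUnit i ↔ i = 1 := by
  rw [isUnit_iff_exists_inv]
  constructor
  · rintro ⟨j, hj⟩
    have hi : i ≠ 0 := by rintro rfl; simp at hj
    have hj0 : j ≠ 0 := by rintro rfl; simp at hj
    refine le_antisymm ?_ (len_one_le_iff.2 hi)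
    rw [← hj]
    exact le_mul_of_one_le_right zero_le (len_one_le_iff.2 hj0)
  · rintro rfl
    exact ⟨1, mul_one 1⟩

theorem len_le_of_dvd {a b : Len M} (hb : b ≠ 0) (h : a ∣ b) : a ≤ b := by
  obtain ⟨c, rfl⟩ := h
  exact le_mul_of_one_le_right zero_le (len_one_le_iff.2 fun h => hb (by rw [h, mul_zero]))
theorem len_dvd_of_dvd_add {a b c : Len M} (h : a ∣ b + c) (hc : a ∣ c) : a ∣ b := by
  by_cases ha : a = 0
  · subst ha
    rw [zero_dvd_iff] at *
    exact (add_eq_zero.1 h).1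
  obtain ⟨u, hu⟩ := h
  obtain ⟨v, rfl⟩ := hc
  have hvu : v ≤ u := le_of_mul_le_mul_left (hu ▸ le_add_self) (pos_iff_ne_zero.2 ha)
  obtain ⟨w, rfl⟩ := exists_add_of_le hvu
  exact ⟨w, add_right_cancel (b := a * v) (by linear_combination hu)⟩

/-- Let a divide bc and let `bezout` give a = g·a', b = g·b' and x·b' = 1 + y·a'. Then a' divides
b'c, hence x·b'c = c + a'·yc, hence c. Through this instance the general lemmas on `IsRelPrime`
apply to lengths. -/
instance : DecompositionMonoid (Len M) where
  primal a b c h := by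
    by_cases ha : a = 0
    · subst ha
      rcases mul_eq_zero.1 (zero_dvd_iff.1 h) with rfl | rfl
      · exact ⟨0, 1, dvd_rfl, one_dvd _, (mul_one 0).symm⟩
      · exact ⟨1, 0, one_dvd _, dvd_rfl, (one_mul 0).symm⟩
    by_cases hb : b = 0
    · exact ⟨a, 1, hb ▸ dvd_zero a, one_dvd _, (mul_one a).symm⟩
    obtain ⟨x, y, g, hg, ⟨a', rfl⟩, ⟨b', rfl⟩, hxy⟩ := bezout a b ha hb
    refine ⟨g, a', dvd_mul_right _ _, ?_, rfl⟩
    have h1 : x * b' = 1 + y * a' := mul_left_cancel₀ hg (by linear_combination hxy)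
    rw [mul_assoc] at h
    have h2 : a' ∣ b' * c := (mul_dvd_mul_iff_left hg).1 h
    have h3 : x * (b' * c) = c + a' * (y * c) := by linear_combination c * h1
    exact len_dvd_of_dvd_add (h3 ▸ h2.mul_left x) (dvd_mul_right _ _)

theorem irreducible_len_iff {q : Len M} :
    Irreducible q ↔ 1 < q ∧ ∀ d, d ∣ q → d = 1 ∨ d = q := by
  simp only [irreducible_iff, isUnit_len_iff]
  constructor
  · rintro ⟨h1, h2⟩
    have h0 : q ≠ 0 := by
      rintro rfl
      have h := h2 (zero_mul (0 : Len M)).symm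
      simp at h
    refine ⟨(len_one_le_iff.2 h0).lt_of_ne' h1, fun d ⟨e, he⟩ => ?_⟩
    rcases h2 he with h | h
    · exact .inl h
    · exact .inr (by rw [he, h, mul_one])
  · rintro ⟨h1, h2⟩
    refine ⟨h1.ne', fun a b hab => ?_⟩
    rcases h2 a ⟨b, hab⟩ with h | h
    · exact .inl h
    · refine .inr (mul_left_cancel₀ (a := q) (zero_lt_one.trans h1).ne' ?_)
      rw [mul_one]
      conv_rhs => rw [hab, h]

/-- The least divisor greater than 1 is irreducible. -/
theorem exists_prime_dvd {n : Len M} (hn : 1 < n) : ∃ q, Irreducible q ∧ q ∣ n := by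
  obtain ⟨q, ⟨h1, h2⟩, h3⟩ := exists_least (P := fun q => 1 < q ∧ q ∣ n) (by fun_prop)
    ⟨n, hn, dvd_rfl⟩
  have hq0 : q ≠ 0 := (zero_lt_one.trans h1).ne'
  refine ⟨q, irreducible_len_iff.2 ⟨h1, fun d hd => ?_⟩, h2⟩
  by_contra! h
  have hd0 : d ≠ 0 := by rintro rfl; exact hq0 (zero_dvd_iff.1 hd)
  exact h3 d ((len_le_of_dvd hq0 hd).lt_of_ne h.2)
    ⟨(len_one_le_iff.2 hd0).lt_of_ne' h.1, hd.trans h2⟩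

end PVModel
end PVArith

namespace PVArith
namespace PVModel

variable {M : Type*} [PVModel M]

/-! ### Blocks of digits -/

theorem shr_congr {u v : M} (a : M) (h : sz u = sz v) : shr u a = shr v a := by
  rw [shr_eq_iff, sm_congr_right 1 h]
  exact shr_bounds v a

/-- `⌊a / 2 ^ i⌋` -/
noncomputable def dx (a : M) (i : Len M) : M := shr (ones i) a

@[fun_prop] theorem _root_.PVArith.Def.dx {Γ : Type*} [Coded M Γ] {f : Γ → M} {g : Γ → Len M}
    (hf : Def M f) (hg : Def M g) : Def M fun γ => dx (f γ) (g γ) := by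
  unfold PVModel.dx
  fun_prop

theorem shr_eq_dx (u a : M) : shr u a = dx a (len u) :=
  shr_congr a (by simp)

theorem dx_eq_iff {a q : M} {i : Len M} : dx a i = q ↔ q * ex i ≤ a ∧ a < (q + 1) * ex i := by
  rw [dx, shr_eq_iff, sm_one_ones]

theorem dx_eq {a q r : M} {i : Len M} (h : a = q * ex i + r) (hr : r < ex i) : dx a i = q := by
  rw [dx_eq_iff, h, add_mul, one_mul]
  exact ⟨le_self_add, add_lt_add_right hr _⟩

theorem exists_dx (a : M) (i : Len M) : ∃ r < ex i, a = dx a i * ex i + r := by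
  obtain ⟨h1, h2⟩ := dx_eq_iff.1 (rfl : dx a i = dx a i)
  obtain ⟨r, hr⟩ := exists_add_of_le h1
  refine ⟨r, ?_, hr⟩
  rw [add_mul, one_mul] at h2
  exact lt_of_add_lt_add_left (hr.symm.trans_lt h2)

theorem dx_eq_zero_iff {a : M} {i : Len M} : dx a i = 0 ↔ a < ex i := by
  rw [dx_eq_iff]
  simp

theorem add_mul_lt_mul {a b q r : M} (hr : r < a) (hq : q < b) : q * a + r < b * a := by
  calc q * a + r < q * a + a := add_lt_add_right hr _
    _ = (q + 1) * a := by ring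
    _ ≤ b * a := mul_le_mul_left (lt_iff_succ_le.1 hq) a

theorem dx_dx (a : M) (i j : Len M) : dx (dx a i) j = dx a (i + j) := by
  obtain ⟨r, hr, h⟩ := exists_dx a i
  obtain ⟨s, hs, h'⟩ := exists_dx (dx a i) j
  refine (dx_eq (r := s * ex i + r) ?_ ?_).symm
  · conv_lhs => rw [h, h']
    rw [ex_add]; ring
  · exact (add_mul_lt_mul hr hs).trans_eq (by rw [ex_add, mul_comm])

@[simp] theorem dx_zero_left (i : Len M) : dx 0 i = 0 := dx_eq_zero_iff.2 (ex_pos i)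

@[simp] theorem dx_zero_right (a : M) : dx a 0 = a := dx_eq (r := 0) (by simp) (ex_pos 0)

theorem dx_add_mul_ex (a b : M) (i j : Len M) :
    dx (a + b * ex (i + j)) i = dx a i + b * ex j := by
  obtain ⟨r, hr, h⟩ := exists_dx a i
  refine dx_eq (r := r) ?_ hr
  conv_lhs => rw [h, ex_add]
  ring

theorem sz_dx (a : M) (i : Len M) : sz (dx a i) = sz a - i := by
  by_cases h : a < ex i
  · rw [dx_eq_zero_iff.2 h, sz_zero, tsub_eq_zero_of_le (lt_ex_iff.1 h)]
  · have hi : i ≤ len a := by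
      rw [lt_ex_iff, not_le] at h
      exact h.le
    obtain ⟨k, hk⟩ := exists_add_of_le hi
    have hk' : sz a = i + k := congrArg Subtype.val hk
    obtain ⟨r, hr, h'⟩ := exists_dx a i
    rw [hk', add_tsub_cancel_left]
    apply le_antisymm
    · rw [← lt_ex_iff]
      by_contra! h1
      have : ex (len a) ≤ a := by
        rw [hk, ex_add, mul_comm]
        exact (mul_le_mul_left h1 _).trans (le_self_add.trans_eq h'.symm)
      exact this.not_gt (lt_ex_len a)
    · by_contra! h1
      obtain ⟨l, hl⟩ := exists_len_eq (i := k) (a := sz (dx a i)) h1.le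
      have h2 : dx a i < ex l := by rw [lt_ex_iff, hl]
      have h3 : a < ex (l + i) := by
        rw [ex_add]
        conv_lhs => rw [h']
        exact add_mul_lt_mul hr h2
      rw [lt_ex_iff, hk', Subsemiring.coe_add, add_comm, add_le_add_iff_right] at h3
      exact h3.not_gt (hl.trans_lt h1)

/-! ### Coefficients of coded polynomials -/

section

variable (p : M)

/-- The code of the polynomial with the first `i` coefficients removed. -/
noncomputable def tl (f : M) (i : Len M) : M := dx f (len p * i)

/-- The coefficient of index `i`. -/
noncomputable def cf (f : M) (i : Len M) : M := tl p f i - tl p f (i + 1) * ex (len p)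

variable {p}

@[fun_prop] theorem _root_.PVArith.Def.tl {Γ : Type*} [Coded M Γ] {f : Γ → M} {g : Γ → Len M}
    (hf : Def M f) (hg : Def M g) : Def M fun γ => tl p (f γ) (g γ) := by
  unfold PVModel.tl
  fun_prop

@[fun_prop] theorem _root_.PVArith.Def.cf {Γ : Type*} [Coded M Γ] {f : Γ → M} {g : Γ → Len M}
    (hf : Def M f) (hg : Def M g) : Def M fun γ => cf p (f γ) (g γ) := by
  unfold PVModel.cf
  fun_prop

theorem tl_tl (f : M) (i j : Len M) : tl p (tl p f i) j = tl p f (i + j) := by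
  rw [tl, tl, tl, dx_dx, mul_add]

@[simp] theorem tl_zero_right (f : M) : tl p f 0 = f := by rw [tl, mul_zero, dx_zero_right]

@[simp] theorem tl_zero_left (i : Len M) : tl p 0 i = 0 := by rw [tl, dx_zero_left]

theorem tl_eq (f : M) (i : Len M) : tl p f i = cf p f i + tl p f (i + 1) * ex (len p) := by
  rw [cf, tsub_add_cancel_of_le]
  rw [← tl_tl, tl, mul_one]
  exact (dx_eq_iff.1 rfl).1

theorem cf_eq_of_tl_eq {f q r : M} {i : Len M} (h : tl p f i = q * ex (len p) + r)
    (hr : r < ex (len p)) : cf p f i = r := by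
  have h1 : tl p f (i + 1) = q := by
    rw [← tl_tl, tl, mul_one]
    exact dx_eq h hr
  have h2 := tl_eq (p := p) f i
  rw [h, h1, add_comm] at h2
  exact (add_right_cancel h2).symm

theorem cf_lt (f : M) (i : Len M) : cf p f i < ex (len p) := by
  obtain ⟨r, hr, h⟩ := exists_dx (tl p f i) (len p)
  rwa [cf_eq_of_tl_eq h hr]

theorem cf_tl (f : M) (i j : Len M) : cf p (tl p f i) j = cf p f (i + j) := by
  rw [cf, cf, tl_tl, tl_tl, add_assoc]

theorem coef_eq_cf (I f : M) : ev .coef ![I, p, f] = cf p f (len I) := by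
  have h1 : shr (hf (sm p I)) f = tl p f (len I) := by
    rw [shr_eq_dx, tl]
    congr 1
    exact Subtype.ext (by simp [sz_hf_eq_sub, sz_sm])
  have h2 (y : M) : ev .low ![p, y] = y - dx y (len p) * ex (len p) := by
    rw [Sym.low, ev_sub, ev_mul, ev_ap2, ev_ap2, ev_one]
    simp only [ev_proj, Matrix.cons_val_zero, Matrix.cons_val_one, ev_smash, ex_len]
    rw [← shr_eq_dx]
    rfl
  simp only [Sym.coef, ev_ap2, ev_ap1, ev_proj, ev_half]
  refine (h2 _).trans ?_
  change shr (hf (sm p I)) f - dx (shr (hf (sm p I)) f) _ * _ = _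
  rw [h1, cf, ← tl_tl _ _ 1]
  congr 3
  exact (mul_one (len p)).symm

variable (p) in
theorem tl_eq_zero {f : M} {i : Len M} (hp : p ≠ 0) (h : sz f ≤ i) : tl p f i = 0 := by
  rw [tl, dx_eq_zero_iff, lt_ex_iff]
  refine h.trans ?_
  simp only [Subsemiring.coe_mul, coe_len]
  exact le_mul_of_one_le_left (zero_le' _) (one_le_iff.2 fun h => hp (sz_eq_zero.1 h))

variable (p) in
theorem cf_eq_zero {f : M} {i : Len M} (hp : p ≠ 0) (h : sz f ≤ i) : cf p f i = 0 := by
  rw [cf, tl_eq_zero p hp h, zero_tsub]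

/-- The codes are rebuilt from the top: both tails vanish from index |f| + |g| on, and each step
downwards appends equal coefficients. -/
theorem cf_ext (hp : p ≠ 0) {f g : M} (h : ∀ i, cf p f i = cf p g i) : f = g := by
  have key : ∀ i, tl p f (len f + len g - i) = tl p g (len f + len g - i) := by
    refine len_induction (by fun_prop) ?_ fun i ih => ?_
    · rw [tl_eq_zero p hp, tl_eq_zero p hp] <;> simp
    · by_cases hi : len f + len g ≤ i
      · rwa [tsub_eq_zero_of_le (hi.trans le_self_add), ← tsub_eq_zero_of_le hi]
      · obtain ⟨k, hk⟩ := exists_add_of_le (Order.add_one_le_iff.2 (not_le.1 hi))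
        rw [hk, add_tsub_cancel_left, tl_eq, h, tl_eq g]
        rw [hk, add_assoc, add_tsub_cancel_left, add_comm] at ih
        rw [ih]
  simpa using key (len f + len g)

theorem cf_add_mul_ex_of_lt (a c : M) {i n : Len M} (h : i < n) :
    cf p (a + c * ex (len p * n)) i = cf p a i := by
  obtain ⟨k, rfl⟩ := exists_add_of_le (Order.add_one_le_iff.2 h)
  refine cf_eq_of_tl_eq (q := tl p a (i + 1) + c * ex (len p * k)) ?_ (cf_lt _ _)
  rw [tl, show len p * (i + 1 + k) = len p * i + len p * (1 + k) by ring, dx_add_mul_ex, ← tl,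
    tl_eq, mul_add, mul_one, ex_add]
  ring

theorem tl_add_mul_ex {a : M} (c : M) {n : Len M} (h : a < ex (len p * n)) (i : Len M) :
    tl p (a + c * ex (len p * n)) (n + i) = tl p c i := by
  rw [← tl_tl]
  congr 1
  rw [tl]
  exact dx_eq (add_comm _ _) h

theorem cf_add_mul_ex {a : M} (c : M) {n : Len M} (h : a < ex (len p * n)) (i : Len M) :
    cf p (a + c * ex (len p * n)) (n + i) = cf p c i := by
  rw [cf, add_assoc, tl_add_mul_ex c h, tl_add_mul_ex c h, cf]

theorem cf_of_lt {c : M} (hc : c < ex (len p)) : cf p c 0 = c :=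
  cf_eq_of_tl_eq (q := 0) (by simp) hc

theorem tl_of_lt {c : M} {n : Len M} (h : c < ex (len p * n)) (i : Len M) :
    tl p c (n + i) = 0 := by
  rw [← tl_tl, show tl p c n = 0 from dx_eq_zero_iff.2 h, tl_zero_left]

theorem cf_of_lt_of_le {c : M} {n i : Len M} (h : c < ex (len p * n)) (hi : n ≤ i) :
    cf p c i = 0 := by
  obtain ⟨k, rfl⟩ := exists_add_of_le hi
  rw [cf, tl_of_lt h, zero_tsub]

/-- The codes of polynomials over `ℤ/p`. -/
def IsPoly (p f : M) : Prop := ∀ i, cf p f i < p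

theorem lt_ex_len_mul_one (p : M) : p < ex (len p * 1) := by
  rw [mul_one]
  exact lt_ex_len p

/-! ### Codes of polynomials tabulated from their coefficients -/

section Tabulate

variable {c : Sym 4} {f g : M}

theorem ev_tabulate_zero : ev c.tabulate ![0, p, f, g] = 0 :=
  (ev_lrn_zero ![p, f, g] _ _ _ _).trans (by simp)

variable (hc : ∀ y y' : M, sz y = sz y' → ev c ![y, p, f, g] = ev c ![y', p, f, g])
  (hlt : ∀ y, ev c ![y, p, f, g] < p)

include hc

theorem ev_tabulate_congr {I J : M} (h : sz I = sz J) :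
    ev c.tabulate ![I, p, f, g] = ev c.tabulate ![J, p, f, g] := by
  refine lrn_congr (c := ![p, f, g]) (fun y y' v h => ?_) (fun y y' h => ?_) h
  · simp only [cons_eq_vecCons, ev_add, ev_mul, ev_ap4, ev_ap2, ev_proj, ev_smash]
    exact congrArg₂ (· + ·) rfl (congrArg₂ (· * ·) (hc _ _ h) (sm_congr_right _ h))
  · simp only [cons_eq_vecCons, ev_ap2, ev_proj, ev_smash]
    exact sm_congr_right _ h

include hlt

/-- Each coefficient is less than p < 2^|p|, so the blocks do not overlap, and the bound of the
recursion never truncates. -/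
theorem ev_tabulate_succ (i : Len M) :
    ev c.tabulate ![ones i, p, f, g] < ex (len p * i) ∧
    ev c.tabulate ![ones (i + 1), p, f, g] =
      ev c.tabulate ![ones i, p, f, g] + ev c ![ones i, p, f, g] * ex (len p * i) := by
  have hlt' (i) (h : ev c.tabulate ![ones i, p, f, g] < ex (len p * i)) :
      ev c.tabulate ![ones i, p, f, g] + ev c ![ones i, p, f, g] * ex (len p * i) <
        ex (len p * (i + 1)) := by
    rw [mul_add, mul_one, add_comm, add_comm (len p * i), ex_add]
    exact add_mul_lt_mul h ((hlt _).trans (lt_ex_len p))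
  have hmin (i) : ev c.tabulate ![ones (i + 1), p, f, g] =
      min (ev c.tabulate ![ones i, p, f, g] + ev c ![ones i, p, f, g] * ex (len p * i))
        (ex (len p * (i + 1))) := by
    refine (ev_lrn_succ (c := ![p, f, g]) (J := ones i) (fun y y' v h => ?_)
      (fun y y' h => ?_) (by simp)).trans ?_
    · simp only [cons_eq_vecCons, ev_add, ev_mul, ev_ap4, ev_ap2, ev_proj, ev_smash]
      exact congrArg₂ (· + ·) rfl (congrArg₂ (· * ·) (hc _ _ h) (sm_congr_right _ h))
    · simp only [cons_eq_vecCons, ev_ap2, ev_proj, ev_smash]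
      exact sm_congr_right _ h
    · simp only [cons_eq_vecCons, ev_add, ev_mul, ev_ap4, ev_ap2, ev_proj, ev_smash, sm_eq_ex]
      simp
      rfl
  have h1 : ∀ i, ev c.tabulate ![ones i, p, f, g] < ex (len p * i) := by
    refine len_induction (by fun_prop) ?_ fun i ih => ?_
    · rw [ones_zero, ev_tabulate_zero]
      exact ex_pos _
    · rw [hmin, min_eq_left (hlt' i ih).le]
      exact hlt' i ih
  exact ⟨h1 i, by rw [hmin, min_eq_left (hlt' i (h1 i)).le]⟩

theorem cf_tabulate (i n : Len M) : cf p (ev c.tabulate ![ones n, p, f, g]) i =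
    if i < n then ev c ![ones i, p, f, g] else 0 := by
  split_ifs with h
  · refine (len_induction (P := fun n => n ≤ i ∨ cf p (ev c.tabulate ![ones n, p, f, g]) i =
      ev c ![ones i, p, f, g]) (by fun_prop) (.inl zero_le) (fun n ih => ?_)
      n).resolve_left (not_le.2 h)
    rcases lt_trichotomy n i with hn | rfl | hn
    · exact .inl (Order.add_one_le_iff.2 hn)
    · right
      rw [(ev_tabulate_succ hc hlt n).2]
      refine Eq.trans ?_ (cf_of_lt (p := p) ?_)
      · simpa using cf_add_mul_ex (ev c ![ones n, p, f, g]) (ev_tabulate_succ hc hlt n).1 0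
      · exact (hlt _).trans (lt_ex_len p)
    · right
      rw [(ev_tabulate_succ hc hlt n).2, cf_add_mul_ex_of_lt _ _ hn]
      exact ih.resolve_left hn.not_ge
  · exact cf_of_lt_of_le (ev_tabulate_succ hc hlt n).1 (not_lt.1 h)

end Tabulate

end

end PVModel
end PVArith

namespace PVArith
namespace PVModel

variable {M : Type*} [PVModel M]

/-! ### The field `ℤ/p` -/

theorem rm_add_rm (a b : M) {m : M} (hm : m ≠ 0) : rm (a + rm b m) m = rm (a + b) m := by
  obtain ⟨h1, -⟩ := div_spec (a + rm b m) hm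
  refine (rm_unique (q := qt (a + rm b m) m + qt b m) ?_ (rm_lt _ hm)).symm
  calc a + b = (a + rm b m) + qt b m * m := by
        conv_lhs => rw [(div_spec b hm).1]
        ring
    _ = (qt (a + rm b m) m * m + rm (a + rm b m) m) + qt b m * m := by rw [← h1]
    _ = _ := by ring

theorem IsPrime.ne_zero {p : M} (hp : IsPrime p) : p ≠ 0 := (zero_lt_one.trans hp.1).ne'

theorem rm_of_lt {a m : M} (h : a < m) : rm a m = a := rm_unique (q := 0) (by ring) h

section

set_option linter.unusedSectionVars false

variable (p : M) [hp : Fact (IsPrime p)]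

/-- Congruence modulo `p`. -/
def modCon : RingCon M where
  r a b := rm a p = rm b p
  iseqv := ⟨fun _ => rfl, Eq.symm, Eq.trans⟩
  add' {a b c d} h₁ h₂ := by
    change rm a p = rm b p at h₁
    change rm c p = rm d p at h₂
    rw [← rm_add_rm a c hp.out.ne_zero, h₂, rm_add_rm _ _ hp.out.ne_zero, add_comm,
      ← rm_add_rm _ _ hp.out.ne_zero, h₁, rm_add_rm _ _ hp.out.ne_zero, add_comm]
  mul' {a b c d} h₁ h₂ := by
    change rm a p = rm b p at h₁
    change rm c p = rm d p at h₂
    rw [← rm_mul_rm a c hp.out.ne_zero, h₂, rm_mul_rm _ _ hp.out.ne_zero, mul_comm,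
      ← rm_mul_rm _ _ hp.out.ne_zero, h₁, rm_mul_rm _ _ hp.out.ne_zero, mul_comm]

/-- The field `ℤ/p`. -/
def Fp : Type _ := (modCon p).Quotient

noncomputable instance : CommSemiring (Fp p) := inferInstanceAs (CommSemiring (modCon p).Quotient)

/-- The residue class modulo `p`. -/
noncomputable def cls : M →+* Fp p := (modCon p).mk'

variable {p}

theorem cls_surjective : Function.Surjective (cls p) := Quotient.mk_surjective

theorem cls_eq_cls {a b : M} : cls p a = cls p b ↔ rm a p = rm b p := (modCon p).eq

/-- The representative of a residue class that is less than `p`. -/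
noncomputable def rep (c : Fp p) : M := rm (Function.surjInv cls_surjective c) p

@[simp] theorem rep_cls (a : M) : rep (cls p a) = rm a p :=
  cls_eq_cls.1 (Function.surjInv_eq cls_surjective (cls p a))

theorem cls_rm (a : M) : cls p (rm a p) = cls p a :=
  cls_eq_cls.2 (rm_of_lt (rm_lt _ hp.out.ne_zero))

@[simp] theorem cls_rep (c : Fp p) : cls p (rep c) = c := by
  obtain ⟨a, rfl⟩ := cls_surjective c
  rw [rep_cls, cls_rm]

theorem rep_lt (c : Fp p) : rep c < p := rm_lt _ hp.out.ne_zero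

theorem rep_injective : Function.Injective (rep : Fp p → M) := fun c d h => by
  rw [← cls_rep c, h, cls_rep]

theorem cls_p : cls p p = 0 := by
  rw [← map_zero (cls p), cls_eq_cls, rm_zero_left]
  exact rm_unique (q := 1) (by ring) (pos_iff.2 hp.out.ne_zero)

/-- There are no negative elements in the model; the class of `p - 1` serves as -1. -/
noncomputable instance : Neg (Fp p) := ⟨fun c => cls p (p - 1) * c⟩

noncomputable instance : CommRing (Fp p) where
  __ := (inferInstance : CommSemiring (Fp p))
  zsmul := zsmulRec
  neg_add_cancel c := by
    change cls p (p - 1) * c + c = 0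
    have : cls p (p - 1) + 1 = 0 := by
      rw [← map_one (cls p), ← map_add, tsub_add_cancel_of_le hp.out.1.le, cls_p]
    calc cls p (p - 1) * c + c = (cls p (p - 1) + 1) * c := by ring
      _ = 0 := by rw [this, zero_mul]

theorem neg_eq (c : Fp p) : -c = cls p (p - 1) * c := rfl

theorem cls_eq_zero_of_lt {a : M} (h : a < p) : cls p a = 0 ↔ a = 0 := by
  rw [← map_zero (cls p), cls_eq_cls, rm_zero_left, rm_of_lt h]

instance : Nontrivial (Fp p) := ⟨1, 0, fun h => one_ne_zero
  ((cls_eq_zero_of_lt hp.out.1).1 (by rw [map_one, h]))⟩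

theorem exists_mul_eq_one {c : Fp p} (hc : c ≠ 0) : ∃ d, d * c = 1 := by
  have h0 : rep c ≠ 0 := fun h => hc (by rw [← cls_rep c, h, map_zero])
  obtain ⟨u, hu⟩ := exists_inverse hp.out h0 (rep_lt c)
  refine ⟨cls p u, ?_⟩
  rw [← cls_rep c, ← map_mul, ← map_one (cls p), cls_eq_cls, hu, rm_of_lt hp.out.1]

instance : NoZeroDivisors (Fp p) where
  eq_zero_or_eq_zero_of_mul_eq_zero {a b} h := by
    by_contra! h'
    obtain ⟨d, hd⟩ := exists_mul_eq_one h'.1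
    apply h'.2
    linear_combination d * h - b * hd

noncomputable instance : Coded M (Fp p) := ⟨1, fun c _ => rep c⟩

section

variable {Γ : Type*} [Coded M Γ]

@[fun_prop] theorem _root_.PVArith.Def.rep {f : Γ → Fp p} (hf : Def M f) :
    Def M fun γ => rep (f γ) := hf

@[fun_prop] theorem _root_.PVArith.Def.cls {f : Γ → M} (hf : Def M f) :
    Def M fun γ => cls p (f γ) := by
  change Def M fun γ => PVModel.rep (PVModel.cls p (f γ))
  simp only [rep_cls]
  fun_prop

@[fun_prop] theorem _root_.PVArith.Def.Fp_add {f g : Γ → Fp p} (hf : Def M f) (hg : Def M g) :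
    Def M fun γ => f γ + g γ := by
  have : Def M fun γ => PVModel.cls p (PVModel.rep (f γ) + PVModel.rep (g γ)) := by fun_prop
  simpa only [map_add, cls_rep] using this

@[fun_prop] theorem _root_.PVArith.Def.Fp_mul {f g : Γ → Fp p} (hf : Def M f) (hg : Def M g) :
    Def M fun γ => f γ * g γ := by
  have : Def M fun γ => PVModel.cls p (PVModel.rep (f γ) * PVModel.rep (g γ)) := by fun_prop
  simpa only [map_mul, cls_rep] using this

@[fun_prop] theorem _root_.PVArith.Def.Fp_eq {f g : Γ → Fp p} (hf : Def M f) (hg : Def M g) :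
    Def M fun γ => f γ = g γ := by
  have : Def M fun γ => PVModel.rep (f γ) = PVModel.rep (g γ) := by fun_prop
  simpa only [rep_injective.eq_iff] using this

end

/-! ### Polynomials over `ℤ/p` -/

variable (p) in
/-- The type of polynomials over `ℤ/p`. -/
structure Poly where
  /-- The code of a polynomial. -/
  val : M
  isPoly : IsPoly p val

noncomputable instance : Coded M (Poly p) := ⟨1, fun f _ => f.1⟩

namespace Poly

theorem val_inj {f g : Poly p} : f.1 = g.1 ↔ f = g := by
  cases f
  cases g
  simp

/-- The coefficient of index `i`. -/
noncomputable def co (f : Poly p) (i : Len M) : Fp p := cls p (cf p f.1 i)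

theorem rep_co (f : Poly p) (i : Len M) : rep (f.co i) = cf p f.1 i := by
  rw [co, rep_cls, rm_of_lt (f.2 i)]

theorem ext {f g : Poly p} (h : ∀ i, f.co i = g.co i) : f = g :=
  val_inj.1 (cf_ext hp.out.ne_zero fun i => by rw [← rep_co, ← rep_co, h])

/-- The polynomial with the first `i` coefficients removed. -/
noncomputable def drop (f : Poly p) (i : Len M) : Poly p :=
  ⟨tl p f.1 i, fun j => by rw [cf_tl]; exact f.2 _⟩

@[simp] theorem co_drop (f : Poly p) (i j : Len M) : (f.drop i).co j = f.co (i + j) := by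
  rw [co, drop, cf_tl, co]

theorem drop_drop (f : Poly p) (i j : Len M) : (f.drop i).drop j = f.drop (i + j) :=
  val_inj.1 (tl_tl _ _ _)

@[simp] theorem drop_zero (f : Poly p) : f.drop 0 = f := val_inj.1 (tl_zero_right _)

theorem cf_zero_left (i : Len M) : cf p 0 i = 0 := by rw [cf, tl_zero_left, zero_tsub]

noncomputable instance : Zero (Poly p) := ⟨⟨0, fun i => by
  rw [cf_zero_left]; exact pos_iff.2 hp.out.ne_zero⟩⟩

@[simp] theorem co_zero (i : Len M) : (0 : Poly p).co i = 0 := by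
  rw [co, show (0 : Poly p).1 = 0 from rfl, cf_zero_left, map_zero]

theorem drop_eq_zero {f : Poly p} {i : Len M} (h : sz f.1 ≤ i) : f.drop i = 0 :=
  val_inj.1 (tl_eq_zero p hp.out.ne_zero h)

section

variable {Γ : Type*} [Coded M Γ]

@[fun_prop] theorem _root_.PVArith.Def.Poly_val {f : Γ → Poly p} (hf : Def M f) :
    Def M fun γ => (f γ).1 := hf

theorem def_iff {f : Γ → Poly p} : Def M f ↔ Def M fun γ => (f γ).1 := Iff.rfl

@[fun_prop] theorem _root_.PVArith.Def.Poly_eq {f g : Γ → Poly p} (hf : Def M f)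
    (hg : Def M g) : Def M fun γ => f γ = g γ := by
  have : Def M fun γ => (f γ).1 = (g γ).1 := by fun_prop
  simpa only [val_inj] using this

@[fun_prop] theorem _root_.PVArith.Def.co {f : Γ → Poly p} {g : Γ → Len M} (hf : Def M f)
    (hg : Def M g) : Def M fun γ => (f γ).co (g γ) := by
  unfold Poly.co
  fun_prop

@[fun_prop] theorem _root_.PVArith.Def.drop {f : Γ → Poly p} {g : Γ → Len M} (hf : Def M f)
    (hg : Def M g) : Def M fun γ => (f γ).drop (g γ) := by
  rw [def_iff]
  unfold Poly.drop
  fun_prop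

end

/-- Induction on polynomials. -/
theorem induction {P : Poly p → Prop} (hP : Def M P) (h0 : P 0)
    (ih : ∀ f, P (f.drop 1) → P f) (f : Poly p) : P f := by
  have key : ∀ i, P (f.drop (len f.1 - i)) := by
    have hd : Def M fun i => f.drop (len f.1 - i) :=
      .drop (.const f) (.len_sub (.const _) .id)
    have hQ : Def M fun i => P (f.drop (len f.1 - i)) := hP.comp hd
    refine len_induction hQ ?_ fun i hi => ?_
    · rwa [drop_eq_zero (by simp)]
    · by_cases h : len f.1 ≤ i
      · rwa [tsub_eq_zero_of_le (h.trans le_self_add), ← tsub_eq_zero_of_le h]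
      · obtain ⟨k, hk⟩ := exists_add_of_le (Order.add_one_le_iff.2 (not_le.1 h))
        rw [hk, add_assoc, add_tsub_cancel_left, add_comm] at hi
        rw [hk, add_tsub_cancel_left]
        exact ih _ (by rwa [drop_drop])
  simpa using key (len f.1)

/-- The constant polynomial `c`. -/
noncomputable def C (c : Fp p) : Poly p := ⟨rep c, fun i => by
  rcases eq_or_ne i 0 with rfl | hi
  · rw [cf_of_lt ((rep_lt c).trans (lt_ex_len p))]
    exact rep_lt c
  · rw [cf_of_lt_of_le (n := 1) ((rep_lt c).trans (lt_ex_len_mul_one p)) (len_one_le_iff.2 hi)]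
    exact pos_iff.2 hp.out.ne_zero⟩

@[simp] theorem co_C_zero (c : Fp p) : (C c).co 0 = c := by
  rw [co, C, cf_of_lt ((rep_lt c).trans (lt_ex_len p)), cls_rep]

@[simp] theorem co_C_succ (c : Fp p) (i : Len M) : (C c).co (i + 1) = 0 := by
  rw [co, C, cf_of_lt_of_le (n := 1) ((rep_lt c).trans (lt_ex_len_mul_one p)) le_add_self,
    map_zero]

/-- The polynomial `X ^ n * f`. -/
noncomputable def shift (n : Len M) (f : Poly p) : Poly p := ⟨f.1 * ex (len p * n), fun i => by
  rcases lt_or_ge i n with hi | hi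
  · have := cf_add_mul_ex_of_lt (p := p) 0 f.1 hi
    rw [zero_add] at this
    rw [this, cf_zero_left]
    exact pos_iff.2 hp.out.ne_zero
  · obtain ⟨k, rfl⟩ := exists_add_of_le hi
    have := cf_add_mul_ex (p := p) f.1 (ex_pos (len p * n)) k
    rw [zero_add] at this
    rw [this]
    exact f.2 k⟩

theorem co_shift_of_lt {n i : Len M} (f : Poly p) (h : i < n) : (shift n f).co i = 0 := by
  have := cf_add_mul_ex_of_lt (p := p) 0 f.1 h
  rw [zero_add] at this
  rw [co, shift, this, cf_zero_left, map_zero]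

@[simp] theorem co_shift_add (n i : Len M) (f : Poly p) : (shift n f).co (n + i) = f.co i := by
  have := cf_add_mul_ex (p := p) f.1 (ex_pos (len p * n)) i
  rw [zero_add] at this
  rw [co, shift, this, co]

/-! The operations are given by the PV-symbols. -/

theorem exists_tabulate {c : Sym 4} {f g : M} {n : Len M} {a : Len M → Fp p}
    (hc : ∀ y, ev c ![y, p, f, g] = rep (a (len y))) :
    ∃ h : Poly p, (∀ u, len u = n → ev c.tabulate ![u, p, f, g] = h.1) ∧
      (∀ i < n, h.co i = a i) ∧ ∀ i, n ≤ i → h.co i = 0 := by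
  have hc' : ∀ y y' : M, sz y = sz y' → ev c ![y, p, f, g] = ev c ![y', p, f, g] :=
    fun y y' h => by rw [hc, hc, len_eq_iff.2 h]
  have hlt : ∀ y, ev c ![y, p, f, g] < p := fun y => hc y ▸ rep_lt _
  refine ⟨⟨ev c.tabulate ![ones n, p, f, g], fun i => ?_⟩, fun u hu => ?_, fun i hi => ?_,
    fun i hi => ?_⟩
  · rw [cf_tabulate hc' hlt]
    split_ifs
    · exact hlt _
    · exact pos_iff.2 hp.out.ne_zero
  · exact ev_tabulate_congr hc' (by rw [sz_ones, ← hu, coe_len])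
  · change cls p (cf p _ i) = _
    rw [cf_tabulate hc' hlt, if_pos hi, hc, cls_rep, len_ones]
  · change cls p (cf p _ i) = _
    rw [cf_tabulate hc' hlt, if_neg hi.not_gt, map_zero]

theorem co_eq_zero {f : Poly p} {i : Len M} (h : len f.1 ≤ i) : f.co i = 0 := by
  rw [co, cf_eq_zero p hp.out.ne_zero h, map_zero]

/-- Only |f| + |g| coefficients are tabulated; `ha` says that nothing is lost. -/
theorem exists_assemble {c : Sym 4} {f g : Poly p} {a : Len M → Fp p}
    (hc : ∀ y, ev c ![y, p, f.1, g.1] = rep (a (len y)))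
    (ha : ∀ i, len f.1 + len g.1 ≤ i → a i = 0) :
    ∃ h : Poly p, ev c.assemble ![p, f.1, g.1] = h.1 ∧ ∀ i, h.co i = a i := by
  obtain ⟨h, h1, h2, h3⟩ := exists_tabulate (n := len f.1 + len g.1) hc
  refine ⟨h, ?_, fun i => ?_⟩
  -- Half of 2^|f|·2^|g| has exactly |f| + |g| digits, which is the required length of the counter.
  · rw [← h1 (hf (sm f.1 1 * sm g.1 1))]
    · simp [Sym.assemble]
    · apply Subtype.ext
      have : sm f.1 1 * sm g.1 1 = ex (len f.1 + len g.1) := by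
        rw [sm_comm, sm_comm g.1, ex_add, ex_len, ex_len]
      rw [coe_len, sz_hf_eq_sub, this, ← sm_one_ones, sz_sm, sz_one, one_mul, sz_ones,
        add_tsub_cancel_right]
  · rcases lt_or_ge i (len f.1 + len g.1) with hi | hi
    · exact h2 i hi
    · rw [h3 i hi, ha i hi]

theorem exists_add (f g : Poly p) :
    ∃ h : Poly p, ev .polyAdd ![p, f.1, g.1] = h.1 ∧ ∀ i, h.co i = f.co i + g.co i := by
  refine exists_assemble (fun y => ?_) fun i hi => ?_
  · simp only [Sym.addCoef, ev_ap2, ev_add, ev_ap3, ev_proj]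
    change rm (ev .coef ![y, p, f.1] + ev .coef ![y, p, g.1]) p = _
    rw [coef_eq_cf, coef_eq_cf]
    simp only [Poly.co]
    rw [← map_add, rep_cls]
  · rw [co_eq_zero (le_self_add.trans hi), co_eq_zero (le_add_self.trans hi), add_zero]

end Poly

end

end PVModel
end PVArith

namespace PVArith
namespace PVModel

variable {M : Type*} [PVModel M]

theorem len_cases (i : Len M) : i = 0 ∨ ∃ k, i = k + 1 := by
  rcases eq_or_ne i 0 with h | h
  · exact .inl h
  · obtain ⟨k, rfl⟩ := exists_add_of_le (len_one_le_iff.2 h)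
    exact .inr ⟨k, add_comm _ _⟩

namespace Poly

set_option linter.unusedSectionVars false

variable {p : M} [hp : Fact (IsPrime p)]

/-! ### The ring of polynomials -/

/-- The partial sum `∑ t < j, f_t * g_{|K| - t}`. -/
noncomputable def conv (f g : Poly p) (K : M) (j : Len M) : Fp p :=
  cls p (ev .convSum ![ones j, K, p, f.1, g.1])

@[fun_prop] theorem _root_.PVArith.Def.conv {Γ : Type*} [Coded M Γ] {f g : Γ → Poly p}
    {K : Γ → M} {j : Γ → Len M} (hf : Def M f) (hg : Def M g) (hK : Def M K) (hj : Def M j) :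
    Def M fun γ => conv (f γ) (g γ) (K γ) (j γ) := by
  unfold PVModel.Poly.conv
  fun_prop

/-- Every step reduces modulo `p`, so the bound `p` has no effect; the step sees the counter only
through its length, so the value depends only on `len I`. -/
theorem ev_convSum (f g : Poly p) (K I : M) :
    ev .convSum ![I, K, p, f.1, g.1] = rep (conv f g K (len I)) ∧
    conv f g K 0 = 0 ∧
    ∀ j, conv f g K (j + 1) = conv f g K j + f.co j * g.co (len K - j) := by
  have hshr (y : M) : len (shr y K) = len K - len y := by
    apply Subtype.ext
    rw [shr_eq_dx, coe_len, sz_dx]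
    rfl
  let step : Sym 6 := .ap2 .rem (.proj 1 + .ap3 .coef (.proj 0) (.proj 3) (.proj 4) *
      .ap3 .coef (.ap2 .shift (.proj 0) (.proj 2)) (.proj 3) (.proj 5)) (.proj 3)
  have hstep (y v : M) : ev step (Fin.cons y (Fin.cons v ![K, p, f.1, g.1])) =
      rm (v + cf p f.1 (len y) * cf p g.1 (len K - len y)) p := by
    simp only [step, cons_eq_vecCons, ev_ap2, ev_add, ev_mul, ev_ap3, ev_proj]
    change rm (v + ev .coef ![y, p, f.1] * ev .coef ![shr y K, p, g.1]) p = _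
    rw [coef_eq_cf, coef_eq_cf, hshr]
  have hb (y : M) : ev (.proj 2 : Sym 5) (Fin.cons y ![K, p, f.1, g.1]) = p := ev_proj _ _
  have h0 : ev .convSum ![0, K, p, f.1, g.1] = 0 :=
    (ev_lrn_zero ![K, p, f.1, g.1] _ _ _ _).trans (by simp)
  have hlrn : Sym.convSum = .lrn 0 step step (.proj 2) := rfl
  have hh (y y' v : M) (h : sz y = sz y') : ev step (Fin.cons y (Fin.cons v ![K, p, f.1, g.1])) =
      ev step (Fin.cons y' (Fin.cons v ![K, p, f.1, g.1])) := by
    rw [hstep, hstep, len_eq_iff.2 h]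
  have hb' (y y' : M) (_ : sz y = sz y') : ev (.proj 2 : Sym 5) (Fin.cons y ![K, p, f.1, g.1]) =
      ev (.proj 2 : Sym 5) (Fin.cons y' ![K, p, f.1, g.1]) := by
    rw [hb, hb]
  have hs (j : Len M) : ev .convSum ![ones (j + 1), K, p, f.1, g.1] =
      rm (ev .convSum ![ones j, K, p, f.1, g.1] + cf p f.1 j * cf p g.1 (len K - j)) p := by
    rw [hlrn]
    refine (ev_lrn_succ (c := ![K, p, f.1, g.1]) (J := ones j) hh hb' (by simp)).trans ?_
    rw [hstep, hb, len_ones, min_eq_left (rm_lt _ hp.out.ne_zero).le]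
    rfl
  have hlt (j : Len M) : ev .convSum ![ones j, K, p, f.1, g.1] < p := by
    rcases len_cases j with rfl | ⟨k, rfl⟩
    · rw [ones_zero, h0]
      exact pos_iff.2 hp.out.ne_zero
    · rw [hs]
      exact rm_lt _ hp.out.ne_zero
  refine ⟨?_, ?_, fun j => ?_⟩
  · rw [conv, rep_cls, rm_of_lt (hlt _), hlrn]
    exact lrn_congr (c := ![K, p, f.1, g.1]) hh hb' (by simp)
  · rw [conv, ones_zero, h0, map_zero]
  · rw [conv, hs, cls_rm, map_add, map_mul]
    rfl

theorem conv_zero (f g : Poly p) (K : M) : conv f g K 0 = 0 := (ev_convSum f g K 0).2.1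

theorem conv_succ (f g : Poly p) (K : M) (j : Len M) :
    conv f g K (j + 1) = conv f g K j + f.co j * g.co (len K - j) := (ev_convSum f g K 0).2.2 j

theorem conv_congr (f g : Poly p) {K L : M} (h : len K = len L) (j : Len M) :
    conv f g K j = conv f g L j := by
  refine len_induction (P := fun j => conv f g K j = conv f g L j) (by fun_prop) ?_
    (fun j hj => ?_) j
  · rw [conv_zero, conv_zero]
  · rw [conv_succ, conv_succ, hj, h]

theorem exists_mul (f g : Poly p) :
    ∃ h : Poly p, ev .polyMul ![p, f.1, g.1] = h.1 ∧
      ∀ i, h.co i = conv f g (ones i) (i + 1) := by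
  refine exists_assemble (fun y => ?_) fun i hi => ?_
  · simp only [Sym.mulCoef, ev_ap5, ev_add, ev_ap1, ev_proj]
    change ev .convSum ![ev .succ ![y + y], y, p, f.1, g.1] = _
    rw [(ev_convSum f g _ _).1, conv_congr f g (L := ones (len y)) (len_ones _).symm, ev_succ]
    congr 2
    exact Subtype.ext (by simp [sz_odd])
  · refine len_induction (P := fun j => conv f g (ones i) j = 0) (by fun_prop) (conv_zero _ _ _)
      (fun j hj => ?_) (i + 1)
    rw [conv_succ, hj, zero_add, len_ones]
    rcases le_or_gt (len f.1) j with h | h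
    · rw [co_eq_zero h, zero_mul]
    · rw [co_eq_zero (f := g), mul_zero]
      obtain ⟨k, hk⟩ := exists_add_of_le h.le
      rw [hk, add_assoc] at hi
      refine le_trans ?_ (tsub_le_tsub_right hi j)
      rw [add_tsub_cancel_left]
      exact le_add_self

/-- The sum of two polynomials. -/
@[irreducible] protected noncomputable def add (f g : Poly p) : Poly p :=
  ⟨ev .polyAdd ![p, f.1, g.1], (exists_add f g).choose_spec.1 ▸ (exists_add f g).choose.2⟩

/-- The product of two polynomials. -/
@[irreducible] protected noncomputable def mul (f g : Poly p) : Poly p :=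
  ⟨ev .polyMul ![p, f.1, g.1], (exists_mul f g).choose_spec.1 ▸ (exists_mul f g).choose.2⟩

noncomputable instance : Add (Poly p) := ⟨Poly.add⟩

noncomputable instance : Mul (Poly p) := ⟨Poly.mul⟩

theorem val_add (f g : Poly p) : (f + g).1 = ev .polyAdd ![p, f.1, g.1] := by
  change (Poly.add f g).1 = _
  rw [Poly.add]

theorem val_mul (f g : Poly p) : (f * g).1 = ev .polyMul ![p, f.1, g.1] := by
  change (Poly.mul f g).1 = _
  rw [Poly.mul]

@[simp] theorem co_add (f g : Poly p) (i : Len M) : (f + g).co i = f.co i + g.co i := by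
  obtain ⟨h, h1, h2⟩ := exists_add f g
  rw [← h2, show f + g = h from val_inj.1 ((val_add f g).trans h1)]

theorem co_mul (f g : Poly p) (i : Len M) : (f * g).co i = conv f g (ones i) (i + 1) := by
  obtain ⟨h, h1, h2⟩ := exists_mul f g
  rw [← h2, show f * g = h from val_inj.1 ((val_mul f g).trans h1)]

section

variable {Γ : Type*} [Coded M Γ]

@[fun_prop] theorem _root_.PVArith.Def.Poly_add {f g : Γ → Poly p} (hf : Def M f)
    (hg : Def M g) : Def M fun γ => f γ + g γ := by
  simp only [def_iff, val_add]
  fun_prop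

@[fun_prop] theorem _root_.PVArith.Def.Poly_mul {f g : Γ → Poly p} (hf : Def M f)
    (hg : Def M g) : Def M fun γ => f γ * g γ := by
  simp only [def_iff, val_mul]
  fun_prop

@[fun_prop] theorem _root_.PVArith.Def.C {f : Γ → Fp p} (hf : Def M f) :
    Def M fun γ => C (f γ) := hf

@[fun_prop] theorem _root_.PVArith.Def.shift {n : Γ → Len M} {f : Γ → Poly p} (hn : Def M n)
    (hf : Def M f) : Def M fun γ => shift (n γ) (f γ) := by
  have : Def M fun γ => (f γ).1 * ex (PVModel.len p * n γ) := by fun_prop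
  exact this

end

@[simp] theorem co_mul_zero (f g : Poly p) : (f * g).co 0 = f.co 0 * g.co 0 := by
  rw [co_mul, conv_succ, conv_zero, zero_add, len_ones, zero_tsub]

/-- Splitting off the term with index 0 leaves a partial sum for `f.drop 1`; this reduces products
to induction on polynomials. -/
theorem conv_drop (f g : Poly p) (k j : Len M) :
    conv f g (ones (k + 1)) (j + 1) = f.co 0 * g.co (k + 1) + conv (f.drop 1) g (ones k) j := by
  refine len_induction (P := fun j => conv f g (ones (k + 1)) (j + 1) =
    f.co 0 * g.co (k + 1) + conv (f.drop 1) g (ones k) j) (by fun_prop) ?_ (fun j hj => ?_) j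
  · rw [conv_succ, conv_zero, conv_zero, zero_add, len_ones, tsub_zero, add_zero]
  · rw [conv_succ, hj, conv_succ, len_ones, len_ones, co_drop, add_tsub_add_eq_tsub_right,
      add_comm 1 j, add_assoc]

theorem co_mul_succ (f g : Poly p) (k : Len M) :
    (f * g).co (k + 1) = f.co 0 * g.co (k + 1) + (f.drop 1 * g).co k := by
  rw [co_mul, conv_drop, co_mul]

theorem zero_mul' (g : Poly p) : 0 * g = 0 := by
  refine ext fun i => ?_
  rw [co_mul, co_zero]
  refine len_induction (P := fun j => conv 0 g (ones i) j = 0) (by fun_prop) (conv_zero _ _ _)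
    (fun j hj => ?_) _
  rw [conv_succ, hj, co_zero, zero_mul, add_zero]

theorem add_mul' (f f' g : Poly p) : (f + f') * g = f * g + f' * g := by
  refine ext fun i => ?_
  simp only [co_mul, co_add]
  refine len_induction (P := fun j => conv (f + f') g (ones i) j =
    conv f g (ones i) j + conv f' g (ones i) j) (by fun_prop) (by simp [conv_zero])
    (fun j hj => ?_) _
  simp only [conv_succ, hj, co_add]
  ring

theorem mul_add' (f g g' : Poly p) : f * (g + g') = f * g + f * g' := by
  refine ext fun i => ?_
  simp only [co_mul, co_add]
  refine len_induction (P := fun j => conv f (g + g') (ones i) j =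
    conv f g (ones i) j + conv f g' (ones i) j) (by fun_prop) (by simp [conv_zero])
    (fun j hj => ?_) _
  simp only [conv_succ, hj, co_add]
  ring

@[simp] theorem drop_C (c : Fp p) : (C c).drop 1 = 0 := ext fun i => by
  rw [co_drop, add_comm, co_C_succ, co_zero]

@[simp] theorem co_C_mul (c : Fp p) (f : Poly p) (i : Len M) : (C c * f).co i = c * f.co i := by
  rcases len_cases i with rfl | ⟨k, rfl⟩
  · simp
  · simp [co_mul_succ, zero_mul']

theorem C_mul_mul (c : Fp p) (f g : Poly p) : (C c * f) * g = C c * (f * g) := by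
  refine ext fun i => ?_
  rw [co_C_mul, co_mul, co_mul]
  refine len_induction (P := fun j => conv (C c * f) g (ones i) j = c * conv f g (ones i) j)
    (by fun_prop) (by simp [conv_zero]) (fun j hj => ?_) _
  simp only [conv_succ, hj, co_C_mul]
  ring

@[simp] theorem co_shift_one_zero (f : Poly p) : (shift 1 f).co 0 = 0 :=
  co_shift_of_lt f zero_lt_one

@[simp] theorem co_shift_one_succ (f : Poly p) (k : Len M) : (shift 1 f).co (k + 1) = f.co k := by
  rw [add_comm, co_shift_add]

@[simp] theorem drop_shift_one (f : Poly p) : (shift 1 f).drop 1 = f := ext fun i => by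
  rw [co_drop, co_shift_add]

theorem eq_C_add_shift (f : Poly p) : f = C (f.co 0) + shift 1 (f.drop 1) := by
  refine ext fun i => ?_
  rcases len_cases i with rfl | ⟨k, rfl⟩ <;> simp [add_comm]

theorem shift_one_mul (f g : Poly p) : shift 1 f * g = shift 1 (f * g) := by
  refine ext fun i => ?_
  rcases len_cases i with rfl | ⟨k, rfl⟩ <;> simp [co_mul_succ]

theorem mul_shift_one (f g : Poly p) : f * shift 1 g = shift 1 (f * g) := by
  refine ext fun i => ?_
  rcases len_cases i with rfl | ⟨k, rfl⟩
  · simp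
  · rw [co_shift_one_succ, co_mul, co_mul, conv_succ, len_ones, tsub_self, co_shift_one_zero,
      mul_zero, add_zero]
    refine (len_induction (P := fun j => ¬ j ≤ k + 1 ∨ conv f (shift 1 g) (ones (k + 1)) j =
      conv f g (ones k) j) (by fun_prop) (.inr (by simp [conv_zero])) (fun j hj => ?_) _
      ).resolve_left (not_not.2 le_rfl)
    by_cases h : j ≤ k
    · right
      rw [conv_succ, conv_succ, hj.resolve_left (not_not.2 (h.trans le_self_add)), len_ones,
        len_ones]
      obtain ⟨l, rfl⟩ := exists_add_of_le h
      rw [add_assoc, add_tsub_cancel_left, add_tsub_cancel_left, co_shift_one_succ]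
    · exact .inl fun h' => h (by simpa using h')

theorem mul_C (f : Poly p) (c : Fp p) : f * C c = C c * f := by
  refine ext fun i => ?_
  rw [co_C_mul, co_mul, conv_succ, len_ones, tsub_self, co_C_zero]
  rw [(len_induction (P := fun j => ¬ j ≤ i ∨ conv f (C c) (ones i) j = 0) (by fun_prop)
    (.inr (conv_zero _ _ _)) (fun j hj => ?_) i).resolve_left (not_not.2 le_rfl)]
  · ring
  · by_cases h : j + 1 ≤ i
    · right
      rw [conv_succ, hj.resolve_left (not_not.2 (le_self_add.trans h)), len_ones]
      obtain ⟨l, rfl⟩ := exists_add_of_le h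
      rw [add_assoc, add_tsub_cancel_left, add_comm 1, co_C_succ]
      ring
    · exact .inl h

/-- By induction on f = f_0 + X·f': constants commute with everything, and X can be moved out of
either factor. -/
theorem mul_comm' (f g : Poly p) : f * g = g * f := by
  refine induction (P := fun f => f * g = g * f) (by fun_prop) ?_ (fun f hf => ?_) f
  · refine ext fun i => ?_
    rw [zero_mul', show (0 : Poly p) = C 0 from ext fun i => ?_, mul_C, co_C_mul, zero_mul]
    · rcases len_cases i with rfl | ⟨k, rfl⟩ <;> simp
    · rcases len_cases i with rfl | ⟨k, rfl⟩ <;> simp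
  · rw [eq_C_add_shift f, add_mul', mul_add', mul_C, shift_one_mul, mul_shift_one, hf]

theorem mul_assoc' (f g h : Poly p) : f * g * h = f * (g * h) := by
  refine induction (P := fun f => f * g * h = f * (g * h)) (by fun_prop) ?_ (fun f hf => ?_) f
  · simp only [zero_mul']
  · rw [eq_C_add_shift f, add_mul', add_mul', add_mul', C_mul_mul, shift_one_mul, shift_one_mul,
      shift_one_mul, hf]

noncomputable instance : One (Poly p) := ⟨C 1⟩

theorem one_def : (1 : Poly p) = C 1 := rfl

/-- The negative of a polynomial. -/
@[irreducible] protected noncomputable def neg (f : Poly p) : Poly p := C (-1) * f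

noncomputable instance : Neg (Poly p) := ⟨Poly.neg⟩

theorem neg_def (f : Poly p) : -f = C (-1) * f := by
  change Poly.neg f = _
  rw [Poly.neg]

/-- The difference of two polynomials. -/
@[irreducible] protected noncomputable def sub (f g : Poly p) : Poly p := f + -g

noncomputable instance : Sub (Poly p) := ⟨Poly.sub⟩

theorem sub_def (f g : Poly p) : f - g = f + -g := by
  change Poly.sub f g = _
  rw [Poly.sub]

theorem one_mul' (f : Poly p) : 1 * f = f := ext fun i => by rw [one_def, co_C_mul, one_mul]

noncomputable instance : CommRing (Poly p) where
  add_assoc f g h := ext fun i => by simp [add_assoc]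
  zero_add f := ext fun i => by simp
  add_zero f := ext fun i => by simp
  add_comm f g := ext fun i => by simp [add_comm]
  nsmul := nsmulRec
  sub_eq_add_neg := sub_def
  zsmul := zsmulRec
  neg_add_cancel f := ext fun i => by simp [neg_def]
  mul_assoc := mul_assoc'
  mul_comm := mul_comm'
  one_mul := one_mul'
  mul_one f := (mul_comm' _ _).trans (one_mul' f)
  zero_mul := zero_mul'
  mul_zero f := (mul_comm' _ _).trans (zero_mul' f)
  left_distrib := mul_add'
  right_distrib := add_mul'

@[simp] theorem co_neg (f : Poly p) (i : Len M) : (-f).co i = -f.co i := by simp [neg_def]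

@[simp] theorem co_sub (f g : Poly p) (i : Len M) : (f - g).co i = f.co i - g.co i := by
  simp [sub_eq_add_neg]

section

variable {Γ : Type*} [Coded M Γ]

@[fun_prop] theorem _root_.PVArith.Def.Poly_neg {f : Γ → Poly p} (hf : Def M f) :
    Def M fun γ => -f γ := by
  simp only [neg_def]
  fun_prop

@[fun_prop] theorem _root_.PVArith.Def.Poly_sub {f g : Γ → Poly p} (hf : Def M f)
    (hg : Def M g) : Def M fun γ => f γ - g γ := by
  simp only [sub_eq_add_neg]
  fun_prop

end

end Poly

end PVModel
end PVArith

namespace PVArith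
namespace PVModel

variable {M : Type*} [PVModel M]

/-- Recursion on notation in terms of a coded type `A`. -/
theorem exists_lrn_recursion {A : Type*} [Coded M A] {enc : A → M} {dec : M → A}
    (henc : Def M enc) (hdec : Def M dec) (hde : ∀ a, dec (enc a) = a)
    {n : ℕ} {g : Sym n} {h : Sym (n + 2)} {b : Sym (n + 1)}
    {c : Fin n → M} {a₀ : A} {H : Len M → A → A} {P : Len M → A → Prop}
    {B : Len M → M} (hP : Def M fun x : Len M × A => P x.1 x.2) (hg : ev g c = enc a₀)
    (hc : ∀ y y' v, sz y = sz y' →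
      ev h (Fin.cons y (Fin.cons v c)) = ev h (Fin.cons y' (Fin.cons v c)))
    (hh : ∀ y a, P (len y) a → ev h (Fin.cons y (Fin.cons (enc a) c)) = enc (H (len y) a))
    (hb : ∀ y, ev b (Fin.cons y c) = B (len y)) (h0 : P 0 a₀)
    (hs : ∀ j a, P j a → P (j + 1) (H j a)) (hB : ∀ j a, P j a → enc a ≤ B j) :
    ∃ T : Len M → A, Def M T ∧
      (∀ u, ev (.lrn g h h b) (Fin.cons u c) = enc (T (len u))) ∧ T 0 = a₀ ∧
      (∀ j, T (j + 1) = H j (T j)) ∧ ∀ j, P j (T j) := by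
  have hb' : ∀ y y' : M, sz y = sz y' → ev b (Fin.cons y c) = ev b (Fin.cons y' c) :=
    fun y y' h => by rw [hb, hb, len_eq_iff.2 h]
  let A (j : Len M) : M := ev (.lrn g h h b) (Fin.cons (ones j) c)
  have hA : Def M A := .app_cons _ (by fun_prop) fun i => .const _
  have hA0 : A 0 = enc a₀ := by
    simp only [A, ones_zero]
    rw [ev_lrn_zero, hg, hb, show len (0 : M) = 0 from Subtype.ext sz_zero,
      min_eq_left (hB _ _ h0)]
  have hAs (j : Len M) (a) (ha : A j = enc a) (hPa : P j a) : A (j + 1) = enc (H j a) := by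
    simp only [A] at ha ⊢
    rw [ev_lrn_succ (J := ones j) hc hb' (by simp), ha, hh _ _ (by rwa [len_ones]), hb, len_ones,
      len_ones, min_eq_left (hB _ _ (hs _ _ hPa))]
  -- The symbol always computes the code of the iterate: the invariant `P` keeps the codes within
  -- the bound `B`, and so the minimum in the recursion is harmless.
  have key : ∀ j, enc (dec (A j)) = A j ∧ P j (dec (A j)) := by
    have h1 : Def M fun j => dec (A j) := hdec.comp hA
    have h2 : Def M fun j => enc (dec (A j)) := henc.comp h1
    have h3 : Def M fun j => P j (dec (A j)) := hP.comp (g := fun j => (j, dec (A j))) (by fun_prop)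
    refine len_induction (by fun_prop) ?_ fun j hj => ?_
    · rw [hA0, hde]
      exact ⟨rfl, h0⟩
    · rw [hAs j _ hj.1.symm hj.2, hde]
      exact ⟨rfl, hs _ _ hj.2⟩
  refine ⟨fun j => dec (A j), hdec.comp hA, fun u => ?_, ?_, fun j => ?_, fun j => (key j).2⟩
  · rw [(key _).1]
    exact lrn_congr hc hb' (by simp)
  · simp only [hA0, hde]
  · simp only [hAs j _ (key j).1.symm (key j).2, hde]

namespace Poly

set_option linter.unusedSectionVars false

variable {p : M} [hp : Fact (IsPrime p)]

/-! ### Powers of `X` -/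

@[simp] theorem shift_zero_left (f : Poly p) : shift 0 f = f := by
  apply val_inj.1
  change f.1 * ex (len p * 0) = f.1
  rw [mul_zero, ex_zero, mul_one]

theorem shift_shift (m n : Len M) (f : Poly p) : shift m (shift n f) = shift (m + n) f := by
  apply val_inj.1
  change f.1 * ex (len p * n) * ex (len p * m) = f.1 * ex (len p * (m + n))
  rw [mul_assoc, ← ex_add, mul_add, add_comm]

theorem shift_mul (n : Len M) (f g : Poly p) : shift n f * g = shift n (f * g) := by
  refine len_induction (P := fun n => shift n f * g = shift n (f * g)) (by fun_prop) (by simp)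
    (fun n hn => ?_) n
  rw [add_comm, ← shift_shift, ← shift_shift, shift_one_mul, hn]

/-- The power `X ^ n`. -/
noncomputable def Xp (n : Len M) : Poly p := shift n 1

@[fun_prop] theorem _root_.PVArith.Def.Xp {Γ : Type*} [Coded M Γ] {n : Γ → Len M}
    (hn : Def M n) : Def M fun γ => Xp (p := p) (n γ) := .shift hn (.const _)

theorem shift_eq (n : Len M) (f : Poly p) : shift n f = Xp n * f := by
  rw [Xp, shift_mul, one_mul]

@[simp] theorem Xp_zero : (Xp 0 : Poly p) = 1 := shift_zero_left _

theorem Xp_add (m n : Len M) : (Xp (m + n) : Poly p) = Xp m * Xp n := by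
  rw [← shift_eq, Xp, Xp, shift_shift]

@[simp] theorem co_one_zero : (1 : Poly p).co 0 = 1 := co_C_zero 1

theorem co_Xp_zero {n : Len M} (hn : n ≠ 0) : (Xp n : Poly p).co 0 = 0 :=
  co_shift_of_lt _ (pos_iff_ne_zero.2 hn)

theorem co_Xp_self (n : Len M) : (Xp n : Poly p).co n = 1 := by
  have := co_shift_add n 0 (1 : Poly p)
  rwa [add_zero, co_one_zero] at this

theorem eq_C_add (f : Poly p) : f = C (f.co 0) + Xp 1 * f.drop 1 := by
  rw [← shift_eq]
  exact eq_C_add_shift f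

theorem C_add (a b : Fp p) : C (a + b) = C a + C b := ext fun i => by
  rcases len_cases i with rfl | ⟨k, rfl⟩ <;> simp

theorem C_mul (a b : Fp p) : C (a * b) = C a * C b := ext fun i => by
  rcases len_cases i with rfl | ⟨k, rfl⟩ <;> simp

@[simp] theorem C_zero : C (0 : Fp p) = 0 := ext fun i => by
  rcases len_cases i with rfl | ⟨k, rfl⟩ <;> simp

/-! ### Degrees -/

theorem drop_eq_zero_iff {f : Poly p} {n : Len M} :
    f.drop n = 0 ↔ ∀ i, n ≤ i → f.co i = 0 := by
  constructor
  · intro h i hi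
    obtain ⟨k, rfl⟩ := exists_add_of_le hi
    rw [← co_drop, h, co_zero]
  · exact fun h => ext fun i => by rw [co_drop, h _ le_self_add, co_zero]

theorem drop_eq_zero_iff_lt {f : Poly p} {n : Len M} :
    f.drop n = 0 ↔ f.1 < ex (len p * n) := by
  rw [← val_inj, ← dx_eq_zero_iff]
  rfl

theorem drop_eq_zero_mono {f : Poly p} {m n : Len M} (h : f.drop m = 0) (hmn : m ≤ n) :
    f.drop n = 0 :=
  drop_eq_zero_iff.2 fun i hi => drop_eq_zero_iff.1 h i (hmn.trans hi)

/-- The polynomial `f` has degree `d`. -/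
def HasDeg (f : Poly p) (d : Len M) : Prop := f.drop (d + 1) = 0 ∧ f.co d ≠ 0

@[fun_prop] theorem _root_.PVArith.Def.hasDeg {Γ : Type*} [Coded M Γ] {f : Γ → Poly p}
    {d : Γ → Len M} (hf : Def M f) (hd : Def M d) : Def M fun γ => HasDeg (f γ) (d γ) := by
  unfold HasDeg
  fun_prop

theorem exists_hasDeg {f : Poly p} (hf : f ≠ 0) : ∃ d, HasDeg f d := by
  obtain ⟨n, hn, hmin⟩ := exists_least (P := fun n => f.drop n = 0) (by fun_prop)
    ⟨len f.1, drop_eq_zero le_rfl⟩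
  rcases len_cases n with rfl | ⟨d, rfl⟩
  · exact absurd (by simpa using hn) hf
  · refine ⟨d, hn, fun h => hmin d (Order.lt_add_one_iff.2 le_rfl) ?_⟩
    refine drop_eq_zero_iff.2 fun i hi => ?_
    rcases hi.eq_or_lt with rfl | hi
    · exact h
    · exact drop_eq_zero_iff.1 hn i (Order.add_one_le_iff.2 hi)

theorem HasDeg.ne_zero {f : Poly p} {d : Len M} (h : HasDeg f d) : f ≠ 0 := by
  rintro rfl
  exact h.2 (co_zero d)

theorem HasDeg.unique {f : Poly p} {d e : Len M} (h : HasDeg f d) (h' : HasDeg f e) : d = e := by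
  by_contra hne
  rcases lt_or_gt_of_ne hne with hlt | hlt
  · exact h'.2 (drop_eq_zero_iff.1 h.1 _ (Order.add_one_le_iff.2 hlt))
  · exact h.2 (drop_eq_zero_iff.1 h'.1 _ (Order.add_one_le_iff.2 hlt))

theorem HasDeg.mul {f g : Poly p} {d e : Len M} (hf : HasDeg f d) (hg : HasDeg g e) :
    HasDeg (f * g) (d + e) := by
  constructor
  · refine drop_eq_zero_iff.2 fun i hi => ?_
    rw [co_mul]
    refine len_induction (P := fun j => conv f g (ones i) j = 0) (by fun_prop) (conv_zero _ _ _)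
      (fun j hj => ?_) _
    rw [conv_succ, hj, zero_add, len_ones]
    rcases lt_or_ge d j with h | h
    · rw [drop_eq_zero_iff.1 hf.1 j (Order.add_one_le_iff.2 h), zero_mul]
    · rw [drop_eq_zero_iff.1 hg.1 (i - j), mul_zero]
      obtain ⟨k, rfl⟩ := exists_add_of_le h
      obtain ⟨l, rfl⟩ := exists_add_of_le hi
      rw [show j + k + e + 1 + l = j + (e + 1 + (k + l)) by ring, add_tsub_cancel_left]
      exact le_self_add
  · rw [co_mul]
    -- The partial sums for index d + e are zero while j ≤ d and equal to f_d·g_e afterwards, since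
    -- all other terms contain a coefficient beyond the degree of its factor.
    have key := len_induction (P := fun j => (¬ j ≤ d ∨ conv f g (ones (d + e)) j = 0) ∧
      (j ≤ d ∨ conv f g (ones (d + e)) j = f.co d * g.co e)) (by fun_prop)
      ⟨.inr (conv_zero _ _ _), .inl zero_le⟩ (fun j hj => ?_) (d + e + 1)
    · rw [key.2.resolve_left (not_le.2 (Order.lt_add_one_iff.2 le_self_add))]
      exact mul_ne_zero hf.2 hg.2
    rw [conv_succ, len_ones]
    rcases lt_trichotomy j d with h | rfl | h
    · rw [hj.1.resolve_left (not_not.2 h.le), drop_eq_zero_iff.1 hg.1 (d + e - j)]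
      · exact ⟨.inr (by ring), .inl (Order.add_one_le_iff.2 h)⟩
      · obtain ⟨k, rfl⟩ := exists_add_of_le (Order.add_one_le_iff.2 h)
        rw [show j + 1 + k + e = j + (e + 1 + k) by ring, add_tsub_cancel_left]
        exact le_self_add
    · rw [hj.1.resolve_left (not_not.2 le_rfl), add_tsub_cancel_left]
      refine ⟨.inl ?_, .inr (zero_add _)⟩
      rw [not_le]
      exact Order.lt_add_one_iff.2 le_rfl
    · rw [hj.2.resolve_left (not_le.2 h),
        drop_eq_zero_iff.1 hf.1 j (Order.add_one_le_iff.2 h)]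
      refine ⟨.inl ?_, .inr (by ring)⟩
      rw [not_le]
      exact h.trans (Order.lt_add_one_iff.2 le_rfl)

instance : NoZeroDivisors (Poly p) where
  eq_zero_or_eq_zero_of_mul_eq_zero {f g} h := by
    by_contra! h'
    obtain ⟨d, hd⟩ := exists_hasDeg h'.1
    obtain ⟨e, he⟩ := exists_hasDeg h'.2
    exact (hd.mul he).ne_zero h

theorem ne_zero_of_co_zero {f : Poly p} (h : f.co 0 = 1) : f ≠ 0 := by
  rintro rfl
  exact zero_ne_one ((co_zero 0).symm.trans h)

/-! ### Polynomials defined by recursion on notation -/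

theorem isPoly_iff {f : M} : IsPoly p f ↔ ∀ i < len f, cf p f i < p := by
  refine ⟨fun h i _ => h i, fun h i => ?_⟩
  rcases lt_or_ge i (len f) with hi | hi
  · exact h i hi
  · rw [cf_eq_zero p hp.out.ne_zero hi]
    exact pos_iff.2 hp.out.ne_zero

@[fun_prop] theorem _root_.PVArith.Def.isPoly {Γ : Type*} [Coded M Γ] {f : Γ → M}
    (hf : Def M f) : Def M fun γ => IsPoly p (f γ) := by
  simp only [isPoly_iff]
  refine .ball (by fun_prop) ?_
  have : Def M fun x : Γ × Len M => f x.1 := hf.comp (.fst .id)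
  fun_prop

open Classical in
/-- The polynomial with the code `a`. -/
noncomputable def ofCode (a : M) : Poly p :=
  ⟨if IsPoly p a then a else 0, by
    split_ifs with h
    · exact h
    · exact (0 : Poly p).2⟩

@[simp] theorem ofCode_val (f : Poly p) : ofCode f.1 = f := val_inj.1 (if_pos f.2)

@[fun_prop] theorem _root_.PVArith.Def.ofCode {Γ : Type*} [Coded M Γ] {f : Γ → M}
    (hf : Def M f) : Def M fun γ => ofCode (p := p) (f γ) := by
  classical
  have : Def M fun γ => if IsPoly p (f γ) then f γ else 0 := by fun_prop
  exact this

theorem exists_poly_recursion {n : ℕ} {g : Sym n} {h : Sym (n + 2)} {b : Sym (n + 1)}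
    {c : Fin n → M} {F₀ : Poly p} {H : Len M → Poly p → Poly p} {P : Len M → Poly p → Prop}
    {B : Len M → M} (hP : Def M fun x : Len M × Poly p => P x.1 x.2) (hg : ev g c = F₀.1)
    (hc : ∀ y y' v, sz y = sz y' →
      ev h (Fin.cons y (Fin.cons v c)) = ev h (Fin.cons y' (Fin.cons v c)))
    (hh : ∀ y F, P (len y) F → ev h (Fin.cons y (Fin.cons F.1 c)) = (H (len y) F).1)
    (hb : ∀ y, ev b (Fin.cons y c) = B (len y)) (h0 : P 0 F₀)
    (hs : ∀ j F, P j F → P (j + 1) (H j F)) (hB : ∀ j F, P j F → F.1 ≤ B j) :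
    ∃ T : Len M → Poly p, Def M T ∧
      (∀ u, ev (.lrn g h h b) (Fin.cons u c) = (T (len u)).1) ∧ T 0 = F₀ ∧
      (∀ j, T (j + 1) = H j (T j)) ∧ ∀ j, P j (T j) :=
  exists_lrn_recursion (enc := Poly.val) (dec := ofCode) (by fun_prop) (by fun_prop) ofCode_val hP hg hc
    hh hb h0 hs hB

/-! ### The substitution of `X ^ s` -/

/-- `∑ j < |I|, f_j * X ^ (|S| * j)`; the arguments are `(I, p, f, S)`. -/
def _root_.PVArith.Sym.substUpTo : Sym 4 :=
  let pow (n : ℕ) (y p S : Sym n) : Sym n := .ap2 .smash (.ap1 .half (.ap2 .smash p S)) y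
  let step : Sym 5 := .ap3 .polyAdd (.proj 2) (.proj 1)
    (.ap3 .coef (.proj 0) (.proj 2) (.proj 3) * pow 5 (.proj 0) (.proj 2) (.proj 4))
  .lrn 0 step step (pow 4 (.proj 0) (.proj 1) (.proj 3))

/-- The polynomial `f (X ^ s)`. -/
noncomputable def subst (s : Len M) (f : Poly p) : Poly p :=
  ofCode (ev .substUpTo ![f.1, p, f.1, ones s])

@[fun_prop] theorem _root_.PVArith.Def.subst {Γ : Type*} [Coded M Γ] {s : Γ → Len M}
    {f : Γ → Poly p} (hs : Def M s) (hf : Def M f) : Def M fun γ => subst (s γ) (f γ) := by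
  unfold PVModel.Poly.subst
  fun_prop

end Poly

end PVModel
end PVArith

/-! ### Algebraic laws of the substitution of X^s -/

namespace PVArith
namespace PVModel

variable {M : Type*} [PVModel M]

namespace Poly

set_option linter.unusedSectionVars false

variable {p : M} [hp : Fact (IsPrime p)]

theorem drop_add (f g : Poly p) (i : Len M) : (f + g).drop i = f.drop i + g.drop i :=
  ext fun j => by simp

/-- For s ≠ 0 the positions s·j are distinct, so `T j` only has coefficients below s·j and respects
the bound of the recursion. The values become stationary once `f` is exhausted, so the exact number
of steps does not matter. -/
theorem exists_subst {s : Len M} (hs : s ≠ 0) (f : Poly p) :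
    ∃ T : Len M → Poly p, Def M T ∧ T 0 = 0 ∧
      (∀ j, T (j + 1) = T j + Xp (s * j) * C (f.co j)) ∧ (∀ j, (T j).drop (s * j) = 0) ∧
      (∀ S, len S = s → ev .substUpTo ![f.1, p, f.1, S] = (subst s f).1) ∧
      ∀ j, f.drop j = 0 → T j = subst s f := by
  have hpow (S y : M) : sm (hf (sm p S)) y = ex (len p * (len S * len y)) := by
    rw [sm_eq_ex, ← mul_assoc]
    congr 2
    exact Subtype.ext (by simp [sz_hf_eq_sub, sz_sm])
  have key (S : M) (hS : len S = s) : ∃ T : Len M → Poly p, Def M T ∧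
      (∀ u, ev .substUpTo ![u, p, f.1, S] = (T (len u)).1) ∧ T 0 = 0 ∧
      (∀ j, T (j + 1) = T j + Xp (s * j) * C (f.co j)) ∧ ∀ j, (T j).drop (s * j) = 0 := by
    have hco (y : M) : ev .coef ![y, p, f.1] * sm (hf (sm p S)) y =
        (Xp (s * len y) * C (f.co (len y))).1 := by
      rw [coef_eq_cf, hpow, hS, ← shift_eq, ← rep_co]
      rfl
    have hd (j : Len M) (F : Poly p) (hF : F.drop (s * j) = 0) :
        (F + Xp (s * j) * C (f.co j)).drop (s * (j + 1)) = 0 := by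
      refine drop_eq_zero_iff.2 fun i hi => ?_
      obtain ⟨k, rfl⟩ := exists_add_of_le hi
      obtain ⟨l, rfl⟩ := (len_cases s).resolve_left hs
      rw [co_add, drop_eq_zero_iff.1 hF, zero_add, ← shift_eq,
        show (l + 1) * (j + 1) + k = (l + 1) * j + (l + k + 1) by ring, co_shift_add, co_C_succ]
      exact (mul_le_mul_right le_self_add _).trans le_self_add
    refine exists_poly_recursion (p := p) (g := 0)
      (h := .ap3 .polyAdd (.proj 2) (.proj 1) (.ap3 .coef (.proj 0) (.proj 2) (.proj 3) *
        .ap2 .smash (.ap1 .half (.ap2 .smash (.proj 2) (.proj 4))) (.proj 0)))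
      (b := .ap2 .smash (.ap1 .half (.ap2 .smash (.proj 1) (.proj 3))) (.proj 0))
      (c := ![p, f.1, S]) (F₀ := 0) (H := fun j F => F + Xp (s * j) * C (f.co j))
      (P := fun j F => F.drop (s * j) = 0) (B := fun j => ex (len p * (s * j))) (by fun_prop)
      (ev_zero _) (fun y y' v h => ?_) (fun y F _ => ?_) (fun y => ?_) ?_ hd
      fun j F hF => (drop_eq_zero_iff_lt.1 hF).le
    · simp only [cons_eq_vecCons, ev_ap3, ev_mul, ev_ap2, ev_ap1, ev_proj]
      change ev .polyAdd ![p, v, ev .coef ![y, p, f.1] * sm (hf (sm p S)) y] =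
        ev .polyAdd ![p, v, ev .coef ![y', p, f.1] * sm (hf (sm p S)) y']
      rw [hco, hco, len_eq_iff.2 h]
    · simp only [cons_eq_vecCons, ev_ap3, ev_mul, ev_ap2, ev_ap1, ev_proj]
      change ev .polyAdd ![p, F.1, ev .coef ![y, p, f.1] * sm (hf (sm p S)) y] = _
      rw [hco, val_add]
    · simp only [cons_eq_vecCons, ev_ap2, ev_ap1, ev_proj]
      change sm (hf (sm p S)) y = _
      rw [hpow, hS]
    · rw [mul_zero, drop_zero]
  obtain ⟨T, hT, hTu, hT0, hTs, hTd⟩ := key (ones s) (by simp)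
  have hstab (i : Len M) (hi : f.drop i = 0) (k : Len M) : T (i + k) = T i := by
    refine len_induction (P := fun k => T (i + k) = T i) (by fun_prop) (by simp) (fun k hk => ?_) k
    rw [← add_assoc, hTs, hk, drop_eq_zero_iff.1 hi _ le_self_add, C_zero, mul_zero, add_zero]
  have hsub : T (len f.1) = subst s f := by rw [subst, hTu, ofCode_val]
  refine ⟨T, hT, hT0, hTs, hTd, fun S hS => ?_, fun j hj => ?_⟩
  · obtain ⟨T', hT', hTu', hT0', hTs', -⟩ := key S hS
    rw [← hsub, hTu', len_induction (P := fun j => T' j = T j) (by fun_prop) (by rw [hT0, hT0'])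
      (fun j hj => by rw [hTs, hTs', hj])]
  · rcases le_total j (len f.1) with h | h
    · obtain ⟨k, hk⟩ := exists_add_of_le h
      rw [← hsub, hk, hstab j hj]
    · obtain ⟨k, rfl⟩ := exists_add_of_le h
      rw [← hsub, hstab _ (drop_eq_zero le_rfl)]


section

variable {s : Len M} (hs : s ≠ 0)

include hs

/-- The computations for `f` and `f.drop 1` run in parallel, shifted by one step. The homomorphism
laws follow from this Horner rule by induction on polynomials. -/
theorem subst_eq (f : Poly p) : subst s f = C (f.co 0) + Xp s * subst s (f.drop 1) := by
  obtain ⟨T, hT, hT0, hTs, -, -, hTf⟩ := exists_subst hs f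
  obtain ⟨T', hT', hT0', hTs', -, -, hTf'⟩ := exists_subst hs (f.drop 1)
  rw [← hTf (len f.1 + 1) (drop_eq_zero le_self_add),
    ← hTf' (len f.1) (by rw [drop_drop]; exact drop_eq_zero le_add_self)]
  refine len_induction (P := fun j => T (j + 1) = C (f.co 0) + Xp s * T' j) (by fun_prop) ?_
    (fun j hj => ?_) _
  · rw [hTs, hT0, hT0', mul_zero, Xp_zero]
    ring
  · rw [hTs, hj, hTs', co_drop, mul_add s, mul_one, Xp_add, add_comm 1 j]
    ring

theorem subst_zero : subst s (0 : Poly p) = 0 := by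
  obtain ⟨T, hT, hT0, -, -, -, hTf⟩ := exists_subst hs (0 : Poly p)
  rw [← hTf 0 (drop_zero _), hT0]

theorem subst_C (c : Fp p) : subst s (C c) = C c := by
  rw [subst_eq hs, drop_C, subst_zero hs, mul_zero, add_zero, co_C_zero]

theorem co_subst_zero (f : Poly p) : (subst s f).co 0 = f.co 0 := by
  rw [subst_eq hs, co_add, co_C_zero, co_mul_zero, co_Xp_zero hs, zero_mul, add_zero]

theorem subst_add (f g : Poly p) : subst s (f + g) = subst s f + subst s g := by
  obtain ⟨L, hf, hg⟩ : ∃ L : Len M, f.drop L = 0 ∧ g.drop L = 0 :=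
    ⟨len f.1 + len g.1, drop_eq_zero le_self_add, drop_eq_zero le_add_self⟩
  -- Both polynomials have to be shortened simultaneously, so the induction runs downwards from an
  -- index `L` beyond both of them.
  have key : ∀ i, subst s (f.drop (L - i) + g.drop (L - i)) =
      subst s (f.drop (L - i)) + subst s (g.drop (L - i)) := by
    refine len_induction (by fun_prop) ?_ fun i hi => ?_
    · rw [tsub_zero, hf, hg, add_zero, subst_zero hs, add_zero]
    · by_cases h : L ≤ i
      · rwa [tsub_eq_zero_of_le (h.trans le_self_add), ← tsub_eq_zero_of_le h]
      · obtain ⟨k, rfl⟩ := exists_add_of_le (Order.add_one_le_iff.2 (not_le.1 h))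
        rw [add_assoc, add_tsub_cancel_left, add_comm 1 k, ← drop_drop, ← drop_drop] at hi
        rw [add_tsub_cancel_left, subst_eq hs, drop_add, hi, co_add, C_add,
          subst_eq hs (f.drop k), subst_eq hs (g.drop k)]
        ring
  simpa using key L

theorem subst_Xp_one_mul (f : Poly p) : subst s (Xp 1 * f) = Xp s * subst s f := by
  rw [← shift_eq, subst_eq hs, drop_shift_one, co_shift_one_zero, C_zero, zero_add]

theorem subst_C_mul (c : Fp p) (f : Poly p) : subst s (C c * f) = C c * subst s f := by
  refine induction (P := fun f => subst s (C c * f) = C c * subst s f) (by fun_prop) ?_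
    (fun f hf => ?_) f
  · rw [mul_zero, subst_zero hs, mul_zero]
  · rw [eq_C_add f, mul_add, mul_left_comm, subst_add hs, subst_add hs, ← C_mul, subst_C hs,
      subst_C hs, subst_Xp_one_mul hs, subst_Xp_one_mul hs, hf, C_mul]
    ring

theorem subst_mul (f g : Poly p) : subst s (f * g) = subst s f * subst s g := by
  refine induction (P := fun f => subst s (f * g) = subst s f * subst s g) (by fun_prop) ?_
    (fun f hf => ?_) f
  · rw [zero_mul, subst_zero hs, zero_mul]
  · rw [eq_C_add f, add_mul, mul_assoc, subst_add hs, subst_add hs, subst_C hs, subst_C_mul hs,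
      subst_Xp_one_mul hs, subst_Xp_one_mul hs, hf]
    ring

theorem subst_one : subst s (1 : Poly p) = 1 := subst_C hs 1

/-- The substitution of `X ^ s` as a ring homomorphism. -/
noncomputable def substHom : Poly p →+* Poly p where
  toFun := subst s
  map_one' := subst_one hs
  map_mul' := subst_mul hs
  map_zero' := subst_zero hs
  map_add' := subst_add hs

theorem subst_sub (f g : Poly p) : subst s (f - g) = subst s f - subst s g :=
  map_sub (substHom hs) f g

theorem subst_dvd {f g : Poly p} (h : f ∣ g) : subst s f ∣ subst s g := map_dvd (substHom hs) h

theorem subst_Xp (n : Len M) : subst s (Xp n : Poly p) = Xp (s * n) := by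
  refine len_induction (P := fun n => subst s (Xp n : Poly p) = Xp (s * n)) (by fun_prop) ?_
    (fun n hn => ?_) n
  · rw [mul_zero, Xp_zero, subst_one hs]
  · rw [Xp_add, mul_comm, subst_Xp_one_mul hs, hn, ← Xp_add]
    congr 1
    ring

theorem subst_subst {t : Len M} (ht : t ≠ 0) (f : Poly p) :
    subst s (subst t f) = subst (s * t) f := by
  refine induction (P := fun f => subst s (subst t f) = subst (s * t) f) (by fun_prop) ?_
    (fun f hf => ?_) f
  · rw [subst_zero ht, subst_zero hs, subst_zero (mul_ne_zero hs ht)]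
  · rw [subst_eq ht, subst_add hs, subst_mul hs, subst_C hs, subst_Xp hs, hf,
      ← subst_eq (mul_ne_zero hs ht)]

/-- The last term added is f_d·X^{sd}, and all earlier ones lie strictly below it. -/
theorem HasDeg.subst {f : Poly p} {d : Len M} (h : HasDeg f d) :
    HasDeg (subst s f) (s * d) := by
  obtain ⟨T, hT, hT0, hTs, hTd, -, hTf⟩ := exists_subst hs f
  rw [← hTf _ h.1, hTs]
  constructor
  · rw [drop_add, drop_eq_zero_mono (hTd d) le_self_add, zero_add]
    refine drop_eq_zero_iff.2 fun i hi => ?_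
    obtain ⟨k, rfl⟩ := exists_add_of_le hi
    rw [← shift_eq, add_assoc, co_shift_add, add_comm 1, co_C_succ]
  · have := co_shift_add (s * d) 0 (C (f.co d))
    rw [add_zero, shift_eq, co_C_zero] at this
    rw [co_add, drop_eq_zero_iff.1 (hTd d) _ le_rfl, zero_add, this]
    exact h.2

end

end Poly

end PVModel
end PVArith

namespace PVArith
namespace PVModel

variable {M : Type*} [PVModel M]

namespace Poly

set_option linter.unusedSectionVars false

variable {p : M} [hp : Fact (IsPrime p)]

/-! ### Exact division -/

/-- The first `|I|` coefficients of the power series `g / f`, where the constant coefficient of `f`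
is one; the arguments are `(I, p, f, g)`. -/
def _root_.PVArith.Sym.quoUpTo : Sym 4 :=
  let step : Sym 5 := .ap3 .polyAdd (.proj 2) (.proj 1)
    (.ap2 .rem (.ap3 .coef (.proj 0) (.proj 2) (.proj 4) + (.proj 2 - 1) *
      .ap3 .coef (.proj 0) (.proj 2) (.ap3 .polyMul (.proj 2) (.proj 3) (.proj 1))) (.proj 2) *
      .ap2 .smash (.proj 2) (.proj 0))
  .lrn 0 step step (.ap2 .smash (.proj 1) (.proj 0))

/-- The quotient of the polynomials `g` and `f`, where the constant coefficient of `f` is one and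
`f` divides `g`. -/
noncomputable def quo (f g : Poly p) : Poly p :=
  ofCode (ev .quoUpTo ![g.1, p, f.1, g.1])

@[fun_prop] theorem _root_.PVArith.Def.quo {Γ : Type*} [Coded M Γ] {f g : Γ → Poly p}
    (hf : Def M f) (hg : Def M g) : Def M fun γ => quo (f γ) (g γ) := by
  unfold PVModel.Poly.quo
  fun_prop

/-- `g` is X^i times a polynomial, hence so is the product, and only the constant coefficients of
the remaining factors matter. -/
theorem co_mul_of_lt {f g : Poly p} {i : Len M} (hg : ∀ j < i, g.co j = 0) :
    (f * g).co i = f.co 0 * g.co i := by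
  have : g = shift i (g.drop i) := by
    refine ext fun j => ?_
    rcases lt_or_ge j i with h | h
    · rw [hg j h, co_shift_of_lt _ h]
    · obtain ⟨k, rfl⟩ := exists_add_of_le h
      rw [co_shift_add, co_drop]
  have h0 := co_shift_add i 0 (f * g.drop i)
  rw [add_zero, co_mul_zero, co_drop, add_zero] at h0
  conv_lhs => rw [this, mul_comm, shift_mul, mul_comm]
  exact h0


/-- If `T j` agrees with `h` below j, then g - f·T_j = f·(h - T_j) starts at index j with the next
coefficient of `h`, because f_0 = 1. No inverse in ℤ/p is needed. -/
theorem quo_eq {f g h : Poly p} (hf : f.co 0 = 1) (hfh : f * h = g) :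
    ev .quoUpTo ![g.1, p, f.1, g.1] = h.1 := by
  have hshr (F : Poly p) (y : M) : rm (ev .coef ![y, p, g.1] + (p - 1) *
      ev .coef ![y, p, ev .polyMul ![p, f.1, F.1] ]) p * sm p y =
      (shift (len y) (C ((g - f * F).co (len y)))).1 := by
    rw [coef_eq_cf, coef_eq_cf, ← val_mul, ← rep_co, ← rep_co, sm_eq_ex, ← rep_cls]
    simp only [map_add, map_mul, cls_rep]
    rw [← neg_eq, ← sub_eq_add_neg, ← co_sub]
    rfl
  have hd (j : Len M) (F : Poly p) (hF : F.drop j = 0) :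
      (F + shift j (C ((g - f * F).co j))).drop (j + 1) = 0 := by
    refine drop_eq_zero_iff.2 fun i hi => ?_
    obtain ⟨k, rfl⟩ := exists_add_of_le hi
    rw [co_add, drop_eq_zero_iff.1 hF, zero_add, add_assoc, co_shift_add, add_comm 1, co_C_succ]
    exact le_self_add.trans le_self_add
  have key : ∃ T : Len M → Poly p, Def M T ∧
      (∀ u, ev .quoUpTo ![u, p, f.1, g.1] = (T (len u)).1) ∧ T 0 = 0 ∧
      (∀ j, T (j + 1) = T j + shift j (C ((g - f * T j).co j))) ∧ ∀ j, (T j).drop j = 0 := by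
    refine exists_poly_recursion (p := p) (g := 0) (c := ![p, f.1, g.1]) (F₀ := 0)
      (h := .ap3 .polyAdd (.proj 2) (.proj 1)
        (.ap2 .rem (.ap3 .coef (.proj 0) (.proj 2) (.proj 4) + (.proj 2 - 1) *
          .ap3 .coef (.proj 0) (.proj 2) (.ap3 .polyMul (.proj 2) (.proj 3) (.proj 1))) (.proj 2) *
          .ap2 .smash (.proj 2) (.proj 0)))
      (b := .ap2 .smash (.proj 1) (.proj 0)) (P := fun j F => F.drop j = 0)
      (H := fun j F => F + shift j (C ((g - f * F).co j))) (B := fun j => ex (len p * j))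
      (by fun_prop) (ev_zero _) (fun y y' v h => ?_) (fun y F _ => ?_) (fun y => ?_) ?_ hd
      fun j F hF => (drop_eq_zero_iff_lt.1 hF).le
    · simp only [cons_eq_vecCons, ev_ap3, ev_mul, ev_add, ev_sub, ev_one, ev_ap2, ev_proj]
      change ev .polyAdd ![p, v, rm (ev .coef ![y, p, g.1] + (p - 1) *
          ev .coef ![y, p, ev .polyMul ![p, f.1, v] ]) p * sm p y] =
        ev .polyAdd ![p, v, rm (ev .coef ![y', p, g.1] + (p - 1) *
          ev .coef ![y', p, ev .polyMul ![p, f.1, v] ]) p * sm p y']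
      rw [coef_eq_cf, coef_eq_cf, coef_eq_cf, coef_eq_cf, len_eq_iff.2 h, sm_congr_right p h]
    · simp only [cons_eq_vecCons, ev_ap3, ev_mul, ev_add, ev_sub, ev_one, ev_ap2, ev_proj]
      refine Eq.trans ?_ (val_add _ _).symm
      rw [← hshr]
      rfl
    · simp only [cons_eq_vecCons, ev_ap2, ev_proj]
      exact sm_eq_ex p y
    · rw [drop_zero]
  obtain ⟨T, hT, hTu, hT0, hTs, hTd⟩ := key
  rw [hTu, val_inj]
  have hco : ∀ i, ∀ j < i, (h - T i).co j = 0 := by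
    refine len_induction ?_ (fun j hj => (not_lt_zero hj).elim) fun i hi j hj => ?_
    · exact .ball .id (by fun_prop)
    · have h1 : g - f * T i = f * (h - T i) := by rw [← hfh]; ring
      rw [hTs, h1, co_mul_of_lt hi, hf, one_mul, ← sub_sub, co_sub]
      rcases (Order.lt_add_one_iff.1 hj).lt_or_eq with h | rfl
      · rw [hi j h, co_shift_of_lt _ h, sub_zero]
      · have := co_shift_add j 0 (C ((h - T j).co j))
        rw [add_zero, co_C_zero] at this
        rw [this, sub_self]
  refine ext fun i => ?_
  rcases lt_or_ge i (len g.1) with hi | hi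
  · have := hco _ i hi
    rw [co_sub] at this
    exact (sub_eq_zero.1 this).symm
  · rw [drop_eq_zero_iff.1 (hTd _) i hi]
    -- A nonzero coefficient of `h` at an index i ≥ |g| would give f·h = g a degree of at least |g|.
    by_contra h0
    have hh : h ≠ 0 := fun h' => h0 (by rw [h', co_zero])
    obtain ⟨d, hd⟩ := exists_hasDeg (ne_zero_of_co_zero hf)
    obtain ⟨e, he⟩ := exists_hasDeg hh
    have h1 : ¬ e < i := fun h => h0 (drop_eq_zero_iff.1 he.1 i (Order.add_one_le_iff.2 h)).symm
    refine (hd.mul he).2 ?_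
    rw [hfh]
    exact co_eq_zero (hi.trans ((not_lt.1 h1).trans le_add_self))

theorem quo_of_mul {f g h : Poly p} (hf : f.co 0 = 1) (hfh : f * h = g) : quo f g = h := by
  rw [quo, quo_eq hf hfh, ofCode_val]

/-- The unbounded quantifier in divisibility is replaced by an equation between PV-functions, to
which induction applies. This is why all divisors are normalised to have constant coefficient 1. -/
theorem dvd_iff {f g : Poly p} (hf : f.co 0 = 1) : f ∣ g ↔ f * quo f g = g := by
  constructor
  · rintro ⟨h, rfl⟩
    rw [quo_of_mul hf rfl]
  · exact fun h => ⟨_, h.symm⟩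

end Poly

end PVModel
end PVArith

namespace PVArith
namespace PVModel

variable {M : Type*} [PVModel M]

namespace Poly

set_option linter.unusedSectionVars false

variable {p : M} [hp : Fact (IsPrime p)]

/-! ### Binomials `1 - X ^ n` -/

/-- The polynomial `1 - X ^ n`. -/
noncomputable def bin (n : Len M) : Poly p := 1 - Xp n

@[fun_prop] theorem _root_.PVArith.Def.bin {Γ : Type*} [Coded M Γ] {n : Γ → Len M}
    (hn : Def M n) : Def M fun γ => bin (p := p) (n γ) := by
  unfold PVModel.Poly.bin
  fun_prop

theorem co_bin_zero {n : Len M} (hn : n ≠ 0) : (bin n : Poly p).co 0 = 1 := by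
  rw [bin, co_sub, co_Xp_zero hn, co_one_zero, sub_zero]

theorem hasDeg_bin {n : Len M} (hn : n ≠ 0) : HasDeg (bin n : Poly p) n := by
  obtain ⟨k, rfl⟩ := (len_cases n).resolve_left hn
  constructor
  · refine drop_eq_zero_iff.2 fun i hi => ?_
    obtain ⟨l, rfl⟩ := exists_add_of_le hi
    rw [bin, co_sub, Xp, add_assoc (k + 1), co_shift_add, one_def, add_comm 1 l, co_C_succ,
      show k + 1 + (l + 1) = k + 1 + l + 1 by ring, co_C_succ, sub_zero]
  · rw [bin, co_sub, co_Xp_self, one_def, co_C_succ, zero_sub]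
    exact neg_ne_zero.2 one_ne_zero

theorem bin_add (m n : Len M) : (bin (m + n) : Poly p) = bin m + Xp m * bin n := by
  rw [bin, bin, bin, Xp_add]
  ring

theorem subst_bin {s : Len M} (hs : s ≠ 0) (n : Len M) :
    subst s (bin n : Poly p) = bin (s * n) := by
  rw [bin, subst_sub hs, subst_one hs, subst_Xp hs, bin]

/-- The relation `f ∣ g` between polynomials, where the constant coefficient of `f` is one. -/
def Dv (f g : Poly p) : Prop := f.co 0 = 1 ∧ f ∣ g

@[fun_prop] theorem _root_.PVArith.Def.dv {Γ : Type*} [Coded M Γ] {f g : Γ → Poly p}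
    (hf : Def M f) (hg : Def M g) : Def M fun γ => Dv (f γ) (g γ) := by
  have : Def M fun γ => (f γ).co 0 = 1 ∧ f γ * Poly.quo (f γ) (g γ) = g γ := by fun_prop
  convert this using 3 with γ
  exact and_congr_right fun h => dvd_iff h

theorem bin_dvd_bin {n : Len M} (hn : n ≠ 0) (k : Len M) : (bin n : Poly p) ∣ bin (n * k) := by
  refine (len_induction (P := fun k => Dv (bin n : Poly p) (bin (n * k))) (by fun_prop)
    ⟨co_bin_zero hn, ?_⟩ (fun k hk => ⟨co_bin_zero hn, ?_⟩) k).2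
  · rw [mul_zero, bin, bin, Xp_zero, sub_self]
    exact dvd_zero _
  · rw [mul_add, mul_one, bin_add]
    exact hk.2.add (dvd_mul_left _ _)

/-- With Y = X^n, the quotient (1 - Y^k) / (1 - Y) is a sum of k powers of Y and thus congruent to k
modulo 1 - Y. The induction on k avoids writing down the sum. -/
theorem bin_mul_sub {n : Len M} (hn : n ≠ 0) (k : Len M) :
    (bin n * bin n : Poly p) ∣ bin (n * k) - C (cls p (k : M)) * bin n := by
  have h1 : (bin n * bin n : Poly p).co 0 = 1 := by
    rw [co_mul_zero, co_bin_zero hn, one_mul]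
  refine (len_induction (P := fun k => Dv (bin n * bin n : Poly p)
    (bin (n * k) - C (cls p (k : M)) * bin n)) (by fun_prop)
    ⟨h1, ?_⟩ (fun k hk => ⟨h1, ?_⟩) k).2
  · rw [mul_zero, show (bin 0 : Poly p) = 0 by rw [bin, Xp_zero, sub_self], ZeroMemClass.coe_zero, map_zero, C_zero, zero_mul,
      sub_zero]
    exact dvd_zero _
  · have h2 : bin (n * (k + 1)) - C (cls p ((k + 1 : Len M) : M)) * bin n =
        (bin (n * k) - C (cls p (k : M)) * bin n) - bin (n * k) * bin n := by
      rw [mul_add, mul_one, bin_add, Subsemiring.coe_add, map_add, C_add, OneMemClass.coe_one,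
        map_one, ← one_def, show (bin (n * k) : Poly p) = 1 - Xp (n * k) from rfl]
      ring
    rw [h2]
    exact dvd_sub hk.2 (mul_dvd_mul_right (bin_dvd_bin hn k) _)

/-- `f` divides (1 - X^{mk}) / (1 - X^m), which is congruent to k modulo 1 - X^m; and k is
invertible as 0 < k < p. -/
theorem isCoprime_bin_of_mul_dvd {f : Poly p} {m k : Len M} (hm : m ≠ 0) (hk : k ≠ 0)
    (hkp : (k : M) < p) (h : f * bin m ∣ bin (m * k)) : IsCoprime f (bin m) := by
  obtain ⟨w, hw⟩ := h
  obtain ⟨t, ht⟩ := bin_mul_sub (p := p) hm k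
  have h1 : f * w = bin m * t + C (cls p (k : M)) := by
    refine mul_left_cancel₀ (ne_zero_of_co_zero (co_bin_zero hm)) ?_
    linear_combination ht - hw
  have h2 : cls p (k : M) ≠ 0 := by
    rw [Ne, cls_eq_zero_of_lt hkp, ZeroMemClass.coe_eq_zero]
    exact hk
  obtain ⟨d, hd⟩ := exists_mul_eq_one h2
  have h3 : C d * C (cls p (k : M)) = 1 := by rw [← C_mul, hd, one_def]
  exact ⟨C d * w, -(C d * t), by linear_combination C d * h1 + h3⟩

/-- Modulo `f` the power X^m is 1, so 1 - X^g is congruent to 1 - X^{ak}, a multiple of 1 - X^k. -/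
theorem IsCoprime_bin {f : Poly p} {a b g k m : Len M} (hk : k ≠ 0) (hm : m ≠ 0)
    (h : a * k = g + b * m) (hfm : f ∣ bin m) (hfg : IsCoprime f (bin g)) :
    IsCoprime f (bin k) := by
  obtain ⟨u, hu⟩ := bin_dvd_bin (p := p) hk a
  obtain ⟨v, hv⟩ := bin_dvd_bin (p := p) hm b
  obtain ⟨w, hw⟩ := hfm
  obtain ⟨x, y, hxy⟩ := hfg
  rw [mul_comm, h, bin_add, mul_comm b m, hv, hw] at hu
  exact ⟨x - y * Xp g * w * v, y * u, by linear_combination hxy - y * hu⟩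

/-! ### The cyclotomic polynomials -/

/-- The bound on `d` makes coprimality definable. It loses nothing unless m = n = 0, and then d = 0
refutes the right side. -/
theorem isRelPrime_len_iff {m n : Len M} :
    IsRelPrime m n ↔ ∀ d < m + n + 1, d ∣ m → d ∣ n → d = 1 := by
  constructor
  · exact fun h d _ hm hn => isUnit_len_iff.1 (h hm hn)
  · refine fun h d hm hn => isUnit_len_iff.2 (h d ?_ hm hn)
    rw [Order.lt_add_one_iff]
    rcases eq_or_ne m 0 with rfl | hm0
    · rcases eq_or_ne n 0 with rfl | hn0
      · exact absurd (h 0 (by simp) dvd_rfl dvd_rfl) zero_ne_one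
      · exact (len_le_of_dvd hn0 hn).trans le_add_self
    · exact (len_le_of_dvd hm0 hm).trans le_self_add

@[fun_prop] theorem _root_.PVArith.Def.isRelPrime {Γ : Type*} [Coded M Γ] {m n : Γ → Len M}
    (hm : Def M m) (hn : Def M n) : Def M fun γ => IsRelPrime (m γ) (n γ) := by
  simp only [isRelPrime_len_iff]
  refine .ball (by fun_prop) ?_
  have h1 : Def M fun x : Γ × Len M => m x.1 := hm.comp (.fst .id)
  have h2 : Def M fun x : Γ × Len M => n x.1 := hn.comp (.fst .id)
  exact .imp (by fun_prop) (.imp (by fun_prop) (by fun_prop))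

/-- The properties of the cyclotomic polynomial `f` of index `n`. -/
structure IsCyclo (r n : Len M) (f : Poly p) : Prop where
  dv : Dv f (bin n)
  -- The restriction s ≤ r keeps the quantifier bounded by a length; it suffices because the
  -- invariant is applied to prime divisors of the final index r.
  subst_dv : ∀ s < r + 1, s ≠ 0 → IsRelPrime s n → Dv f (subst s f)
  quo_dv : ∀ s < r + 1, s ≠ 0 → IsRelPrime s n →
    Dv (quo f (bin n)) (subst s (quo f (bin n)))
  mul_dv : ∀ m < n, m ∣ n → Dv (f * bin m) (bin n)

@[fun_prop] theorem _root_.PVArith.Def.isCyclo {Γ : Type*} [Coded M Γ] {r n : Γ → Len M}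
    {f : Γ → Poly p} (hr : Def M r) (hn : Def M n) (hf : Def M f) :
    Def M fun γ => IsCyclo (r γ) (n γ) (f γ) := by
  have hn' : Def M fun x : Γ × Len M => n x.1 := hn.comp (.fst .id)
  have hf' : Def M fun x : Γ × Len M => f x.1 := hf.comp (.fst .id)
  have h1 : Def M fun γ => ∀ s < r γ + 1, s ≠ 0 → IsRelPrime s (n γ) →
      Dv (f γ) (Poly.subst s (f γ)) :=
    .ball (by fun_prop) (.imp (by fun_prop) (.imp (by fun_prop) (by fun_prop)))
  have h2 : Def M fun γ => ∀ s < r γ + 1, s ≠ 0 → IsRelPrime s (n γ) →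
      Dv (Poly.quo (f γ) (Poly.bin (n γ))) (Poly.subst s (Poly.quo (f γ) (Poly.bin (n γ)))) :=
    .ball (by fun_prop) (.imp (by fun_prop) (.imp (by fun_prop) (by fun_prop)))
  have h3 : Def M fun γ => ∀ m < n γ, m ∣ n γ → Dv (f γ * Poly.bin m) (Poly.bin (n γ)) :=
    .ball (by fun_prop) (.imp (by fun_prop) (by fun_prop))
  convert (Def.dv hf (.bin hn)).and (h1.and (h2.and h3)) using 3 with γ
  exact ⟨fun h => ⟨h.1, h.2, h.3, h.4⟩, fun h => ⟨h.1, h.2.1, h.2.2.1, h.2.2.2⟩⟩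

end Poly

end PVModel
end PVArith

/-! ### The cyclotomic recursion preserves the invariant -/

namespace PVArith
namespace PVModel

variable {M : Type*} [PVModel M]

namespace Poly

set_option linter.unusedSectionVars false

variable {p : M} [hp : Fact (IsPrime p)]

theorem isCyclo_one (r : Len M) : IsCyclo r 1 (bin 1 : Poly p) where
  dv := ⟨co_bin_zero one_ne_zero, dvd_rfl⟩
  subst_dv s _ hs _ := ⟨co_bin_zero one_ne_zero, by
    rw [subst_bin hs, mul_comm]; exact bin_dvd_bin one_ne_zero s⟩
  quo_dv s _ hs _ := by
    rw [quo_of_mul (co_bin_zero one_ne_zero) (mul_one _), subst_one hs]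
    exact ⟨co_one_zero, dvd_rfl⟩
  mul_dv m hm h := by
    rw [← zero_add (1 : Len M), Order.lt_add_one_iff, nonpos_iff_eq_zero] at hm
    rw [hm, zero_dvd_iff] at h
    exact absurd h one_ne_zero

/-- If m = qk, then k is a proper divisor of n, and X^q is substituted into the condition for k. If
q does not divide m, then m divides n, so 1 - X^m divides 1 - X^n and `h` applies. -/
theorem IsCyclo.mul_dv_mul {r n q : Len M} {f F : Poly p} (hf : IsCyclo r n f) (hn : n ≠ 0)
    (hq : Irreducible q) (hF : F.co 0 = 1) (hFf : F ∣ subst q f)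
    (h : F * bin n ∣ bin (n * q)) (m : Len M) (hm : m < n * q) (hmn : m ∣ n * q) :
    Dv (F * bin m) (bin (n * q)) := by
  have hq0 : q ≠ 0 := hq.ne_zero
  have hm0 : m ≠ 0 := by
    rintro rfl
    exact mul_ne_zero hn hq0 (zero_dvd_iff.1 hmn)
  refine ⟨by rw [co_mul_zero, hF, co_bin_zero hm0, one_mul], ?_⟩
  by_cases hqm : q ∣ m
  · obtain ⟨k, rfl⟩ := hqm
    rw [mul_comm q] at hm hmn
    have hk : k < n := lt_of_mul_lt_mul_right hm zero_le
    have := subst_dvd hq0 (hf.mul_dv k hk ((mul_dvd_mul_iff_right hq0).1 hmn)).2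
    rw [subst_mul hq0, subst_bin hq0, subst_bin hq0, mul_comm q n] at this
    exact (mul_dvd_mul_right hFf _).trans this
  · obtain ⟨k, rfl⟩ : m ∣ n :=
      ((hq.isRelPrime_iff_not_dvd.2 hqm).symm.dvd_of_dvd_mul_right hmn)
    exact (mul_dvd_mul_left F (bin_dvd_bin hm0 k)).trans h

/-- Substituting X^q is a ring homomorphism that commutes with substituting X^s, so the conditions
carry over; the cofactor h becomes h(X^q). -/
theorem IsCyclo.subst_of_dvd {r n q : Len M} {f : Poly p} (hf : IsCyclo r n f) (hn : n ≠ 0)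
    (hq : Irreducible q) (hqn : q ∣ n) : IsCyclo r (n * q) (subst q f) := by
  have hq0 : q ≠ 0 := hq.ne_zero
  have hF : (subst q f).co 0 = 1 := by rw [co_subst_zero hq0, hf.dv.1]
  obtain ⟨h, hh⟩ := hf.dv.2
  have hH : subst q f * subst q h = bin (n * q) := by
    rw [← subst_mul hq0, ← hh, subst_bin hq0, mul_comm]
  have hcop {s : Len M} (hs : IsRelPrime s (n * q)) : IsRelPrime s n :=
    hs.of_mul_right_left
  have hquo := quo_of_mul hf.dv.1 hh.symm
  refine ⟨⟨hF, _, hH.symm⟩, fun s hs hs0 hsn => ⟨hF, ?_⟩, fun s hs hs0 hsn => ?_,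
    hf.mul_dv_mul hn hq hF dvd_rfl ?_⟩
  · rw [subst_subst hs0 hq0, mul_comm, ← subst_subst hq0 hs0]
    exact subst_dvd hq0 (hf.subst_dv s hs hs0 (hcop hsn)).2
  · have := hf.quo_dv s hs hs0 (hcop hsn)
    rw [hquo] at this
    rw [quo_of_mul hF hH]
    refine ⟨by rw [co_subst_zero hq0, this.1], ?_⟩
    rw [subst_subst hs0 hq0, mul_comm, ← subst_subst hq0 hs0]
    exact subst_dvd hq0 this.2
  -- Here n = qk, so the condition for the proper divisor k turns into the one for n under the
  -- substitution of X^q.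
  · obtain ⟨k, rfl⟩ := hqn
    have hk0 : k ≠ 0 := right_ne_zero_of_mul hn
    have hk : k < q * k := lt_mul_of_one_lt_left (pos_iff_ne_zero.2 hk0) (irreducible_len_iff.1 hq).1
    have := subst_dvd hq0 (hf.mul_dv k hk (dvd_mul_left _ _)).2
    rwa [subst_mul hq0, subst_bin hq0, subst_bin hq0, mul_comm q (q * k)] at this

/-- Write f·h = 1 - X^n and f(X^q) = f·F. The cofactor of F is f·h(X^q), so its condition is
inherited factor by factor. That F divides F(X^s) needs the coprimality of F and f(X^s), which is
where r < p enters. -/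
theorem IsCyclo.quo_of_not_dvd {r n q : Len M} {f : Poly p} (hf : IsCyclo r n f) (hn : n ≠ 0)
    (hq : Irreducible q) (hqn : ¬ q ∣ n) (hqr : q ≤ r) (hrp : (r : M) < p) :
    f * quo f (subst q f) = subst q f ∧ IsCyclo r (n * q) (quo f (subst q f)) := by
  have hq0 : q ≠ 0 := hq.ne_zero
  have hqr' : q < r + 1 := Order.lt_add_one_iff.2 hqr
  have hrel : IsRelPrime q n := hq.isRelPrime_iff_not_dvd.2 hqn
  obtain ⟨F, hF⟩ := (hf.subst_dv q hqr' hq0 hrel).2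
  rw [quo_of_mul hf.dv.1 hF.symm]
  refine ⟨hF.symm, ?_⟩
  obtain ⟨h, hh⟩ := hf.dv.2
  have hquo := quo_of_mul hf.dv.1 hh.symm
  have hF0 : F.co 0 = 1 := by
    have := congrArg (co · 0) hF
    simp only [co_subst_zero hq0, co_mul_zero, hf.dv.1, one_mul] at this
    exact this.symm
  have hH : F * (f * subst q h) = bin (n * q) := by
    rw [mul_left_comm, ← mul_assoc, ← hF, ← subst_mul hq0, ← hh, subst_bin hq0, mul_comm]
  have hhq := hf.quo_dv q hqr' hq0 hrel
  rw [hquo] at hhq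
  -- As h divides h(X^q), the cofactor f·h(X^q) is a multiple of f·h = 1 - X^n.
  have hA : F * bin n ∣ bin (n * q) := by
    obtain ⟨w, hw⟩ := hhq.2
    exact ⟨w, by rw [← hH, hw, hh]; ring⟩
  have hcop : IsCoprime F (bin n) := isCoprime_bin_of_mul_dvd hn hq0
    (lt_of_le_of_lt (show (q : M) ≤ r from hqr) hrp) hA
  have hsq {s : Len M} (hs : IsRelPrime s (n * q)) : IsRelPrime s q := hs.of_mul_right_right
  have hsn' {s : Len M} (hs : IsRelPrime s (n * q)) : IsRelPrime s n := hs.of_mul_right_left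
  refine ⟨⟨hF0, _, hH.symm⟩, fun s hs hs0 hsn => ⟨hF0, ?_⟩, fun s hs hs0 hsn => ?_,
    hf.mul_dv_mul hn hq hF0 ⟨f, by rw [hF, mul_comm]⟩ hA⟩
  -- From a·s = 1 + b·q follows a·(sn) = n + b·(nq), and F divides 1 - X^{nq}; so coprimality to 1 -
  -- X^n passes to 1 - X^{sn}, a multiple of f(X^s).
  · have h1 : IsCoprime F (bin (s * n)) := by
      obtain ⟨a, b, g, -, hgq, hgs, hab⟩ := bezout q s hq0 hs0
      rw [isUnit_len_iff.1 (hsq hsn hgs hgq)] at hab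
      exact IsCoprime_bin (a := a) (b := b) (g := n) (m := n * q) (mul_ne_zero hs0 hn)
        (mul_ne_zero hn hq0) (by linear_combination n * hab) ⟨_, hH.symm⟩ hcop
    have h2 : subst s f ∣ bin (s * n) := by
      rw [← subst_bin hs0]
      exact subst_dvd hs0 hf.dv.2
    -- F divides f·F = f(X^q), which divides f(X^{sq}) = f(X^s)·F(X^s), and the factor coprime to F
    -- can be dropped.
    refine (h1.of_isCoprime_of_dvd_right h2).dvd_of_dvd_mul_left ?_
    rw [← subst_mul hs0, ← hF, subst_subst hs0 hq0, mul_comm s q, ← subst_subst hq0 hs0]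
    exact (dvd_mul_left F f).trans
      (hF ▸ subst_dvd hq0 (hf.subst_dv s hs hs0 (hsn' hsn)).2)
  · have h1 := hf.quo_dv s hs hs0 (hsn' hsn)
    rw [hquo] at h1
    rw [quo_of_mul hF0 hH, subst_mul hs0, subst_subst hs0 hq0, mul_comm s q,
      ← subst_subst hq0 hs0]
    refine ⟨by rw [co_mul_zero, co_subst_zero hq0, hf.dv.1, h1.1, one_mul], ?_⟩
    exact mul_dvd_mul (hf.subst_dv s hs hs0 (hsn' hsn)).2 (subst_dvd hq0 h1.2)

/-- The gcd g of r and m is a proper divisor of r, so `f` is coprime to 1 - X^g by the condition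
`mul_dv`; as g is congruent to a multiple of m modulo r, this passes to 1 - X^m. -/
theorem IsCyclo.isCoprime {r : Len M} {f : Poly p} (hf : IsCyclo r r f) (hr : r ≠ 0)
    (hrp : (r : M) < p) {m : Len M} (hm0 : m ≠ 0) (hm : m < r) : IsCoprime f (bin m) := by
  obtain ⟨a, b, g, hg0, ⟨k, hk⟩, hgm, hab⟩ := bezout r m hr hm0
  have hgr : g < r := (len_le_of_dvd hm0 hgm).trans_lt hm
  refine IsCoprime_bin hm0 hr hab hf.dv.2 (isCoprime_bin_of_mul_dvd hg0 (k := k) ?_ ?_ ?_)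
  · rintro rfl
    exact hr (by rw [hk, mul_zero])
  · refine lt_of_le_of_lt (show (k : M) ≤ r from ?_) hrp
    exact len_le_of_dvd hr ⟨g, by rw [hk, mul_comm]⟩
  · rw [← hk]
    exact (hf.mul_dv g hgr ⟨k, hk⟩).2

end Poly

end PVModel
end PVArith

namespace PVArith
namespace PVModel

variable {M : Type*} [PVModel M]

/-! ### Euler's totient -/

/-- The totient only asks whether the search finds a common divisor greater than 1, so the value of
the gcd is not identified any further. -/
theorem ev_gcdUpTo (i r : Len M) :
    ∃ T : Len M → M, Def M T ∧ (∀ D, ev .gcdUpTo ![D, (i : M), (r : M)] = T (len D)) ∧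
      ∀ j, T j ≤ 1 ↔ ∀ d < j + 1, d ∣ i → d ∣ r → d ≤ 1 := by
  classical
  have key : ∃ T : Len M → M, Def M T ∧ (∀ D, ev .gcdUpTo ![D, (i : M), (r : M)] = T (len D)) ∧ T 0 = 0 ∧
      (∀ j, T (j + 1) = if (j + 1 ∣ i) ∧ (j + 1 ∣ r) then (((j + 1 : Len M)) : M) else T j) ∧
      ∀ j : Len M, T j ≤ (j : M) := by
    have hh (y v : M) : ev (.ap3 .cond (.ap2 .rem (.proj 2) (.ap1 .succ (.ap1 .size (.proj 0))) +
        .ap2 .rem (.proj 3) (.ap1 .succ (.ap1 .size (.proj 0))))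
        (.ap1 .succ (.ap1 .size (.proj 0))) (.proj 1) : Sym 4)
        (Fin.cons y (Fin.cons v ![(i : M), (r : M)])) =
        if (len y + 1 ∣ i) ∧ (len y + 1 ∣ r) then ((len y + 1 : Len M) : M) else v := by
      have h1 : sz y + 1 ≠ 0 := by simp
      simp only [cons_eq_vecCons, ev_ap3, ev_add, ev_ap2, ev_ap1, ev_proj, ev_cond]
      change (if rm (i : M) (ev .succ ![sz y]) + rm (r : M) (ev .succ ![sz y]) = 0
        then ev .succ ![sz y] else v) = _
      rw [ev_succ, ← coe_dvd_coe, ← coe_dvd_coe]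
      simp only [Subsemiring.coe_add, coe_len, OneMemClass.coe_one, add_eq_zero,
        rm_eq_zero_iff h1]
      congr
    refine exists_lrn_recursion (A := M) (enc := id) (dec := id) .id .id (fun _ => rfl) (g := 0)
      (c := ![(i : M), (r : M)]) (a₀ := 0)
      (h := .ap3 .cond (.ap2 .rem (.proj 2) (.ap1 .succ (.ap1 .size (.proj 0))) +
        .ap2 .rem (.proj 3) (.ap1 .succ (.ap1 .size (.proj 0))))
        (.ap1 .succ (.ap1 .size (.proj 0))) (.proj 1))
      (H := fun j v => if (j + 1 ∣ i) ∧ (j + 1 ∣ r) then (((j + 1 : Len M)) : M) else v)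
      (b := .ap1 .size (.proj 0)) (P := fun j v => v ≤ (j : M)) (B := fun j => j) (by fun_prop)
      (ev_zero _) (fun y y' v h => ?_) (fun y a _ => hh y a) (fun y => ?_) ?_ ?_ fun _ _ h => h
    · rw [hh, hh, len_eq_iff.2 h]
    · simp only [cons_eq_vecCons, ev_ap1, ev_proj]
      rfl
    · exact zero_le' _
    · intro j a ha
      split_ifs
      · exact le_rfl
      · exact ha.trans (by simp)
  obtain ⟨T, hT, hTD, hT0, hTs, -⟩ := key
  refine ⟨T, hT, hTD, fun j => ?_⟩
  have h1 : Def M fun j => ∀ d < j + 1, d ∣ i → d ∣ r → d ≤ 1 :=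
    .ball (by fun_prop) (.imp (by fun_prop) (.imp (by fun_prop) (by fun_prop)))
  refine len_induction (P := fun j => T j ≤ 1 ↔ ∀ d < j + 1, d ∣ i → d ∣ r → d ≤ 1)
    ?_ ?_ (fun j hj => ?_) j
  · have h2 : Def M fun j => T j ≤ 1 := by fun_prop
    simp only [iff_iff_implies_and_implies]
    exact .and (.imp h2 h1) (.imp h1 h2)
  · rw [hT0, zero_add]
    exact ⟨fun _ d hd _ _ => hd.le, fun _ => zero_le' _⟩
  · rw [hTs]
    split_ifs with h
    · constructor
      · exact fun h1 d hd _ _ => (Order.lt_add_one_iff.1 hd).trans h1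
      · exact fun h1 => h1 (j + 1) (Order.lt_add_one_iff.2 le_rfl) h.1 h.2
    · rw [hj]
      constructor
      · intro h1 d hd hdi hdr
        rcases (Order.lt_add_one_iff.1 hd).lt_or_eq with h2 | rfl
        · exact h1 d h2 hdi hdr
        · exact absurd ⟨hdi, hdr⟩ h
      · exact fun h1 d hd => h1 d (hd.trans (Order.lt_add_one_iff.2 le_rfl))

theorem ev_gcdUpTo_le_one {r : Len M} (hr : r ≠ 0) {D : M} (hD : len D = r) (i : Len M) :
    ev .gcdUpTo ![D, (i : M), (r : M)] - 1 = 0 ↔ IsRelPrime i r := by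
  obtain ⟨T, -, hT, h⟩ := ev_gcdUpTo i r
  rw [hT, tsub_eq_zero_iff_le, h, hD]
  constructor
  · intro h d hi hr'
    have hd : d ≠ 0 := fun h => hr (zero_dvd_iff.1 (h ▸ hr'))
    exact isUnit_len_iff.2 ((h d (Order.lt_add_one_iff.2 (len_le_of_dvd hr hr')) hi hr').antisymm
      (len_one_le_iff.2 hd))
  · exact fun h d _ hi hr' => (isUnit_len_iff.1 (h hi hr')).le

/-- The number of `i` with `1 ≤ i ≤ j` that are coprime to `r`. -/
noncomputable def cop (r j : Len M) : M := ev .totUpTo ![ones j, ones r]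

@[fun_prop] theorem _root_.PVArith.Def.cop {Γ : Type*} [Coded M Γ] {r j : Γ → Len M}
    (hr : Def M r) (hj : Def M j) : Def M fun γ => cop (r γ) (j γ) := by
  unfold PVModel.cop
  fun_prop

open Classical in
theorem ev_totUpTo {r : Len M} (hr : r ≠ 0) :
    (∀ I R, len R = r → ev .totUpTo ![I, R] = cop r (len I)) ∧ cop r 0 = 0 ∧
      (∀ j, cop r (j + 1) = cop r j + if IsRelPrime (j + 1) r then 1 else 0) ∧
      ∀ j : Len M, cop r j ≤ (j : M) := by
  have key (R : M) (hR : len R = r) : ∃ T : Len M → M, Def M T ∧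
      (∀ I, ev .totUpTo ![I, R] = T (len I)) ∧ T 0 = 0 ∧
      (∀ j, T (j + 1) = T j + if IsRelPrime (j + 1) r then 1 else 0) ∧
      ∀ j : Len M, T j ≤ (j : M) := by
    have hh (y v : M) : ev (.proj 1 + .ap3 .cond (.ap3 .gcdUpTo (.proj 2)
        (.ap1 .succ (.ap1 .size (.proj 0))) (.ap1 .size (.proj 2)) - 1) 1 0 : Sym 3)
        (Fin.cons y (Fin.cons v ![R])) = v + if IsRelPrime (len y + 1) r then 1 else 0 := by
      simp only [cons_eq_vecCons, ev_ap3, ev_add, ev_ap1, ev_proj, ev_cond, ev_sub, ev_one,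
        ev_zero]
      change v + (if ev .gcdUpTo ![R, ev .succ ![sz y], sz R] - 1 = 0 then 1 else 0) = _
      have h1 := ev_gcdUpTo_le_one hr hR (len y + 1)
      rw [← hR] at h1 ⊢
      rw [ev_succ]
      simp only [← h1]
      rfl
    refine exists_lrn_recursion (A := M) (enc := id) (dec := id) .id .id (fun _ => rfl) (g := 0)
      (c := ![R]) (a₀ := 0)
      (h := .proj 1 + .ap3 .cond (.ap3 .gcdUpTo (.proj 2)
        (.ap1 .succ (.ap1 .size (.proj 0))) (.ap1 .size (.proj 2)) - 1) 1 0)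
      (H := fun j v => v + if IsRelPrime (j + 1) r then 1 else 0)
      (b := .ap1 .size (.proj 0)) (P := fun j v => v ≤ (j : M)) (B := fun j => j) (by fun_prop)
      (ev_zero _) (fun y y' v h => ?_) (fun y a _ => hh y a) (fun y => ?_) ?_ ?_ fun _ _ h => h
    · rw [hh, hh, len_eq_iff.2 h]
    · simp only [cons_eq_vecCons, ev_ap1, ev_proj]
      rfl
    · exact zero_le' _
    · intro j a ha
      refine add_le_add ha ?_
      split_ifs
      · exact le_rfl
      · exact zero_le' _
  obtain ⟨T, hT, hTI, hT0, hTs, hTj⟩ := key (ones r) (len_ones r)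
  have hcop : cop r = T := funext fun j => by rw [cop, hTI, len_ones]
  rw [hcop]
  refine ⟨fun I R hR => ?_, hT0, hTs, hTj⟩
  obtain ⟨T', hT', hTI', hT0', hTs', -⟩ := key R hR
  rw [hTI']
  exact len_induction (P := fun j => T' j = T j) (by fun_prop) (by rw [hT0, hT0'])
    (fun j hj => by rw [hTs, hTs', hj]) _

theorem ev_tot {r : Len M} (hr : r ≠ 0) {R : M} (hR : len R = r) :
    ev .tot ![R] = cop r r := by
  rw [Sym.tot, ev_ap2, ev_proj]
  exact ((ev_totUpTo hr).1 R R hR).trans (by rw [hR])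

theorem cop_zero {r : Len M} (hr : r ≠ 0) : cop r 0 = 0 := (ev_totUpTo hr).2.1

theorem cop_succ_of {r j : Len M} (hr : r ≠ 0) (h : IsRelPrime (j + 1) r) :
    cop r (j + 1) = cop r j + 1 := by
  rw [(ev_totUpTo hr).2.2.1, if_pos h]

theorem cop_succ_of_not {r j : Len M} (hr : r ≠ 0) (h : ¬ IsRelPrime (j + 1) r) :
    cop r (j + 1) = cop r j := by
  rw [(ev_totUpTo hr).2.2.1, if_neg h, add_zero]

theorem cop_one : cop (1 : Len M) 1 = 1 := by
  have := cop_succ_of (r := (1 : Len M)) (j := 0) one_ne_zero isRelPrime_one_right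
  rwa [zero_add, cop_zero one_ne_zero, zero_add] at this

theorem isRelPrime_add_mul_iff {a n : Len M} (k : Len M) :
    IsRelPrime (a + n * k) n ↔ IsRelPrime a n := by
  constructor
  · exact fun h d ha hn => h (dvd_add ha (hn.mul_right k)) hn
  · exact fun h d ha hn => h (len_dvd_of_dvd_add ha (hn.mul_right k)) hn

/-- Coprimality to n has period n. -/
theorem cop_add {n : Len M} (hn : n ≠ 0) (i : Len M) : cop n (n + i) = cop n n + cop n i := by
  refine len_induction (P := fun i => cop n (n + i) = cop n n + cop n i) (by fun_prop)
    (by rw [add_zero, cop_zero hn, add_zero]) (fun i hi => ?_) i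
  have h := isRelPrime_add_mul_iff (a := i + 1) (n := n) 1
  rw [mul_one, show i + 1 + n = n + i + 1 by ring] at h
  rw [← add_assoc]
  by_cases h1 : IsRelPrime (i + 1) n
  · rw [cop_succ_of hn (h.2 h1), cop_succ_of hn h1, hi, add_assoc]
  · rw [cop_succ_of_not hn (mt h.1 h1), cop_succ_of_not hn h1, hi]

theorem cop_mul {n : Len M} (hn : n ≠ 0) (k : Len M) : cop n (n * k) = k * cop n n := by
  refine len_induction (P := fun k : Len M => cop n (n * k) = k * cop n n) (by fun_prop)
    (by rw [mul_zero, cop_zero hn, ZeroMemClass.coe_zero, zero_mul]) (fun k hk => ?_) k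
  rw [mul_add, mul_one, add_comm, cop_add hn, hk, Subsemiring.coe_add, OneMemClass.coe_one]
  ring

/-- If q divides n, being coprime to nq and to n are the same, and q periods of length n are
counted. -/
theorem cop_mul_self_of_dvd {n q : Len M} (hn : n ≠ 0) (hq : q ≠ 0) (h : q ∣ n) :
    cop (n * q) (n * q) = q * cop n n := by
  rw [← cop_mul hn]
  have h1 (j : Len M) : IsRelPrime j (n * q) ↔ IsRelPrime j n := by
    refine ⟨fun h => h.of_mul_right_left, fun h' => h'.mul_right ?_⟩
    exact h'.of_dvd_right h
  have hnq := mul_ne_zero hn hq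
  refine len_induction (P := fun j : Len M => cop (n * q) j = cop n j) (by fun_prop)
    (by rw [cop_zero hn, cop_zero hnq]) (fun j hj => ?_) _
  by_cases h2 : IsRelPrime (j + 1) n
  · rw [cop_succ_of hn h2, cop_succ_of hnq ((h1 _).2 h2), hj]
  · rw [cop_succ_of_not hn h2, cop_succ_of_not hnq (mt (h1 _).1 h2), hj]

/-- The numbers coprime to n but not to nq are the products q·j with j coprime to n. Up to qk there
are `cop n k` of them; the case k = n is the claim. -/
theorem cop_mul_self_of_not_dvd {n q : Len M} (hn : n ≠ 0) (hq : Irreducible q) (h : ¬ q ∣ n) :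
    cop (n * q) (n * q) + cop n n = q * cop n n := by
  have hq0 : q ≠ 0 := hq.ne_zero
  have hnq := mul_ne_zero hn hq0
  have hqn : IsRelPrime q n := hq.isRelPrime_iff_not_dvd.2 h
  have h1 (j : Len M) (hj : ¬ q ∣ j) : IsRelPrime j (n * q) ↔ IsRelPrime j n :=
    ⟨fun h => h.of_mul_right_left, fun h' =>
      h'.mul_right (hq.isRelPrime_iff_not_dvd.2 hj).symm⟩
  have h2 (j : Len M) : IsRelPrime (q * j) n ↔ IsRelPrime j n :=
    ⟨fun h => h.of_mul_left_right, fun h => hqn.mul_left h⟩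
  have h3 (j : Len M) : ¬ IsRelPrime (q * j) (n * q) := fun h =>
    hq.not_isUnit (h (dvd_mul_right _ _) (dvd_mul_left _ _))
  -- Strictly between two multiples of q both counts grow alike.
  have inner (k : Len M) (hk : cop (n * q) (q * k) + cop n k = cop n (q * k)) (i : Len M)
      (hi : i < q) : cop (n * q) (q * k + i) + cop n k = cop n (q * k + i) := by
    refine (len_induction (P := fun i => q ≤ i ∨
      cop (n * q) (q * k + i) + cop n k = cop n (q * k + i)) (by fun_prop)
      (.inr (by rwa [add_zero])) (fun i hi => ?_) i).resolve_left hi.not_ge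
    rcases le_or_gt q (i + 1) with hqi | hqi
    · exact .inl hqi
    right
    replace hi := hi.resolve_left ((Order.lt_add_one_iff.2 le_rfl).trans hqi).not_ge
    have h4 : ¬ q ∣ q * k + i + 1 := by
      intro h
      rw [add_assoc, add_comm] at h
      exact (len_le_of_dvd (by simp) (len_dvd_of_dvd_add h (dvd_mul_right _ _))).not_gt hqi
    rw [← add_assoc]
    by_cases h5 : IsRelPrime (q * k + i + 1) n
    · rw [cop_succ_of hn h5, cop_succ_of hnq ((h1 _ h4).2 h5), ← hi]
      ring
    · rw [cop_succ_of_not hn h5, cop_succ_of_not hnq (mt (h1 _ h4).1 h5), hi]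
  -- At the multiple q(k + 1) the count for nq stands still, while the count for n grows exactly
  -- when k + 1 is coprime to n.
  have outer (k : Len M) : cop (n * q) (q * k) + cop n k = cop n (q * k) := by
    refine len_induction (P := fun k => cop (n * q) (q * k) + cop n k = cop n (q * k))
      (by fun_prop) (by rw [mul_zero, cop_zero hn, cop_zero hnq, add_zero]) (fun k hk => ?_) k
    obtain ⟨l, hl⟩ := (len_cases q).resolve_left hq0
    have h4 := inner k hk l (by rw [hl]; exact Order.lt_add_one_iff.2 le_rfl)
    have h5 : q * (k + 1) = q * k + l + 1 := by
      rw [mul_add, mul_one, add_assoc, ← hl]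
    have h6 := h3 (k + 1)
    have h7 := h2 (k + 1)
    rw [h5] at h6 h7 ⊢
    rw [cop_succ_of_not hnq h6]
    by_cases h8 : IsRelPrime (k + 1) n
    · rw [cop_succ_of hn h8, cop_succ_of hn (h7.2 h8), ← add_assoc, h4]
    · rw [cop_succ_of_not hn h8, cop_succ_of_not hn (mt h7.1 h8), h4]
  rw [← cop_mul hn, mul_comm n q]
  have := outer n
  rwa [mul_comm n q] at this

end PVModel
end PVArith

namespace PVArith
namespace PVModel

variable {M : Type*} [PVModel M]

/-! ### A chain of divisors -/

/-- The least `d` with `2 ≤ d ≤ |J| + 1` such that `|N| * d` divides `|R|` in unary notation, and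
zero if there is none; the arguments are `(J, N, R)`. -/
def _root_.PVArith.Sym.factorUpTo : Sym 3 :=
  let z : Sym 4 := .ap1 .succ (.proj 0 + .proj 0)
  let d : Sym 4 := .ap1 .succ (z + z)
  let step : Sym 4 := .ap3 .cond (.proj 1) (.ap3 .cond
    (.ap2 .rem (.ap1 .size (.proj 3)) (.ap1 .size (.proj 2) * .ap1 .size d))
    (.ap2 .smash 1 d - 1) 0) (.proj 1)
  .lrn 0 step step (.ap2 .smash 1 (.ap1 .succ (.proj 0 + .proj 0)))

/-- The least `d ≥ 2` such that `n * d` divides `r`, and zero if there is none. -/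
noncomputable def factor (n r : Len M) : Len M := len (ev .factorUpTo ![ones r, ones n, ones r])

-- The least d ≥ 2 with n·d dividing r is prime, since a prime factor of it is a candidate as well.
-- If the search fails, no proper multiple of n divides r.
open Classical in
theorem factor_spec {n r : Len M} (hn : n ≠ 0) (hr : r ≠ 0) :
    (∀ N R, len N = n → len R = r → ev .factorUpTo ![R, N, R] = ones (factor n r)) ∧
    ((factor n r = 0 ∧ ∀ d, n * d ∣ r → d = 1) ∨
      Irreducible (factor n r) ∧ n * factor n r ∣ r) := by
  -- At a counter of length j the candidate is j + 2, produced in unary by applying y ↦ 2y + 1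
  -- twice.
  have hz (y : M) : len (y + y + 1) = len y + 1 := Subtype.ext (by simp [sz_odd])
  have key (N R : M) (hN : len N = n) (hR : len R = r) : ∃ T : Len M → Len M, Def M T ∧
      (∀ J, ev .factorUpTo ![J, N, R] = ones (T (len J))) ∧ T 0 = 0 ∧
      (∀ j, T (j + 1) = if T j = 0 then if n * (j + 1 + 1) ∣ r then j + 1 + 1 else 0 else T j) ∧
      ∀ j, T j ≤ j + 1 := by
    have hstep (y v : M) : ev (.ap3 .cond (.proj 1) (.ap3 .cond
        (.ap2 .rem (.ap1 .size (.proj 3)) (.ap1 .size (.proj 2) * .ap1 .size (.ap1 .succ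
          (.ap1 .succ (.proj 0 + .proj 0) + .ap1 .succ (.proj 0 + .proj 0)))))
        (.ap2 .smash 1 (.ap1 .succ
          (.ap1 .succ (.proj 0 + .proj 0) + .ap1 .succ (.proj 0 + .proj 0))) - 1) 0)
          (.proj 1) : Sym 4) (Fin.cons y (Fin.cons v ![N, R])) =
        if v = 0 then if n * (len y + 1 + 1) ∣ r then ones (len y + 1 + 1) else 0 else v := by
      have h1 : ((n * (len y + 1 + 1) : Len M) : M) ≠ 0 := by
        rw [Ne, ZeroMemClass.coe_eq_zero]
        exact mul_ne_zero hn (by simp)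
      simp only [cons_eq_vecCons, ev_ap3, ev_add, ev_mul, ev_sub, ev_one, ev_ap2, ev_ap1, ev_proj,
        ev_cond, ev_zero]
      change (if v = 0 then if rm (sz R) (sz N * sz (ev .succ ![ev .succ ![y + y] +
        ev .succ ![y + y] ])) = 0 then sm 1 (ev .succ ![ev .succ ![y + y] + ev .succ ![y + y] ]) - 1
        else 0 else v) = _
      rw [ev_succ, ev_succ, ← coe_len R, ← coe_len N, ← coe_len (y + y + 1 + (y + y + 1) + 1), hz,
        hz, hN, hR, ← ex_len, hz, hz, ← ones_eq, ← Subsemiring.coe_mul]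
      simp only [rm_eq_zero_iff h1, coe_dvd_coe]
    refine exists_lrn_recursion (A := Len M) (enc := ones) (dec := len) (by fun_prop)
      (by fun_prop) len_ones (g := 0) (c := ![N, R]) (a₀ := 0)
      (h := .ap3 .cond (.proj 1) (.ap3 .cond
        (.ap2 .rem (.ap1 .size (.proj 3)) (.ap1 .size (.proj 2) * .ap1 .size (.ap1 .succ
          (.ap1 .succ (.proj 0 + .proj 0) + .ap1 .succ (.proj 0 + .proj 0)))))
        (.ap2 .smash 1 (.ap1 .succ
          (.ap1 .succ (.proj 0 + .proj 0) + .ap1 .succ (.proj 0 + .proj 0))) - 1) 0)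
          (.proj 1))
      (H := fun j t => if t = 0 then if n * (j + 1 + 1) ∣ r then j + 1 + 1 else 0 else t)
      (b := .ap2 .smash 1 (.ap1 .succ (.proj 0 + .proj 0))) (P := fun j t => t ≤ j + 1)
      (B := fun j => ex (j + 1)) (by fun_prop) ((ev_zero _).trans ones_zero.symm)
      (fun y y' v h => ?_) (fun y a _ => ?_) (fun y => ?_) zero_le (fun j t h => ?_)
      fun j t h => ?_
    · rw [hstep, hstep, len_eq_iff.2 h]
    · rw [hstep]
      have : ones a = 0 ↔ a = 0 := by
        rw [← ones_zero]
        exact ⟨fun h => by rw [← len_ones a, h, len_ones], fun h => by rw [h]⟩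
      simp only [this]
      split_ifs
      · rfl
      · exact ones_zero.symm
      · rfl
    · simp only [cons_eq_vecCons, ev_add, ev_one, ev_ap2, ev_ap1, ev_proj]
      change sm 1 (ev .succ ![y + y]) = _
      rw [ev_succ, ← hz, ex_len]
    · split_ifs
      · exact le_rfl
      · exact zero_le
      · exact h.trans le_self_add
    · exact (ones_add_one t ▸ le_self_add : ones t ≤ ex t).trans (ex_mono h)
  obtain ⟨T, hT, hTJ, hT0, hTs, -⟩ := key (ones n) (ones r) (len_ones n) (len_ones r)
  have hf : factor n r = T r := by rw [factor, hTJ, len_ones, len_ones]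
  refine ⟨fun N R hN hR => ?_, ?_⟩
  · obtain ⟨T', hT', hTJ', hT0', hTs', -⟩ := key N R hN hR
    rw [hf, hTJ', hR, len_induction (P := fun j => T' j = T j) (by fun_prop) (by rw [hT0, hT0'])
      (fun j hj => by rw [hTs, hTs', hj])]
  rw [hf]
  have hmain := len_induction (P := fun j => (T j = 0 ∧ ∀ d < j + 1 + 1, n * d ∣ r → d ≤ 1) ∨
    (1 < T j ∧ n * T j ∣ r ∧ ∀ d < T j, n * d ∣ r → d ≤ 1)) ?_ ?_ (fun j hj => ?_) r
  · rcases hmain with ⟨h0, h1⟩ | ⟨h0, h1, h2⟩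
    · refine .inl ⟨h0, fun d hd => ?_⟩
      have hd0 : d ≠ 0 := by
        rintro rfl
        rw [mul_zero, zero_dvd_iff] at hd
        exact hr hd
      refine le_antisymm (h1 d ?_ hd) (len_one_le_iff.2 hd0)
      exact (Order.lt_add_one_iff.2 (len_le_of_dvd hr ((dvd_mul_left d n).trans hd))).trans
        (Order.lt_add_one_iff.2 le_rfl)
    · obtain ⟨q, hq, hqT⟩ := exists_prime_dvd h0
      have hT0 : T r ≠ 0 := (zero_lt_one.trans h0).ne'
      have : q = T r := by
        refine (len_le_of_dvd hT0 hqT).eq_of_not_lt fun h => ?_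
        exact (irreducible_len_iff.1 hq).1.not_ge (h2 q h ((mul_dvd_mul_left n hqT).trans h1))
      exact .inr ⟨this ▸ hq, h1⟩
  · refine .or (.and (by fun_prop) (.ball (by fun_prop) (.imp (by fun_prop) (by fun_prop))))
      (.and (by fun_prop) (.and (by fun_prop) (.ball hT (.imp (by fun_prop) (by fun_prop)))))
  · refine .inl ⟨hT0, fun d hd _ => ?_⟩
    rw [zero_add] at hd
    exact Order.lt_add_one_iff.1 hd
  · rcases hj with ⟨h0, h1⟩ | hj
    · rw [hTs, if_pos h0]
      split_ifs with h
      · exact .inr ⟨Order.lt_add_one_iff.2 le_add_self, h, h1⟩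
      · refine .inl ⟨rfl, fun d hd hdr => ?_⟩
        rcases (Order.lt_add_one_iff.1 hd).lt_or_eq with h2 | rfl
        · exact h1 d h2 hdr
        · exact absurd hdr h
    · rw [hTs, if_neg (zero_lt_one.trans hj.1).ne']
      exact .inr hj

/-- Starting with `1`, multiply `|I|` times by the least possible factor `d ≥ 2` such that the
product divides `|R|`, in unary notation; the arguments are `(I, R)`. -/
def _root_.PVArith.Sym.chain : Sym 2 :=
  let t : Sym 3 := .ap3 .factorUpTo (.proj 2) (.proj 1) (.proj 2)
  let step : Sym 3 := .ap3 .cond t (.proj 1) (.ap2 .smash (.proj 1) t - 1)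
  .lrn 1 step step (.ap2 .smash 1 (.proj 1))

/-- The `j`-th element of the chain of divisors of `r`. -/
noncomputable def chain (r j : Len M) : Len M := len (ev .chain ![ones j, ones r])

@[fun_prop] theorem _root_.PVArith.Def.chain {Γ : Type*} [Coded M Γ] {r j : Γ → Len M}
    (hr : Def M r) (hj : Def M j) : Def M fun γ => chain (r γ) (j γ) := by
  unfold PVModel.chain
  fun_prop

theorem ones_eq_zero {a : Len M} : ones a = 0 ↔ a = 0 := by
  rw [← ones_zero]
  exact ⟨fun h => by rw [← len_ones a, h, len_ones], fun h => by rw [h]⟩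

theorem ones_lt_ex (a : Len M) : ones a < ex a := by
  rw [← ones_add_one]
  exact Order.lt_add_one_iff.2 le_rfl

-- A successful step at least doubles the divisor, which therefore exceeds its index in the chain; a
-- failing step means that r is reached. So r steps suffice.
open Classical in
theorem chain_spec {r : Len M} (hr : r ≠ 0) :
    (∀ I R, len R = r → ev .chain ![I, R] = ones (chain r (len I))) ∧ chain r 0 = 1 ∧
    (∀ j, chain r (j + 1) = if factor (chain r j) r = 0 then chain r j
      else chain r j * factor (chain r j) r) ∧
    ∀ j, chain r j ∣ r ∧ (j < chain r j ∨ chain r j = r) := by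
  have key (R : M) (hR : len R = r) : ∃ T : Len M → Len M, Def M T ∧
      (∀ I, ev .chain ![I, R] = ones (T (len I))) ∧ T 0 = 1 ∧
      (∀ j, T (j + 1) = if factor (T j) r = 0 then T j else T j * factor (T j) r) ∧
      ∀ j, T j ∣ r ∧ (j < T j ∨ T j = r) := by
    refine exists_lrn_recursion (A := Len M) (enc := ones) (dec := len) (by fun_prop)
      (by fun_prop) len_ones (g := 1) (c := ![R]) (a₀ := 1)
      (h := .ap3 .cond (.ap3 .factorUpTo (.proj 2) (.proj 1) (.proj 2)) (.proj 1)
        (.ap2 .smash (.proj 1) (.ap3 .factorUpTo (.proj 2) (.proj 1) (.proj 2)) - 1))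
      (H := fun _ n => if factor n r = 0 then n else n * factor n r)
      (b := .ap2 .smash 1 (.proj 1)) (P := fun j n => n ∣ r ∧ (j < n ∨ n = r))
      (B := fun _ => ex r) (by fun_prop) ?_
      (fun y y' v h => ?_) (fun y n hn => ?_) (fun y => ?_) ⟨one_dvd r, .inl zero_lt_one⟩
      (fun j n h => ?_) fun j n h => ?_
    · rw [ev_one, ones_eq, ex_one, add_tsub_cancel_right]
    · simp only [cons_eq_vecCons, ev_ap3, ev_ap2, ev_proj, ev_sub, ev_one, ev_cond]
      rfl
    · have hn0 : n ≠ 0 := fun h => hr (zero_dvd_iff.1 (h ▸ hn.1))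
      simp only [cons_eq_vecCons, ev_ap3, ev_ap2, ev_proj, ev_sub, ev_one, ev_cond]
      change (if ev .factorUpTo ![R, ones n, R] = 0 then ones n else
        sm (ones n) (ev .factorUpTo ![R, ones n, R]) - 1) = _
      -- Smash multiplies unary numbers: subtracting 1 from 2^{ab} gives the code of the product.
      rw [(factor_spec hn0 hr).1 _ _ (len_ones n) hR, sm_eq_ex, len_ones, len_ones, ← ones_eq]
      simp only [ones_eq_zero]
      split_ifs <;> rfl
    · simp only [cons_eq_vecCons, ev_one, ev_ap2, ev_proj]
      change sm 1 R = _
      rw [← hR, ex_len]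
    · have hn0 : n ≠ 0 := fun h' => hr (zero_dvd_iff.1 (h' ▸ h.1))
      rcases (factor_spec hn0 hr).2 with ⟨h1, h2⟩ | ⟨h1, h2⟩
      · rw [if_pos h1]
        obtain ⟨d, hd⟩ := h.1
        refine ⟨h.1, .inr ?_⟩
        rw [hd, h2 d (by rw [← hd]), mul_one]
      · rw [if_neg h1.ne_zero]
        refine ⟨h2, ?_⟩
        have h3 : n < n * factor n r :=
          lt_mul_of_one_lt_right (pos_iff_ne_zero.2 hn0) (irreducible_len_iff.1 h1).1
        rcases h.2 with h4 | h4
        · exact .inl ((Order.add_one_le_iff.2 h4).trans_lt h3)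
        · exact absurd ((len_le_of_dvd hr h2).trans_eq h4.symm) h3.not_ge
    · exact (ones_lt_ex n).le.trans (ex_mono (len_le_of_dvd hr h.1))
  obtain ⟨T, hT, hTI, hT0, hTs, hTj⟩ := key (ones r) (len_ones r)
  have hcop : chain r = T := funext fun j => by rw [chain, hTI, len_ones, len_ones]
  rw [hcop]
  refine ⟨fun I R hR => ?_, hT0, hTs, hTj⟩
  obtain ⟨T', hT', hTI', hT0', hTs', -⟩ := key R hR
  rw [hTI']
  exact congrArg ones (len_induction (P := fun j => T' j = T j) (by fun_prop) (by rw [hT0, hT0'])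
    (fun j hj => by rw [hTs, hTs', hj]) _)

theorem chain_self {r : Len M} (hr : r ≠ 0) : chain r r = r := by
  obtain ⟨h1, h2⟩ := (chain_spec hr).2.2.2 r
  exact h2.resolve_left (len_le_of_dvd hr h1).not_gt

theorem chain_ne_zero {r : Len M} (hr : r ≠ 0) (j : Len M) : chain r j ≠ 0 := fun h =>
  hr (zero_dvd_iff.1 (h ▸ ((chain_spec hr).2.2.2 j).1))

end PVModel
end PVArith

namespace PVArith
namespace PVModel

variable {M : Type*} [PVModel M]

namespace Poly

set_option linter.unusedSectionVars false

variable {p : M} [hp : Fact (IsPrime p)]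

/-! ### The cyclotomic symbol -/

theorem val_C_add_Xp_mul_C {n : Len M} (hn : n ≠ 0) (a b : Fp p) :
    (C a + Xp n * C b).1 = rep a + rep b * ex (len p * n) := by
  obtain ⟨l, rfl⟩ := (len_cases n).resolve_left hn
  refine cf_ext hp.out.ne_zero fun i => ?_
  rw [← rep_co, co_add, ← shift_eq]
  rcases lt_or_ge i (l + 1) with hi | hi
  · rw [cf_add_mul_ex_of_lt _ _ hi, co_shift_of_lt _ hi, add_zero, rep_co]
    rfl
  · obtain ⟨k, rfl⟩ := exists_add_of_le hi
    rw [co_shift_add, add_right_comm, co_C_succ, zero_add, rep_co, add_right_comm l k 1,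
      cf_add_mul_ex]
    · rfl
    · refine (rep_lt a).trans ((lt_ex_len_mul_one p).trans_le (ex_mono ?_))
      exact mul_le_mul_right le_add_self _

theorem rep_one : rep (1 : Fp p) = 1 := by
  rw [← map_one (cls p), rep_cls, rm_of_lt hp.out.1]

theorem rep_neg_one : rep (-1 : Fp p) = p - 1 := by
  rw [neg_eq, mul_one, rep_cls, rm_of_lt]
  exact tsub_lt_self (pos_iff.2 hp.out.ne_zero) zero_lt_one

theorem C_neg_one : C (-1 : Fp p) = -1 := by
  rw [neg_def, one_def, ← C_mul, mul_one]

theorem val_bin {n : Len M} (hn : n ≠ 0) :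
    (bin n : Poly p).1 = 1 + (p - 1) * ex (len p * n) := by
  rw [← rep_one (p := p), rep_one, ← rep_neg_one, ← rep_one (p := p), ← val_C_add_Xp_mul_C hn,
    C_neg_one, ← one_def, bin]
  congr 1
  ring

theorem val_neg_bin {n : Len M} (hn : n ≠ 0) {R : M} (hR : len R = n) :
    ev .xPowSubOne ![p, R] = (-bin n : Poly p).1 := by
  have : (-bin n : Poly p) = C (-1) + Xp n * C 1 := by
    rw [C_neg_one, ← one_def, bin]
    ring
  rw [this, val_C_add_Xp_mul_C hn, rep_one, rep_neg_one, one_mul, Sym.xPowSubOne, ev_add, ev_ap2,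
    ev_sub, ev_one, ev_proj, ev_proj]
  change sm p R + (p - 1) = _
  rw [sm_eq_ex, hR, add_comm]

/-- The cyclotomic polynomial with index the `|I|`-th element of the chain of divisors of `|R|`,
up to the sign; the arguments are `(I, p, R)`. -/
def _root_.PVArith.Sym.cycUpTo : Sym 3 :=
  let n : Sym 4 := .ap2 .chain (.proj 0) (.proj 3)
  let t : Sym 4 := .ap3 .factorUpTo (.proj 3) n (.proj 3)
  let f : Sym 4 := .ap4 .substUpTo (.proj 1) (.proj 2) (.proj 1) t
  let step : Sym 4 := .ap3 .cond t (.proj 1) (.ap3 .cond (.ap2 .rem (.ap1 .size n) (.ap1 .size t)) f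
    (.ap4 .quoUpTo f (.proj 2) (.proj 1) f))
  .lrn (1 + (.proj 0 - 1) * .ap2 .smash 1 (.proj 0)) step step
    (.ap2 .smash (.proj 1) (.ap1 .succ (.proj 2 + .proj 2)))

theorem HasDeg.le_of_dvd {f g : Poly p} {d e : Len M} (hf : HasDeg f d) (hg : HasDeg g e)
    (h : f ∣ g) : d ≤ e := by
  obtain ⟨k, rfl⟩ := h
  obtain ⟨l, hl⟩ := exists_hasDeg (right_ne_zero_of_mul hg.ne_zero)
  rw [← (hf.mul hl).unique hg]
  exact le_self_add

-- The induction along the chain carries `IsCyclo` together with the equality of degree and totient.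
-- At step r the chain has arrived at r itself.
open Classical in
theorem exists_cyc {r : Len M} (hr : r ≠ 0) (hrp : (r : M) < p) {R : M} (hR : len R = r) :
    ∃ f : Poly p, ev .cycUpTo ![R, p, R] = f.1 ∧ IsCyclo r r f ∧
      ∃ d, HasDeg f d ∧ (d : M) = cop r r := by
  have hle (j : Len M) : chain r j ≤ r := len_le_of_dvd hr ((chain_spec hr).2.2.2 j).1
  have key : ∃ T : Len M → Poly p, Def M T ∧
      (∀ I, ev .cycUpTo ![I, p, R] = (T (len I)).1) ∧ T 0 = bin 1 ∧
      (∀ j, T (j + 1) = if factor (chain r j) r = 0 then T j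
        else if factor (chain r j) r ∣ chain r j then subst (factor (chain r j) r) (T j)
        else quo (T j) (subst (factor (chain r j) r) (T j))) ∧
      ∀ j, IsCyclo r (chain r j) (T j) ∧ ∃ d < r + 1, HasDeg (T j) d ∧
        (d : M) = cop (chain r j) (chain r j) := by
    have hev (y : M) : ev .chain ![y, R] = ones (chain r (len y)) := (chain_spec hr).1 _ _ hR
    have hfac (y : M) : ev .factorUpTo ![R, ev .chain ![y, R], R] =
        ones (factor (chain r (len y)) r) := by
      rw [hev]
      exact (factor_spec (chain_ne_zero hr _) hr).1 _ _ (len_ones _) hR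
    have hstep (y v : M) : ev (.ap3 .cond
        (.ap3 .factorUpTo (.proj 3) (.ap2 .chain (.proj 0) (.proj 3)) (.proj 3)) (.proj 1)
        (.ap3 .cond (.ap2 .rem (.ap1 .size (.ap2 .chain (.proj 0) (.proj 3)))
          (.ap1 .size (.ap3 .factorUpTo (.proj 3) (.ap2 .chain (.proj 0) (.proj 3)) (.proj 3))))
          (.ap4 .substUpTo (.proj 1) (.proj 2) (.proj 1)
            (.ap3 .factorUpTo (.proj 3) (.ap2 .chain (.proj 0) (.proj 3)) (.proj 3)))
          (.ap4 .quoUpTo (.ap4 .substUpTo (.proj 1) (.proj 2) (.proj 1)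
            (.ap3 .factorUpTo (.proj 3) (.ap2 .chain (.proj 0) (.proj 3)) (.proj 3))) (.proj 2)
            (.proj 1) (.ap4 .substUpTo (.proj 1) (.proj 2) (.proj 1)
            (.ap3 .factorUpTo (.proj 3) (.ap2 .chain (.proj 0) (.proj 3)) (.proj 3))))) : Sym 4)
        (Fin.cons y (Fin.cons v ![p, R])) =
        if factor (chain r (len y)) r = 0 then v
        else if factor (chain r (len y)) r ∣ chain r (len y) then
          ev .substUpTo ![v, p, v, ones (factor (chain r (len y)) r)]
        else ev .quoUpTo ![ev .substUpTo ![v, p, v, ones (factor (chain r (len y)) r)], p, v,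
          ev .substUpTo ![v, p, v, ones (factor (chain r (len y)) r)] ] := by
      simp only [cons_eq_vecCons, ev_ap3, ev_ap4, ev_ap2, ev_ap1, ev_proj, ev_cond]
      change (if ev .factorUpTo ![R, ev .chain ![y, R], R] = 0 then v else
        if rm (sz (ev .chain ![y, R])) (sz (ev .factorUpTo ![R, ev .chain ![y, R], R])) = 0 then
          ev .substUpTo ![v, p, v, ev .factorUpTo ![R, ev .chain ![y, R], R] ]
        else ev .quoUpTo ![ev .substUpTo ![v, p, v, ev .factorUpTo ![R, ev .chain ![y, R], R] ], p,
          v, ev .substUpTo ![v, p, v, ev .factorUpTo ![R, ev .chain ![y, R], R] ] ]) = _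
      rw [hfac, hev, sz_ones, sz_ones]
      by_cases h0 : factor (chain r (len y)) r = 0
      · rw [if_pos h0, if_pos (ones_eq_zero.2 h0)]
      · have h1 : ((factor (chain r (len y)) r : Len M) : M) ≠ 0 := by
          rwa [Ne, ZeroMemClass.coe_eq_zero]
        rw [if_neg h0, if_neg (mt ones_eq_zero.1 h0)]
        simp only [rm_eq_zero_iff h1, coe_dvd_coe]
    have hsubst (F : Poly p) {q : Len M} (hq : q ≠ 0) :
        ev .substUpTo ![F.1, p, F.1, ones q] = (subst q F).1 := by
      obtain ⟨T, -, -, -, -, h, -⟩ := exists_subst hq F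
      exact h _ (len_ones q)
    refine exists_poly_recursion (p := p) (g := 1 + (.proj 0 - 1) * .ap2 .smash 1 (.proj 0))
      (c := ![p, R]) (F₀ := bin 1)
      (h := .ap3 .cond
        (.ap3 .factorUpTo (.proj 3) (.ap2 .chain (.proj 0) (.proj 3)) (.proj 3)) (.proj 1)
        (.ap3 .cond (.ap2 .rem (.ap1 .size (.ap2 .chain (.proj 0) (.proj 3)))
          (.ap1 .size (.ap3 .factorUpTo (.proj 3) (.ap2 .chain (.proj 0) (.proj 3)) (.proj 3))))
          (.ap4 .substUpTo (.proj 1) (.proj 2) (.proj 1)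
            (.ap3 .factorUpTo (.proj 3) (.ap2 .chain (.proj 0) (.proj 3)) (.proj 3)))
          (.ap4 .quoUpTo (.ap4 .substUpTo (.proj 1) (.proj 2) (.proj 1)
            (.ap3 .factorUpTo (.proj 3) (.ap2 .chain (.proj 0) (.proj 3)) (.proj 3))) (.proj 2)
            (.proj 1) (.ap4 .substUpTo (.proj 1) (.proj 2) (.proj 1)
            (.ap3 .factorUpTo (.proj 3) (.ap2 .chain (.proj 0) (.proj 3)) (.proj 3))))))
      (b := .ap2 .smash (.proj 1) (.ap1 .succ (.proj 2 + .proj 2)))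
      (P := fun j F => IsCyclo r (chain r j) F ∧ ∃ d < r + 1, HasDeg F d ∧
        (d : M) = cop (chain r j) (chain r j))
      (H := fun j F => if factor (chain r j) r = 0 then F
        else if factor (chain r j) r ∣ chain r j then subst (factor (chain r j) r) F
        else quo F (subst (factor (chain r j) r) F)) (B := fun _ => ex (len p * (r + 1)))
      -- The bound d ≤ r in the invariant makes the quantifier over degrees definable and keeps the
      -- codes below the bound 2^{|p|(r + 1)}.
      (.and (by fun_prop) (.bex (by fun_prop) (by fun_prop))) ?_ (fun y y' v h => ?_)
      (fun y F hF => ?_) (fun y => ?_) ?_ (fun j F hF => ?_) fun j F hF => ?_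
    · simp only [ev_one, ev_add, ev_mul, ev_sub, ev_ap2, ev_proj]
      change 1 + (p - 1) * sm 1 p = _
      rw [val_bin one_ne_zero, mul_one, ex_len]
    · rw [hstep, hstep, len_eq_iff.2 h]
    · rw [hstep]
      split_ifs with h1 h2
      · rfl
      · exact hsubst F h1
      · rw [hsubst F h1]
        have hq := ((factor_spec (chain_ne_zero hr (len y)) hr).2.resolve_left fun h => h1 h.1)
        have := (hF.1.quo_of_not_dvd (chain_ne_zero hr (len y)) hq.1 h2
          (len_le_of_dvd hr ((dvd_mul_left _ _).trans hq.2)) hrp).1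
        exact quo_eq hF.1.dv.1 this
    · simp only [cons_eq_vecCons, ev_ap2, ev_ap1, ev_proj, ev_add]
      change sm p (ev .succ ![R + R]) = _
      rw [ev_succ, sm_eq_ex, show len (R + R + 1) = r + 1 from Subtype.ext (by simp [sz_odd, ← hR])]
    · rw [(chain_spec hr).2.1]
      refine ⟨isCyclo_one r, 1, ?_, hasDeg_bin one_ne_zero, ?_⟩
      · exact Order.lt_add_one_iff.2 (len_one_le_iff.2 hr)
      · rw [cop_one, OneMemClass.coe_one]
    · have hn0 := chain_ne_zero hr j
      obtain ⟨hF, d, hdr, hd, hdc⟩ := hF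
      rw [(chain_spec hr).2.2.1]
      rcases (factor_spec hn0 hr).2 with ⟨h1, -⟩ | ⟨h1, h2⟩
      · rw [if_pos h1, if_pos h1]
        exact ⟨hF, d, hdr, hd, hdc⟩
      · rw [if_neg h1.ne_zero, if_neg h1.ne_zero]
        have hlt {F' : Poly p} {e : Len M} (hF' : IsCyclo r (chain r j * factor (chain r j) r) F')
            (he : HasDeg F' e) : e < r + 1 :=
          -- The new polynomial divides 1 - X^{nq}, and nq divides r, so its degree is at most r.
          Order.lt_add_one_iff.2 ((he.le_of_dvd (hasDeg_bin (mul_ne_zero hn0 h1.ne_zero))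
            hF'.dv.2).trans (len_le_of_dvd hr h2))
        by_cases h3 : factor (chain r j) r ∣ chain r j
        · rw [if_pos h3]
          have h4 := hF.subst_of_dvd hn0 h1 h3
          have h5 := hd.subst h1.ne_zero
          refine ⟨h4, _, hlt h4 h5, h5, ?_⟩
          rw [cop_mul_self_of_dvd hn0 h1.ne_zero h3, ← hdc, Subsemiring.coe_mul]
        · rw [if_neg h3]
          obtain ⟨h6, h4⟩ := hF.quo_of_not_dvd hn0 h1 h3
            (len_le_of_dvd hr ((dvd_mul_left _ _).trans h2)) hrp
          obtain ⟨e, he⟩ := exists_hasDeg (ne_zero_of_co_zero h4.dv.1)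
          -- Comparing degrees in f·F = f(X^q) gives the same relation as the totient satisfies,
          -- which determines the degree of F.
          have h7 : d + e = factor (chain r j) r * d :=
            (hd.mul he).unique (by rw [h6]; exact hd.subst h1.ne_zero)
          refine ⟨h4, e, hlt h4 he, he, ?_⟩
          have h8 := cop_mul_self_of_not_dvd hn0 h1 h3
          rw [← hdc, ← Subsemiring.coe_mul, ← h7, Subsemiring.coe_add, add_comm (d : M)] at h8
          exact (add_right_cancel h8).symm
    · obtain ⟨hF, d, hdr, hd, hdc⟩ := hF
      refine (drop_eq_zero_iff_lt.1 (drop_eq_zero_mono hd.1 ?_)).le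
      exact Order.add_one_le_iff.2 hdr
  obtain ⟨T, -, hTI, -, -, hT⟩ := key
  obtain ⟨h1, d, -, h2⟩ := hT r
  rw [chain_self hr] at h1 h2
  exact ⟨T r, by rw [hTI, hR], h1, d, h2⟩

end Poly

end PVModel
end PVArith

namespace PVArith
namespace PVModel

variable {M : Type*} [PVModel M]


set_option linter.unusedSectionVars false

variable {p : M} [hp : Fact (IsPrime p)]

/-! ### The meaning of the formulas -/

section

variable {n : ℕ} {v : Empty → M} {xs : Fin n → M} {P f g : Tm n}

@[simp] theorem realize_up_snoc (t : Tm n) (c : M) :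
    (up t).realize (Sum.elim v (Fin.snoc xs c)) = t.realize (Sum.elim v xs) := by
  simp only [realize_up, Fin.snoc_castSucc]

@[simp] theorem realize_new_snoc (c : M) :
    (new : Tm (n + 1)).realize (Sum.elim v (Fin.snoc xs c)) = c := by
  simp only [realize_new, Fin.snoc_last]

@[simp] theorem realize_lt : (lt f g).Realize v xs ↔
    f.realize (Sum.elim v xs) < g.realize (Sum.elim v xs) := by
  rw [lt, realize_le, realize_S, ev_succ, lt_iff_succ_le]

theorem realize_prime : (prime P).Realize v xs ↔ IsPrime (P.realize (Sum.elim v xs)) := by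
  simp only [prime, dvd, BoundedFormula.realize_inf, BoundedFormula.realize_all,
    BoundedFormula.realize_imp, BoundedFormula.realize_ex, BoundedFormula.realize_sup, realize_lt,
    realize_le, realize_eq, realize_one, realize_mul, realize_up_snoc, realize_new_snoc, IsPrime]
  -- The formula tests only numbers up to `p`, but every divisor of the nonzero number `p` is among
  -- them.
  refine and_congr_right fun h => forall_congr' fun d => ?_
  constructor
  · rintro H ⟨e, he⟩
    exact H (le_of_dvd' (zero_lt_one.trans h).ne' ⟨e, he⟩) ⟨e, he.symm⟩
  · rintro H - ⟨e, he⟩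
    exact H ⟨e, he.symm⟩

theorem realize_coef (I : Tm n) : (coef I P f).realize (Sum.elim v xs) =
    cf (P.realize (Sum.elim v xs)) (f.realize (Sum.elim v xs))
      (len (I.realize (Sum.elim v xs))) := by
  rw [← coef_eq_cf, coef, realize_ap, comp_vec3]

theorem realize_polyMul : (polyMul P f g).realize (Sum.elim v xs) =
    ev .polyMul ![P.realize (Sum.elim v xs), f.realize (Sum.elim v xs),
      g.realize (Sum.elim v xs)] := by
  rw [polyMul, realize_ap, comp_vec3]

theorem realize_polyAdd : (polyAdd P f g).realize (Sum.elim v xs) =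
    ev .polyAdd ![P.realize (Sum.elim v xs), f.realize (Sum.elim v xs),
      g.realize (Sum.elim v xs)] := by
  rw [polyAdd, realize_ap, comp_vec3]

variable {p : M} [hp : Fact (IsPrime p)] (hP : P.realize (Sum.elim v xs) = p)

include hP

/-- The formula quantifies over numbers I ≤ f and uses the index |I|. Each index i < |f| arises from
I = `ones i`, and the coefficients beyond vanish. -/
theorem realize_isPoly :
    (isPoly P f).Realize v xs ↔ IsPoly p (f.realize (Sum.elim v xs)) := by
  simp only [isPoly, BoundedFormula.realize_all, BoundedFormula.realize_imp, realize_lt,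
    realize_le, realize_coef, realize_up_snoc, realize_new_snoc, hP]
  refine ⟨fun h => Poly.isPoly_iff.2 fun i hi => ?_, fun h I _ => h _⟩
  rw [← len_ones i]
  refine h _ ((ones_lt_ex i).le.trans ?_)
  rw [← not_lt, lt_ex_iff, not_le]
  exact hi

theorem realize_polyDvd {F G : Poly p} (hF : f.realize (Sum.elim v xs) = F.1)
    (hG : g.realize (Sum.elim v xs) = G.1) : (polyDvd P f g).Realize v xs ↔ F ∣ G := by
  simp only [polyDvd, BoundedFormula.realize_ex, BoundedFormula.realize_inf, realize_eq,
    realize_polyMul, realize_up_snoc, realize_new_snoc, hP, hF, hG]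
  have h (c : M) : (isPoly (up P) new).Realize v (Fin.snoc xs c : Fin (n + 1) → M) ↔
      IsPoly p c := by
    rw [realize_isPoly (p := p) (by rwa [realize_up_snoc]), realize_new_snoc]
  simp only [h]
  constructor
  · rintro ⟨c, hc, hcG⟩
    exact ⟨⟨c, hc⟩, Poly.val_inj.1 (hcG.symm.trans (Poly.val_mul F ⟨c, hc⟩).symm)⟩
  · rintro ⟨H, rfl⟩
    exact ⟨H.1, H.2, (Poly.val_mul _ _).symm⟩

theorem realize_hasDegree {F : Poly p} (hF : f.realize (Sum.elim v xs) = F.1) {d : Len M}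
    (hg : g.realize (Sum.elim v xs) = d) (hd : Poly.HasDeg F d) :
    (hasDegree P f g).Realize v xs := by
  simp only [hasDegree, BoundedFormula.realize_inf, realize_lt, realize_le, realize_mul,
    realize_size, realize_S, hP, hF, hg]
  constructor
  · by_contra! h
    have : F.drop d = 0 := by
      rw [Poly.drop_eq_zero_iff_lt, lt_ex_iff]
      exact h
    exact hd.2 (Poly.drop_eq_zero_iff.1 this d le_rfl)
  · have := Poly.drop_eq_zero_iff_lt.1 hd.1
    rw [lt_ex_iff] at this
    rw [ev_succ]
    exact this

theorem val_one : (1 : Poly p).1 = 1 := Poly.rep_one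

/-- A relation a·F + b·G = 1 provides the last condition directly and shows that every common
divisor divides 1. -/
theorem realize_isPolyGcd_one {F G : Poly p} (hF : f.realize (Sum.elim v xs) = F.1)
    (hG : g.realize (Sum.elim v xs) = G.1) (h : IsCoprime F G) :
    (isPolyGcd P f g 1).Realize v xs := by
  have h1 : (1 : Tm n).realize (Sum.elim v xs) = (1 : Poly p).1 := by
    rw [realize_one, val_one hP]
  obtain ⟨a, b, hab⟩ := h
  have hup (c : M) : (up P).realize (Sum.elim v (Fin.snoc xs c)) = p := by
    rwa [realize_up_snoc]
  rw [isPolyGcd, BoundedFormula.realize_inf, BoundedFormula.realize_inf,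
    BoundedFormula.realize_inf, BoundedFormula.realize_inf, BoundedFormula.realize_inf]
  refine ⟨⟨⟨⟨⟨?_, ?_⟩, ?_⟩, ?_⟩, ?_⟩, ?_⟩
  · rw [realize_isPoly hP, h1]
    exact (1 : Poly p).2
  · simp only [monic, BoundedFormula.realize_ex, BoundedFormula.realize_inf, realize_eq,
      realize_lt, realize_coef, realize_smash, realize_S, realize_add, realize_up_snoc,
      realize_new_snoc, hP, h1]
    -- The constant polynomial 1 has its leading coefficient at index 0, and its code is below p # 1
    -- = 2^|p|.
    refine ⟨0, ?_, ?_⟩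
    · rw [show len (0 : M) = 0 from Subtype.ext sz_zero, ← Poly.rep_co, Poly.co_one_zero,
        Poly.rep_one, realize_one]
    · rw [add_zero, ev_succ, zero_add, sm_eq_ex, show len (1 : M) = 1 from Subtype.ext sz_one,
        ← Poly.drop_eq_zero_iff_lt, Poly.one_def, Poly.drop_C]
  · rw [realize_polyDvd hP h1 hF]
    exact one_dvd F
  · rw [realize_polyDvd hP h1 hG]
    exact one_dvd G
  · rw [BoundedFormula.realize_all]
    intro c
    rw [BoundedFormula.realize_imp, BoundedFormula.realize_inf, BoundedFormula.realize_inf]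
    rintro ⟨⟨hc, hcF⟩, hcG⟩
    rw [realize_isPoly (hup c), realize_new_snoc] at hc
    have hc' : (new : Tm (n + 1)).realize (Sum.elim v (Fin.snoc xs c)) = (⟨c, hc⟩ : Poly p).1 :=
      realize_new_snoc c
    rw [realize_polyDvd (hup c) hc' (by rwa [realize_up_snoc])] at hcF hcG ⊢
    rw [← hab]
    exact (hcF.mul_left a).add (hcG.mul_left b)
  · simp only [BoundedFormula.realize_ex, BoundedFormula.realize_inf]
    refine ⟨a.1, b.1, ⟨?_, ?_⟩, ?_⟩
    · rw [realize_isPoly (p := p) (by simpa using hP), realize_up_snoc, realize_new_snoc]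
      exact a.2
    · rw [realize_isPoly (p := p) (by simpa using hP), realize_new_snoc]
      exact b.2
    · simp only [realize_eq, realize_polyAdd, realize_polyMul, realize_up_snoc, realize_new_snoc,
        hP, hF, hG, h1]
      rw [← Poly.val_mul, ← Poly.val_mul, ← Poly.val_add, hab]

end

end PVModel

/-- The cyclotomic polynomial with index `|R|` over `ℤ/p`, up to the sign; the arguments are
`(p, R)`. -/
def Sym.cyc : Sym 2 := .ap3 .cycUpTo (.proj 1) (.proj 0) (.proj 1)

/-! ### The theorem in a single model -/

namespace PVModel

variable {M : Type*} [PVModel M]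

/-- The construction works with 1 - X^n, the statement with X^n - 1; divisibility and coprimality
are insensitive to the sign. -/
theorem realize_cyc_spec (xs : Fin 2 → M) :
    (prime (x 0) ⊓ allOnes (x 1) ⊓ le 1 (size (x 1)) ⊓ lt (size (x 1)) (x 0) ⟹
        isPoly (x 0) (ap .cyc ![x 0, x 1]) ⊓
        hasDegree (x 0) (ap .cyc ![x 0, x 1]) (tot (x 1)) ⊓
        polyDvd (x 0) (ap .cyc ![x 0, x 1]) (xPowSubOne (x 0) (x 1)) ⊓
        ∀' (allOnes (x 2) ⊓ le 1 (size (x 2)) ⊓ lt (size (x 2)) (size (x 1)) ⟹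
          isPolyGcd (x 0) (ap .cyc ![x 0, x 1]) (xPowSubOne (x 0) (x 2)) 1)).Realize
      (default : Empty → M) xs := by
  simp only [BoundedFormula.realize_imp, BoundedFormula.realize_inf, BoundedFormula.realize_all]
  rintro ⟨⟨⟨hp, -⟩, hr⟩, hrp⟩
  rw [realize_prime] at hp
  simp only [realize_le, realize_lt, realize_size, realize_one, realize_x] at hr hrp hp
  have : Fact (IsPrime (xs 0)) := ⟨hp⟩
  have hr0 : len (xs 1) ≠ 0 := fun h => one_le_iff.1 hr (congrArg Subtype.val h)
  obtain ⟨F, hF, hcyc, d, hd, hdc⟩ := Poly.exists_cyc (p := xs 0) hr0 hrp rfl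
  have hF' : ev .cyc ![xs 0, xs 1] = F.1 := by
    rw [Sym.cyc, ev_ap3, ev_proj, ev_proj]
    exact hF
  have hF2 : (ap .cyc ![x 0, x 1] : Tm 2).realize (Sum.elim default xs) = F.1 := by
    rw [realize_ap, comp_vec2]
    exact hF'
  have hx : (x 0 : Tm 2).realize (Sum.elim (default : Empty → M) xs) = xs 0 := rfl
  refine ⟨⟨⟨?_, ?_⟩, ?_⟩, fun R' => ?_⟩
  · rw [realize_isPoly (p := xs 0) hx, hF2]
    exact F.2
  · refine realize_hasDegree (p := xs 0) hx hF2 (d := d) ?_ hd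
    rw [hdc, tot, realize_ap, comp_vec1]
    exact ev_tot hr0 rfl
  · refine (realize_polyDvd (p := xs 0) hx hF2 (G := -Poly.bin (len (xs 1))) ?_).2
      ((dvd_neg).2 hcyc.dv.2)
    rw [xPowSubOne, realize_ap, comp_vec2]
    exact Poly.val_neg_bin (p := xs 0) hr0 rfl
  · rintro ⟨⟨-, h1⟩, h2⟩
    simp only [realize_le, realize_lt, realize_size, realize_one] at h1 h2
    change 1 ≤ sz R' at h1
    change sz R' < sz (xs 1) at h2
    have hr' : len R' ≠ 0 := fun h => one_le_iff.1 h1 (congrArg Subtype.val h)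
    have hx' : (x 0 : Tm 3).realize (Sum.elim (default : Empty → M) (Fin.snoc xs R')) = xs 0 := rfl
    refine realize_isPolyGcd_one (p := xs 0) hx' (F := F) (G := -Poly.bin (len R')) ?_ ?_
      ((hcyc.isCoprime hr0 hrp hr' h2).neg_right)
    · rw [realize_ap, comp_vec2]
      exact hF'
    · rw [xPowSubOne, realize_ap, comp_vec2]
      exact Poly.val_neg_bin (p := xs 0) hr' rfl

end PVModel
end PVArith

open PVArith in
theorem mainTheorem7 :
    ∃ Cyc : Sym 2, PV1Proves (close (n := 2)
      (prime (x 0) ⊓ allOnes (x 1) ⊓ le 1 (size (x 1)) ⊓ lt (size (x 1)) (x 0) ⟹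
        isPoly (x 0) (ap Cyc ![x 0, x 1]) ⊓
        hasDegree (x 0) (ap Cyc ![x 0, x 1]) (tot (x 1)) ⊓
        polyDvd (x 0) (ap Cyc ![x 0, x 1]) (xPowSubOne (x 0) (x 1)) ⊓
        ∀' (allOnes (x 2) ⊓ le 1 (size (x 2)) ⊓ lt (size (x 2)) (size (x 1)) ⟹
          isPolyGcd (x 0) (ap Cyc ![x 0, x 1]) (xPowSubOne (x 0) (x 2)) 1))) := by
  -- The symbol is fixed before the model, so one symbol serves for all models.
  refine ⟨Sym.cyc, Theory.models_sentence_iff.2 fun M => ?_⟩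
  let _ : PVModel M := ⟨M.is_model⟩
  exact PVModel.realize_close.2 fun xs => PVModel.realize_cyc_spec xs
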